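/- Let $F$ be a non-archimedean local field with ring of integers $\mathfrak{o}_F$, maximal ideal $\mathfrak{p}_F$ and normalized valuation $v_F : F \to \mathbb{Z}\cup\{\infty\}$, and let $\psi : F \to \mathbb{C}^\times$ be a smooth additive character of conductor $\mathfrak{p}_F$ (trivial on $\mathfrak{p}_F$, not trivial on $\mathfrak{o}_F$). Let $D$ be a finite-dimensional central division $F$-algebra with ring of integers $\mathfrak{o}_D$ and maximal ideal $\mathfrak{p}_D$, let $V$ be a finite-dimensional right $D$-vector space, and put $A = \operatorname{End}_D(V)$ and $G = A^\times$ (so $G \cong \mathrm{GL}_m(D)$ with $m = \dim_D V$); let $\operatorname{Trd}_{A/F} : A \to F$ be the reduced trace. Let $\mathfrak{A} \subset A$ be a principal hereditary $\mathfrak{o}_F$-order, that is, $\mathfrak{A} = \{a \in A : a\mathcal{L}_j \subset \mathcal{L}_j \text{ for all } j \in \mathbb{Z}\}$ for a strictly decreasing sequence $(\mathcal{L}_i)_{i\in\mathbb{Z}}$ of compact open $\mathfrak{o}_D$-submodules of $V$ such that $\mathcal{L}_{i+r} = \mathcal{L}_i\mathfrak{p}_D$ for all $i$, for some integer $r \ge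 1$, and such that the index $[\mathcal{L}_i : \mathcal{L}_{i+1}]$ does not depend on $i$. Let $\mathfrak{P}$ be the Jacobson radical of $\mathfrak{A}$, put $\mathrm{U}^0(\mathfrak{A}) = \mathfrak{A}^\times$ and $\mathrm{U}^k(\mathfrak{A}) = 1 + \mathfrak{P}^k$ for $k \ge 1$, and let $e = e(\mathfrak{A}|\mathfrak{o}_F)$ be the positive integer with $\varpi_F\mathfrak{A} = \mathfrak{P}^{e}$, where $\varpi_F$ is a uniformizer of $F$. Let $\chi : G \to \mathbb{C}^\times$ be a smooth character (a homomorphism with open kernel), and let $n \ge 0$ be an integer such that $\chi$ is trivial on $\mathrm{U}^{n+1}(\mathfrak{A})$ but not trivial on $\mathrm{U}^{n}(\mathfrak{A})$. Then there exists $c \in F$ with $v_F(c) = -n/e$ (in particular $c \neq 0$) such that \[ \chi(1+y) = \psi\bigl(\operatorname{Trd}_{A/F}(cy)\bigr) \qquad \text{for all } y \in \mathfrak{P}^{\lfloor n/2\rfloor+1}. \] -/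

import Mathlib

open ValuativeRel IsNonarchimedeanLocalField

noncomputable section

namespace PrincipalOrderCharacter

/-- The normalized additive valuation `v_F` of a non-archimedean local field, with values in `ℤ`.
(The value at `0`, which should be `∞`, is the junk value `0`.) -/
def addVal (F : Type*) [Field F] [ValuativeRel F] [TopologicalSpace F]
    [IsNonarchimedeanLocalField F] (x : F) : ℤ :=
  -WithZero.log (valueGroupWithZeroIsoInt F (valuation F x))

/-- The additive character `ψ` of `F` has conductor `𝔭_F`: it is trivial on `𝔭_F`, but not
on `𝔬_F`. (In particular `ψ` is smooth.) -/
def HasConductorMaximalIdeal {F : Type*} [Field F] [ValuativeRel F] (ψ : AddChar F ℂ) : Prop :=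
  (∀ x : F, valuation F x < 1 → ψ x = 1) ∧ ∃ x : F, valuation F x ≤ 1 ∧ ψ x ≠ 1

/-- `t` is the reduced trace of the element `a` of the central simple `F`-algebra `A`, where
`dim_F A = N ^ 2`: the trace of the image of `a` under an embedding of `F`-algebras
`A → M_N(F^alg)` is `t`. Such embeddings exist and any two are conjugate. -/
def IsReducedTrace {F A : Type*} [Field F] [Ring A] [Algebra F A] (a : A) (t : F) : Prop :=
  ∀ φ : A →ₐ[F] Matrix (Fin (Module.finrank F A).sqrt) (Fin (Module.finrank F A).sqrt)
      (AlgebraicClosure F),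
    (φ a).trace = algebraMap F (AlgebraicClosure F) t

open Classical in
/-- The reduced trace `Trd_{A/F} : A → F` of a central simple `F`-algebra `A`. -/
def reducedTrace (F : Type*) {A : Type*} [Field F] [Ring A] [Algebra F A] (a : A) : F :=
  if h : ∃ t : F, IsReducedTrace a t then h.choose else 0

section Lattices

variable (F D V : Type*) [Field F] [ValuativeRel F] [DivisionRing D] [Algebra F D]

/-- The ring of integers `𝔬_D` of `D`: the elements that are integral over `𝔬_F`. -/
def integers : Set D := {x | IsIntegral 𝒪[F] x}

/-- The maximal ideal `𝔭_D` of `𝔬_D`: the non-units of `𝔬_D`. -/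
def maximalIdeal : Set D := {x | x ∈ integers F D ∧ ∀ y ∈ integers F D, x * y ≠ 1}

variable {V} [TopologicalSpace F] [AddCommGroup V] [Module F V] [Module Dᵐᵒᵖ V]

/-- An `𝔬_D`-lattice in the right `D`-module `V`: a compact open subgroup that is stable under
right multiplication by `𝔬_D`. The topology of `V` is its topology as a finite-dimensional
`F`-vector space. -/
structure IsLattice (L : AddSubgroup V) : Prop where
  smul_mem : ∀ x ∈ integers F D, ∀ v ∈ L, MulOpposite.op x • v ∈ L
  isCompact : @IsCompact V (moduleTopology F V) (L : Set V)
  isOpen : @IsOpen V (moduleTopology F V) (L : Set V)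

/-- The subgroup `L 𝔭_D` of `V`. -/
def mulMaximalIdeal (L : AddSubgroup V) : AddSubgroup V :=
  AddSubgroup.closure {w | ∃ v ∈ L, ∃ x ∈ maximalIdeal F D, w = MulOpposite.op x • v}

/-- `𝔬_D`-sequences `(L i)_{i ∈ ℤ}` in `V`. -/
structure IsLatticeSequence (L : ℤ → AddSubgroup V) : Prop where
  isLattice : ∀ i, IsLattice F D (L i)
  antitone : ∀ i j, i < j → L j ≤ L i
  periodic : ∃ e : ℕ, 0 < e ∧ ∀ i, L (i + e) = mulMaximalIdeal F D (L i)

/-- `𝔬_D`-chains: the `𝔬_D`-sequences with strict inclusions. -/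
structure IsLatticeChain (L : ℤ → AddSubgroup V) : Prop extends IsLatticeSequence F D L where
  strict : ∀ i, L (i + 1) < L i

/-- Uniform `𝔬_D`-chains: the index `[L i : L (i + 1)]` does not depend on `i`. -/
structure IsUniformChain (L : ℤ → AddSubgroup V) : Prop extends IsLatticeChain F D L where
  uniform : ∀ i j, (L (i + 1)).relIndex (L i) = (L (j + 1)).relIndex (L j)

/-- The `𝔬_F`-subalgebra `𝔄` of `A = End_D(V)` is a principal hereditary order: it is the order
`{a ∈ A | a (L j) ⊆ L j for all j}` attached to a uniform `𝔬_D`-chain `L` in `V`. -/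
def IsPrincipalOrder [IsScalarTower F Dᵐᵒᵖ V] (𝔄 : Subalgebra 𝒪[F] (Module.End Dᵐᵒᵖ V)) :
    Prop :=
  ∃ L : ℤ → AddSubgroup V, IsUniformChain F D L ∧
    ∀ a : Module.End Dᵐᵒᵖ V, a ∈ 𝔄 ↔ ∀ j, ∀ v ∈ L j, a v ∈ L j

end Lattices

section Orders

variable {F A : Type*} [Field F] [ValuativeRel F] [Ring A] [Algebra F A]

/-- The power `𝔓 ^ n` of the (Jacobson) radical `𝔓` of the order `𝔄`, as a subset of `A`. -/
def radicalPow (𝔄 : Subalgebra 𝒪[F] A) (n : ℕ) : Set A :=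
  Subtype.val '' ((Ring.jacobson 𝔄 ^ n : Ideal 𝔄) : Set 𝔄)

/-- The groups `U^0(𝔄) = 𝔄ˣ` and `U^n(𝔄) = 1 + 𝔓 ^ n` for `n > 0`, as subsets of `Aˣ`. -/
def unitFiltration (𝔄 : Subalgebra 𝒪[F] A) : ℕ → Set Aˣ
  | 0 => {u | (u : A) ∈ 𝔄 ∧ ((u⁻¹ : Aˣ) : A) ∈ 𝔄}
  | n + 1 => {u | ∃ y ∈ radicalPow 𝔄 (n + 1), (u : A) = 1 + y}

/-- The integer `e(𝔄|𝔬_F)`: the exponent `e` with `ϖ_F 𝔄 = 𝔓 ^ e`, where `ϖ_F` is a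
uniformizer of `F`. -/
def ramificationIndex [TopologicalSpace F] [IsNonarchimedeanLocalField F]
    (𝔄 : Subalgebra 𝒪[F] A) : ℕ :=
  sInf {e | ∃ ϖ : F, addVal F ϖ = 1 ∧ radicalPow 𝔄 e = (fun a : A => ϖ • a) '' (𝔄 : Set A)}

/-- A character `χ : Aˣ → ℂˣ` is smooth if its kernel is open. The topology of `Aˣ` comes from the
topology of `A` as a finite-dimensional `F`-vector space. -/
def IsSmoothCharacter (F : Type*) {A : Type*} [Field F] [TopologicalSpace F] [Ring A] [Algebra F A]
    (χ : Aˣ →* ℂˣ) : Prop :=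
  letI : TopologicalSpace A := moduleTopology F A
  IsOpen (χ.ker : Set Aˣ)

end Orders

end PrincipalOrderCharacter

end

open ValuativeRel IsNonarchimedeanLocalField

noncomputable section
set_option linter.unusedSectionVars false

namespace PrincipalOrderCharacter

/-! Put `S = Dᵐᵒᵖ`, so that `V` is a left `S`-space, and let `v` be the normalized valuation of `S`.
The heart of the matter is that a character of `G` is invariant under conjugation, and that near `1`
it is additive.

Additivity: if `2j` is at least `n + 1`, then `(1 + x)(1 + y)` and `1 + x + y` differ by a factor in
`1 + 𝔓 ^ (n + 1)` for `x, y ∈ 𝔓 ^ j`, so `y ↦ χ (1 + y)` is additive on `𝔓 ^ j`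
(`IsSplit.oneAdd_add`). A lattice chain has an adapted basis (`IsChain.exists_isSplit`), in which
membership in `𝔓 ^ j` is a condition on each matrix entry separately
(`IsSplit.mem_jacobson_pow_iff`, `IsSplit.mem_fil_iff`). Thus `y` can be decomposed into elementary
matrices. Off-diagonal ones are commutators and contribute nothing; diagonal ones can be moved to
one fixed position by permutations (`IsSplit.oneAdd_eq_sum_diag`). What remains is an additive
function on a fractional ideal of `S`, invariant under conjugation.

Such a function factors through the reduced trace (`CyclicData.eq_of_conj_invariant`). This uses the
cyclic structure of `S`: a root of unity `ζ` that lifts a generator of the multiplicative group of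
the residue field, and a uniformizer `P` that normalizes `ζ`. Conjugation by `ζ` kills all
eigencomponents but the centralizer of `ζ`, and an integral `z ∈ F[ζ]` of trace `1` replaces a
component by `Trd(x) z`. Therefore `χ (1 + y) = θ (Trd y)` for a character `θ` of a fractional ideal
of `F`, and finite duality gives `θ t = ψ (c t)` (`exists_eq_addChar_mul`). Since `Trd` maps `𝔓 ^ i`
into the `t` with `i ≤ e v_F(t)`, nontriviality on `𝔓 ^ n` forces `n = e v_F(t)` for some `t`, and
the exact level of `θ` gives `v_F(c) = -n/e`.

The reduced trace defined by embeddings into matrices is matched with the explicit one in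
`reducedTrace_eq`, by diagonalizing the image of `ζ`. For `n = 0` the choice `c = 1` works, as both
sides are trivial on `𝔓`. -/

/-- A normalized discrete valuation on a division ring, with a junk value at `0`. -/
structure ZVal (K : Type*) [DivisionRing K] where
  /-- The underlying function. -/
  v : K → ℤ
  v_mul : ∀ x y, x ≠ 0 → y ≠ 0 → v (x * y) = v x + v y
  v_add : ∀ x y, x ≠ 0 → y ≠ 0 → x + y ≠ 0 → min (v x) (v y) ≤ v (x + y)
  surj : ∃ x, x ≠ 0 ∧ v x = 1

/-! ### Discrete valuations on division rings and their fractional ideals -/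

namespace ZVal

variable {K : Type*} [DivisionRing K] (w : ZVal K)

lemma v_one : w.v 1 = 0 := by
  have := w.v_mul 1 1 one_ne_zero one_ne_zero
  rw [mul_one] at this
  lia

lemma v_inv {x : K} (hx : x ≠ 0) : w.v x⁻¹ = -w.v x := by
  have := w.v_mul x x⁻¹ hx (inv_ne_zero hx)
  rw [mul_inv_cancel₀ hx, v_one] at this
  lia

lemma v_pow {x : K} (hx : x ≠ 0) (n : ℕ) : w.v (x ^ n) = n * w.v x := by
  induction n with
  | zero => simp [v_one]
  | succ n ih =>
    rw [pow_succ, w.v_mul _ _ (pow_ne_zero _ hx) hx, ih]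
    push_cast
    ring

lemma v_zpow {x : K} (hx : x ≠ 0) (n : ℤ) : w.v (x ^ n) = n * w.v x := by
  obtain ⟨m, rfl | rfl⟩ := n.eq_nat_or_neg
  · simp [w.v_pow hx]
  · rw [zpow_neg, zpow_natCast, w.v_inv (pow_ne_zero _ hx), w.v_pow hx]
    ring

lemma v_neg_one : w.v (-1) = 0 := by
  have := w.v_mul (-1) (-1) (by simp) (by simp)
  rw [neg_mul_neg, mul_one, v_one] at this
  lia

lemma v_neg (x : K) : w.v (-x) = w.v x := by
  rcases eq_or_ne x 0 with rfl | hx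
  · simp
  · rw [← neg_one_mul, w.v_mul _ _ (by simp) hx, v_neg_one, zero_add]

lemma exists_eq (n : ℤ) : ∃ x, x ≠ 0 ∧ w.v x = n := by
  obtain ⟨x, hx, h⟩ := w.surj
  exact ⟨x ^ n, zpow_ne_zero _ hx, by rw [w.v_zpow hx, h, mul_one]⟩

/-- The fractional ideal of the elements of valuation at least `i`. -/
def ball (i : ℤ) : AddSubgroup K where
  carrier := {x | x = 0 ∨ i ≤ w.v x}
  zero_mem' := Or.inl rfl
  add_mem' := by
    rintro x y (rfl | hx) (rfl | hy)
    · simp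
    · simp [hy]
    · simp [hx]
    · rcases eq_or_ne x 0 with rfl | hx0
      · simp [hy]
      rcases eq_or_ne y 0 with rfl | hy0
      · simp [hx]
      rcases eq_or_ne (x + y) 0 with h0 | h0
      · exact Or.inl h0
      · exact Or.inr ((le_min hx hy).trans (w.v_add x y hx0 hy0 h0))
  neg_mem' := by
    rintro x (rfl | hx)
    · simp
    · exact Or.inr (by rwa [w.v_neg])

lemma mem_ball {i : ℤ} {x : K} : x ∈ w.ball i ↔ x = 0 ∨ i ≤ w.v x := Iff.rfl

lemma mem_ball_of_ne {i : ℤ} {x : K} (hx : x ≠ 0) : x ∈ w.ball i ↔ i ≤ w.v x := by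
  simp [mem_ball, hx]

lemma ball_anti {i j : ℤ} (h : i ≤ j) : w.ball j ≤ w.ball i := by
  rintro x (rfl | hx)
  · exact zero_mem _
  · exact Or.inr (h.trans hx)

lemma mul_mem_ball {i j : ℤ} {x y : K} (hx : x ∈ w.ball i) (hy : y ∈ w.ball j) :
    x * y ∈ w.ball (i + j) := by
  rcases eq_or_ne x 0 with rfl | hx0
  · simp
  rcases eq_or_ne y 0 with rfl | hy0
  · simp
  rw [w.mem_ball_of_ne hx0] at hx
  rw [w.mem_ball_of_ne hy0] at hy
  rw [w.mem_ball_of_ne (mul_ne_zero hx0 hy0), w.v_mul _ _ hx0 hy0]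
  lia

lemma one_mem_ball : (1 : K) ∈ w.ball 0 := Or.inr w.v_one.ge

lemma mul_mem_ball_iff {i : ℤ} {x y : K} (hx : x ≠ 0) :
    x * y ∈ w.ball (w.v x + i) ↔ y ∈ w.ball i := by
  rcases eq_or_ne y 0 with rfl | hy
  · simp
  · rw [w.mem_ball_of_ne (mul_ne_zero hx hy), w.mem_ball_of_ne hy, w.v_mul _ _ hx hy]
    lia

lemma mul_mem_ball_iff' {i : ℤ} {x y : K} (hx : x ≠ 0) :
    y * x ∈ w.ball (w.v x + i) ↔ y ∈ w.ball i := by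
  rcases eq_or_ne y 0 with rfl | hy
  · simp
  · rw [w.mem_ball_of_ne (mul_ne_zero hy hx), w.mem_ball_of_ne hy, w.v_mul _ _ hy hx]
    lia

lemma pow_mem_ball {x : K} (hx : x ∈ w.ball 0) (n : ℕ) : x ^ n ∈ w.ball 0 := by
  induction n with
  | zero => simpa using w.one_mem_ball
  | succ n ih => simpa [pow_succ] using w.mul_mem_ball ih hx

end ZVal

/-! ### Fractional ideals and additive characters of the local field -/

section LocalField

variable (F : Type*) [Field F] [ValuativeRel F] [TopologicalSpace F]
  [IsNonarchimedeanLocalField F]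

variable {F} in
lemma iso_valuation_ne_zero {x : F} (hx : x ≠ 0) :
    valueGroupWithZeroIsoInt F (valuation F x) ≠ 0 := by
  simpa using hx

variable {F} in
lemma valuation_le_iff_addVal {x y : F} (hx : x ≠ 0) (hy : y ≠ 0) :
    valuation F x ≤ valuation F y ↔ addVal F y ≤ addVal F x := by
  rw [addVal, addVal, neg_le_neg_iff, WithZero.log_le_log (iso_valuation_ne_zero hx)
    (iso_valuation_ne_zero hy)]
  exact (OrderIsoClass.map_le_map_iff _).symm

/-- The normalized valuation of a local field. -/
def fieldVal : ZVal F where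
  v := addVal F
  v_mul x y hx hy := by
    simp only [addVal]
    rw [map_mul, map_mul, WithZero.log_mul (iso_valuation_ne_zero hx) (iso_valuation_ne_zero hy)]
    ring
  v_add x y hx hy h := by
    rw [min_le_iff, ← valuation_le_iff_addVal h hx, ← valuation_le_iff_addVal h hy, ← le_max_iff]
    exact (valuation F).map_add x y
  surj := by
    obtain ⟨γ, hγ⟩ := (valueGroupWithZeroIsoInt F).surjective (WithZero.exp (-1))
    obtain ⟨x, rfl⟩ := valuation_surjective γ
    refine ⟨x, ?_, ?_⟩
    · rintro rfl
      simp at hγ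
      exact WithZero.exp_ne_zero hγ.symm
    · replace hγ : valueGroupWithZeroIsoInt F (valuation F x) = WithZero.exp (-1) := hγ
      rw [addVal, hγ, WithZero.log_exp, neg_neg]

lemma fieldVal_v (x : F) : (fieldVal F).v x = addVal F x := rfl

variable {F}

lemma mem_ball_iff_le {x c : F} (hc : c ≠ 0) :
    x ∈ (fieldVal F).ball (addVal F c) ↔ valuation F x ≤ valuation F c := by
  rcases eq_or_ne x 0 with rfl | hx
  · simp
  · rw [ZVal.mem_ball_of_ne _ hx, fieldVal_v, valuation_le_iff_addVal hx hc]

lemma addVal_one : addVal F 1 = 0 := (fieldVal F).v_one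

lemma mem_ball_zero {x : F} : x ∈ (fieldVal F).ball 0 ↔ valuation F x ≤ 1 := by
  have := mem_ball_iff_le (F := F) (x := x) one_ne_zero
  rwa [addVal_one, map_one] at this

lemma mem_ball_zero' {x : F} : x ∈ (fieldVal F).ball 0 ↔ x ∈ 𝒪[F] := by
  rw [mem_ball_zero]
  rfl

lemma mem_ball_one {x : F} : x ∈ (fieldVal F).ball 1 ↔ valuation F x < 1 := by
  rcases eq_or_ne x 0 with rfl | hx
  · simp
  · rw [ZVal.mem_ball_of_ne _ hx, fieldVal_v, ← not_le, ← map_one (valuation F),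
      valuation_le_iff_addVal one_ne_zero hx, addVal_one]
    lia

lemma isOpen_fieldVal_ball (i : ℤ) : IsOpen ((fieldVal F).ball i : Set F) := by
  obtain ⟨c, hc, rfl⟩ := (fieldVal F).exists_eq i
  refine AddSubgroup.isOpen_of_mem_nhds _ (g := 0) (Filter.mem_of_superset
    ((IsValuativeTopology.hasBasis_nhds_zero' F).mem_of_mem (i := valuation F c)
      (by simpa using hc)) fun x (hx : valuation F x < valuation F c) ↦ ?_)
  exact (mem_ball_iff_le hc).2 hx.le

lemma isCompact_fieldVal_ball (i : ℤ) : IsCompact ((fieldVal F).ball i : Set F) := by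
  obtain ⟨c, hc, rfl⟩ := (fieldVal F).exists_eq i
  have : ((fieldVal F).ball (addVal F c) : Set F) = {x | valuation F x ≤ valuation F c} := by
    ext x
    exact mem_ball_iff_le hc
  rw [fieldVal_v, this]
  exact isCompact_closedBall F _

lemma exists_subset_ball_of_isCompact {s : Set F} (hs : IsCompact s) :
    ∃ i : ℤ, s ⊆ (fieldVal F).ball i := by
  obtain ⟨t, ht⟩ := hs.elim_finite_subcover (fun i : ℤ ↦ ((fieldVal F).ball i : Set F))
    isOpen_fieldVal_ball fun x _ ↦ Set.mem_iUnion.2 ⟨addVal F x, Or.inr le_rfl⟩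
  rcases t.eq_empty_or_nonempty with rfl | hne
  · exact ⟨0, fun x hx ↦ by simpa using ht hx⟩
  · refine ⟨t.min' hne, fun x hx ↦ ?_⟩
    obtain ⟨i, hi, hxi⟩ := Set.mem_iUnion₂.1 (ht hx)
    exact (fieldVal F).ball_anti (t.min'_le i hi) hxi

lemma exists_ball_subset_of_isOpen {s : Set F} (hs : IsOpen s) (h0 : (0 : F) ∈ s) :
    ∃ i : ℤ, ((fieldVal F).ball i : Set F) ⊆ s := by
  obtain ⟨γ, hγ, h⟩ := (IsValuativeTopology.hasBasis_nhds_zero' F).mem_iff.mp (hs.mem_nhds h0)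
  obtain ⟨c, rfl⟩ := valuation_surjective γ
  have hc : c ≠ 0 := by simpa using hγ
  refine ⟨addVal F c + 1, fun x hx ↦ h ?_⟩
  show valuation F x < valuation F c
  rcases eq_or_ne x 0 with rfl | hx0
  · simpa [zero_lt_iff] using hc
  · rw [SetLike.mem_coe, ZVal.mem_ball_of_ne _ hx0, fieldVal_v] at hx
    rw [← not_le, valuation_le_iff_addVal hc hx0]
    lia

/-- The ideal of the elements of valuation at least `i` in the ring of integers. -/
def ballIdeal (i : ℤ) : Ideal 𝒪[F] where
  carrier := {x | (x : F) ∈ (fieldVal F).ball i}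
  zero_mem' := (fieldVal F).ball i |>.zero_mem
  add_mem' := ((fieldVal F).ball i).add_mem
  smul_mem' a x hx := by
    have := (fieldVal F).mul_mem_ball (mem_ball_zero'.2 a.2) hx
    rwa [zero_add] at this

instance finite_quotient_ballIdeal (i : ℤ) : Finite (𝒪[F] ⧸ ballIdeal (F := F) i) :=
  AddSubgroup.quotient_finite_of_isOpen (ballIdeal (F := F) i).toAddSubgroup
    ((isOpen_fieldVal_ball i).preimage continuous_subtype_val)

/-- Passing to a finite quotient ring makes a counting argument available for the duality of
additive characters. -/
lemma exists_addChar_quotient {N : ℤ} (hN : 0 ≤ N) {g : F → ℂ}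
    (hadd : ∀ x ∈ (fieldVal F).ball 0, ∀ y ∈ (fieldVal F).ball 0, g (x + y) = g x * g y)
    (hone : ∀ x ∈ (fieldVal F).ball N, g x = 1) :
    ∃ η : AddChar (𝒪[F] ⧸ ballIdeal (F := F) N) ℂ,
      ∀ x : 𝒪[F], η (Ideal.Quotient.mk _ x) = g x := by
  have key : ∀ x y : 𝒪[F], Ideal.Quotient.mk (ballIdeal (F := F) N) x = Ideal.Quotient.mk _ y →
      g x = g y := by
    intro x y h
    have h1 : ((x - y : 𝒪[F]) : F) ∈ (fieldVal F).ball N := Ideal.Quotient.eq.1 h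
    have h2 := hadd y (mem_ball_zero'.2 y.2) _ ((fieldVal F).ball_anti hN h1)
    rw [hone _ h1, mul_one] at h2
    rw [← h2]
    push_cast
    congr 1
    ring
  have hs := Ideal.Quotient.mk_surjective (I := ballIdeal (F := F) N)
  choose s hs using hs
  refine ⟨⟨fun r ↦ g (s r), ?_, fun a b ↦ ?_⟩, fun x ↦ key _ _ (hs _)⟩
  · rw [key _ 0 (by rw [hs, map_zero])]
    exact hone _ (zero_mem _)
  · rw [key _ (s a + s b) (by rw [hs, map_add, hs, hs])]
    exact hadd _ (mem_ball_zero'.2 (s a).2) _ (mem_ball_zero'.2 (s b).2)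

lemma HasConductorMaximalIdeal.eq_one {ψ : AddChar F ℂ} (hψ : HasConductorMaximalIdeal ψ) {x : F}
    (hx : x ∈ (fieldVal F).ball 1) : ψ x = 1 := hψ.1 x (mem_ball_one.1 hx)

/-- Additive characters of a fractional ideal of a local field come from `ψ`. -/
lemma exists_eq_addChar_mul {ψ : AddChar F ℂ} (hψ : HasConductorMaximalIdeal ψ) {θ : F → ℂ}
    {k h : ℤ} (hkh : k ≤ h)
    (hadd : ∀ x ∈ (fieldVal F).ball k, ∀ y ∈ (fieldVal F).ball k, θ (x + y) = θ x * θ y)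
    (hone : ∀ x ∈ (fieldVal F).ball (h + 1), θ x = 1) :
    ∃ c : F, ∀ x ∈ (fieldVal F).ball k, θ x = ψ (c * x) := by
  set w := fieldVal F
  obtain ⟨a, ha, hak⟩ := w.exists_eq k
  -- With this valuation, `b` carries `𝔭 ^ (h + 1 - k)` onto `𝔭`, exactly the conductor of `ψ`, so
  -- `ψ (b x)` descends to a primitive character of the same finite ring as `θ (a x)`.
  obtain ⟨b, hb, hbN⟩ := w.exists_eq (k - h)
  have mem_a {i : ℤ} {x : F} : a * x ∈ w.ball (k + i) ↔ x ∈ w.ball i := by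
    rw [← hak]; exact w.mul_mem_ball_iff ha
  have mem_b {i : ℤ} {x : F} : b * x ∈ w.ball (k - h + i) ↔ x ∈ w.ball i := by
    rw [← hbN]; exact w.mul_mem_ball_iff hb
  obtain ⟨η, hη⟩ := exists_addChar_quotient (N := h + 1 - k) (by lia) (g := fun x ↦ θ (a * x))
    (fun x hx y hy ↦ by
      rw [mul_add]
      exact hadd _ (by simpa using (mem_a (i := 0)).2 hx) _ (by simpa using (mem_a (i := 0)).2 hy))
    (fun x hx ↦ hone _ (by
      have := mem_a.2 hx
      rwa [show k + (h + 1 - k) = h + 1 by ring] at this))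
  obtain ⟨ρ, hρ⟩ := exists_addChar_quotient (N := h + 1 - k) (by lia) (g := fun x ↦ ψ (b * x))
    (fun x _ y _ ↦ by rw [mul_add, AddChar.map_add_eq_mul])
    (fun x hx ↦ hψ.eq_one (by
      have := mem_b.2 hx
      rwa [show k - h + (h + 1 - k) = 1 by ring] at this))
  have hprim : ρ.IsPrimitive := by
    intro r hr h1
    obtain ⟨x, rfl⟩ := Ideal.Quotient.mk_surjective r
    obtain ⟨t, ht, ht'⟩ := hψ.2
    have hx : (x : F) ∉ w.ball (h + 1 - k) := fun hx ↦ hr (Ideal.Quotient.eq_zero_iff_mem.2 hx)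
    have hx0 : (x : F) ≠ 0 := fun h ↦ hx (h ▸ zero_mem _)
    have hy : (b * x)⁻¹ * t ∈ w.ball 0 := by
      rw [w.mem_ball_of_ne hx0] at hx
      have h2 : (b * x)⁻¹ ∈ w.ball 0 := by
        right
        rw [w.v_inv (mul_ne_zero hb hx0), w.v_mul _ _ hb hx0]
        lia
      simpa using w.mul_mem_ball h2 (mem_ball_zero.2 ht)
    apply ht'
    have h3 := DFunLike.congr_fun h1 (Ideal.Quotient.mk _ ⟨_, mem_ball_zero'.1 hy⟩)
    rw [AddChar.mulShift_apply, ← map_mul, hρ, AddChar.one_apply] at h3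
    rw [← h3]
    congr 1
    push_cast
    rw [← mul_assoc, mul_inv_cancel_left₀ (mul_ne_zero hb hx0)]
  -- A finite ring has as many characters as elements, so the injective map from the ring to its
  -- dual given by a primitive character is onto.
  have hsurj : Function.Surjective ρ.mulShift := by
    have := Fintype.ofFinite (𝒪[F] ⧸ ballIdeal (F := F) (h + 1 - k))
    exact ((Fintype.bijective_iff_injective_and_card _).2
      ⟨AddChar.to_mulShift_inj_of_isPrimitive hprim, AddChar.card_eq.symm⟩).2
  obtain ⟨r, hr⟩ := hsurj η
  obtain ⟨d, rfl⟩ := Ideal.Quotient.mk_surjective r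
  refine ⟨b * d * a⁻¹, fun x hx ↦ ?_⟩
  have hx' : a⁻¹ * x ∈ w.ball 0 := by
    rw [← mem_a, mul_inv_cancel_left₀ ha, add_zero]
    exact hx
  have h1 := hη ⟨_, mem_ball_zero'.1 hx'⟩
  rw [← hr, AddChar.mulShift_apply, ← map_mul, hρ] at h1
  simp only [mul_inv_cancel_left₀ ha] at h1
  rw [← h1]
  congr 1
  push_cast
  ring

/-- The valuation of a parameter of an additive character. -/
lemma addVal_eq_of_addChar_mul {ψ : AddChar F ℂ} (hψ : HasConductorMaximalIdeal ψ) {c : F} {h : ℤ}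
    (hone : ∀ x ∈ (fieldVal F).ball (h + 1), ψ (c * x) = 1)
    (hne : ∃ x ∈ (fieldVal F).ball h, ψ (c * x) ≠ 1) : c ≠ 0 ∧ addVal F c = -h := by
  obtain ⟨x, hx, hx1⟩ := hne
  have hc : c ≠ 0 := by
    rintro rfl
    simp at hx1
  refine ⟨hc, le_antisymm ?_ ?_⟩
  · by_contra! hlt
    refine hx1 (hψ.eq_one ?_)
    have h1 : c ∈ (fieldVal F).ball (addVal F c) := Or.inr le_rfl
    exact (fieldVal F).ball_anti (by lia) ((fieldVal F).mul_mem_ball h1 hx)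
  · by_contra! hlt
    obtain ⟨t, ht, ht'⟩ := hψ.2
    refine ht' ?_
    have := hone (c⁻¹ * t) ?_
    · rwa [mul_inv_cancel_left₀ hc] at this
    have h1 : c⁻¹ ∈ (fieldVal F).ball (-addVal F c) := Or.inr ((fieldVal F).v_inv hc).ge
    exact (fieldVal F).ball_anti (by lia) ((fieldVal F).mul_mem_ball h1 (mem_ball_zero.2 ht))

end LocalField

/-! ### Norm, integrality and boundedness in a division algebra -/

section DivisionValuation

variable {F : Type*} [Field F] [ValuativeRel F] [TopologicalSpace F] [IsNonarchimedeanLocalField F]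

lemma continuous_norm {S : Type*} [Ring S] [Algebra F S] [Module.Finite F S]
    [TopologicalSpace S] [IsModuleTopology F S] : Continuous fun x : S ↦ Algebra.norm F x := by
  classical
  simp_rw [Algebra.norm_eq_matrix_det (Module.finBasis F S)]
  refine Continuous.matrix_det (continuous_matrix fun i j ↦ ?_)
  exact IsModuleTopology.continuous_of_linearMap (R := F)
    ((LinearMap.proj j ∘ₗ LinearMap.proj i : Matrix _ _ F →ₗ[F] F) ∘ₗ
      (Algebra.leftMulMatrix (Module.finBasis F S)).toLinearMap)

/-- The elements of a finite-dimensional space with coordinates in a fractional ideal. -/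
def box (F : Type*) [Field F] [ValuativeRel F] [TopologicalSpace F] [IsNonarchimedeanLocalField F]
    (W : Type*) [AddCommGroup W] [Module F W] [Module.Finite F W] (C : ℤ) : Submodule 𝒪[F] W where
  carrier := {x | ∀ i, (Module.finBasis F W).repr x i ∈ (fieldVal F).ball C}
  zero_mem' := by simp
  add_mem' hx hy i := by simpa using add_mem (hx i) (hy i)
  smul_mem' a x hx i := by
    have := (fieldVal F).mul_mem_ball (mem_ball_zero'.2 a.2) (hx i)
    rw [zero_add] at this
    show (Module.finBasis F W).repr ((a : F) • x) i ∈ _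
    rwa [map_smul]

section Box

variable {W : Type*} [AddCommGroup W] [Module F W] [Module.Finite F W]

lemma mem_box {C : ℤ} {x : W} :
    x ∈ box F W C ↔ ∀ i, (Module.finBasis F W).repr x i ∈ (fieldVal F).ball C := Iff.rfl

lemma box_anti {i j : ℤ} (h : i ≤ j) : box F W j ≤ box F W i :=
  fun _ hx k ↦ (fieldVal F).ball_anti h (hx k)

lemma exists_mem_box (x : W) : ∃ C, x ∈ box F W C := by
  obtain ⟨C, hC⟩ := exists_subset_ball_of_isCompact
    (Set.finite_range fun i ↦ (Module.finBasis F W).repr x i).isCompact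
  exact ⟨C, fun i ↦ hC ⟨i, rfl⟩⟩

lemma smul_mem_box {t : F} (ht : t ≠ 0) {C : ℤ} {x : W} :
    t • x ∈ box F W (addVal F t + C) ↔ x ∈ box F W C := by
  refine forall_congr' fun i ↦ ?_
  rw [map_smul]
  exact (fieldVal F).mul_mem_ball_iff ht

lemma box_eq_image (C : ℤ) : (box F W C : Set W) = (Module.finBasis F W).equivFun.symm ''
    Set.univ.pi fun _ ↦ ((fieldVal F).ball C : Set F) := by
  rw [LinearEquiv.image_symm_eq_preimage]
  ext x
  simp [mem_box]

variable [TopologicalSpace W] [IsModuleTopology F W]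

lemma isCompact_box (C : ℤ) : IsCompact (box F W C : Set W) := by
  have := IsModuleTopology.toContinuousAdd F W
  rw [box_eq_image]
  exact (isCompact_univ_pi fun _ ↦ isCompact_fieldVal_ball C).image
    (IsModuleTopology.continuous_of_linearMap (R := F) _)

lemma isOpen_box (C : ℤ) : IsOpen (box F W C : Set W) := by
  have : (box F W C : Set W) = ⋂ i, (Module.finBasis F W).coord i ⁻¹' (fieldVal F).ball C := by
    ext x
    simp [mem_box]
  rw [this]
  exact isOpen_iInter_of_finite fun i ↦ (isOpen_fieldVal_ball C).preimage
    (IsModuleTopology.continuous_of_linearMap (R := F) _)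

lemma exists_subset_box_of_isCompact {s : Set W} (hs : IsCompact s) : ∃ C, s ⊆ box F W C := by
  have h (i) : ∃ C, ∀ x ∈ s, (Module.finBasis F W).repr x i ∈ (fieldVal F).ball C := by
    obtain ⟨C, hC⟩ := exists_subset_ball_of_isCompact (hs.image
      (IsModuleTopology.continuous_of_linearMap (R := F) ((Module.finBasis F W).coord i)))
    exact ⟨C, fun x hx ↦ hC ⟨x, hx, rfl⟩⟩
  choose C hC using h
  obtain ⟨B, hB⟩ := (Set.finite_range C).bddBelow
  exact ⟨B, fun x hx i ↦ (fieldVal F).ball_anti (hB ⟨i, rfl⟩) (hC i x hx)⟩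

lemma exists_box_subset_of_isOpen {s : AddSubgroup W} (hs : IsOpen (s : Set W)) :
    ∃ C, (box F W C : Set W) ⊆ s := by
  have := IsModuleTopology.toContinuousSMul F W
  have h (i) : ∃ C, ∀ t ∈ (fieldVal F).ball C, t • Module.finBasis F W i ∈ s :=
    exists_ball_subset_of_isOpen (hs.preimage (f := fun t : F ↦ t • Module.finBasis F W i)
      (by fun_prop)) (by
        show (0 : F) • Module.finBasis F W i ∈ s
        rw [zero_smul]
        exact s.zero_mem)
  choose C hC using h
  obtain ⟨B, hB⟩ := (Set.finite_range C).bddAbove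
  refine ⟨B, fun x hx ↦ ?_⟩
  rw [← (Module.finBasis F W).sum_repr x]
  exact sum_mem fun i _ ↦ hC i _ ((fieldVal F).ball_anti (hB ⟨i, rfl⟩) (hx i))

end Box

/-- The box lies in a lattice spanned by multiples of the basis, and `𝒪[F]` is noetherian. This
turns boundedness into integrality. -/
lemma fg_box {W : Type*} [AddCommGroup W] [Module F W] [Module.Finite F W] (C : ℤ) :
    (box F W C).FG := by
  obtain ⟨a, ha, rfl⟩ := (fieldVal F).exists_eq C
  refine Submodule.FG.of_le (T := Submodule.span 𝒪[F]
    (Set.range fun i ↦ a • Module.finBasis F W i)) (Submodule.fg_span (Set.finite_range _)) ?_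
  intro x hx
  rw [← (Module.finBasis F W).sum_repr x]
  refine sum_mem fun i _ ↦ ?_
  have h : a⁻¹ * (Module.finBasis F W).repr x i ∈ (fieldVal F).ball 0 := by
    rw [← (fieldVal F).mul_mem_ball_iff ha, mul_inv_cancel_left₀ ha, add_zero]
    exact hx i
  have h1 : (Module.finBasis F W).repr x i • Module.finBasis F W i =
      (⟨_, mem_ball_zero'.1 h⟩ : 𝒪[F]) • a • Module.finBasis F W i := by
    show _ = (a⁻¹ * (Module.finBasis F W).repr x i) • a • Module.finBasis F W i
    rw [smul_smul]
    congr 1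
    field_simp
  rw [h1]
  exact Submodule.smul_mem _ _ (Submodule.subset_span (Set.mem_range_self i))

variable {S : Type*} [DivisionRing S] [Algebra F S] [Module.Finite F S]

lemma norm_ne_zero {x : S} (hx : x ≠ 0) : Algebra.norm F x ≠ 0 := by
  intro h
  have := map_mul (Algebra.norm F) x x⁻¹
  rw [mul_inv_cancel₀ hx, h, zero_mul, map_one] at this
  exact one_ne_zero this

variable (F S) in
/-- An element whose norm is integral has bounded coordinates. -/
lemma exists_box_of_norm_mem :
    ∃ C, ∀ x : S, Algebra.norm F x ∈ (fieldVal F).ball 0 → x ∈ box F S C := by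
  let _ : TopologicalSpace S := moduleTopology F S
  have : IsModuleTopology F S := ⟨rfl⟩
  -- The norm has no zero on this compact shell, so its inverse is bounded there; every nonzero `x`
  -- can be scaled into the shell.
  have hK : IsCompact ((box F S 0 : Set S) \ box F S 1) := (isCompact_box 0).diff (isOpen_box 1)
  have hne : ∀ x ∈ (box F S 0 : Set S) \ box F S 1, Algebra.norm F x ≠ 0 := fun x hx ↦
    norm_ne_zero fun h ↦ hx.2 (h ▸ zero_mem _)
  obtain ⟨i, hi⟩ := exists_subset_ball_of_isCompact
    (hK.image_of_continuousOn (continuous_norm.continuousOn.inv₀ hne))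
  -- If `m` is the level of `x`, scaling gives `i ≤ d * m` with `d` the dimension. Taking `-|i|`
  -- makes this bound `m` from below whatever the sign of `i`.
  refine ⟨-|i|, fun x hx ↦ ?_⟩
  rcases eq_or_ne x 0 with rfl | hx0
  · exact zero_mem _
  have hex : ∃ m : ℤ, x ∈ box F S m ∧ x ∉ box F S (m + 1) := by
    obtain ⟨C, hC⟩ := exists_mem_box (F := F) x
    have hbd : ∃ B, ∀ m, x ∈ box F S m → m ≤ B := by
      obtain ⟨j, hj⟩ : ∃ j, (Module.finBasis F S).repr x j ≠ 0 := by
        by_contra! h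
        exact hx0 ((Module.finBasis F S).repr.map_eq_zero_iff.1 (Finsupp.ext h))
      exact ⟨_, fun m hm ↦ ((fieldVal F).mem_ball_of_ne hj).1 (hm j)⟩
    obtain ⟨m, hm, hmax⟩ := Int.exists_greatest_of_bdd hbd ⟨C, hC⟩
    exact ⟨m, hm, fun h ↦ by have := hmax _ h; lia⟩
  obtain ⟨m, hm, hm1⟩ := hex
  refine box_anti ?_ hm
  obtain ⟨c, hc, hcm⟩ := (fieldVal F).exists_eq (-m)
  rw [fieldVal_v] at hcm
  have hy : c • x ∈ (box F S 0 : Set S) \ box F S 1 := by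
    rw [← smul_mem_box hc, hcm] at hm hm1
    exact ⟨by simpa using hm, by simpa using hm1⟩
  have h1 : (Algebra.norm F (c • x))⁻¹ ∈ (fieldVal F).ball i := hi ⟨_, hy, rfl⟩
  have h2 : Algebra.norm F (c • x) = c ^ Module.finrank F S * Algebra.norm F x := by
    rw [Algebra.smul_def, map_mul, Algebra.norm_algebraMap]
  rw [ZVal.mem_ball_of_ne _ (inv_ne_zero (hne _ hy)), ZVal.v_inv _ (hne _ hy),
    h2, ZVal.v_mul _ _ _ (pow_ne_zero _ hc) (norm_ne_zero hx0), ZVal.v_pow _ hc, fieldVal_v,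
    hcm] at h1
  rw [ZVal.mem_ball_of_ne _ (norm_ne_zero hx0)] at hx
  have hd : 0 < Module.finrank F S := Module.finrank_pos
  have h3 : i ≤ Module.finrank F S * m := by linarith
  by_contra! hlt
  have h4 : (Module.finrank F S : ℤ) * m ≤ 1 * m :=
    mul_le_mul_of_nonpos_right (by exact_mod_cast hd) (by have := abs_nonneg i; lia)
  have := neg_abs_le i
  lia

/-- All powers of `x` have integral norm, hence lie in one box, so `𝒪[F][x]` is finitely generated.
-/
lemma isIntegral_of_norm_mem {x : S} (hx : Algebra.norm F x ∈ (fieldVal F).ball 0) :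
    IsIntegral 𝒪[F] x := by
  obtain ⟨C, hC⟩ := exists_box_of_norm_mem F S
  refine IsIntegral.of_mem_of_fg (Algebra.adjoin 𝒪[F] {x}) ?_ x
    (Algebra.self_mem_adjoin_singleton _ _)
  refine Submodule.FG.of_le (fg_box C) ?_
  rw [Algebra.adjoin_eq_span, Submodule.span_le]
  intro y hy
  obtain ⟨n, rfl⟩ := Submonoid.mem_closure_singleton.1 hy
  refine hC _ ?_
  rw [map_pow]
  exact (fieldVal F).pow_mem_ball hx n

/-- The powers of `x` lie in a finitely generated module, hence in a compact box, so the valuations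
of their norms are bounded below; a negative value at `x` would make them unbounded. -/
lemma norm_mem_of_isIntegral {x : S} (hx : IsIntegral 𝒪[F] x) :
    Algebra.norm F x ∈ (fieldVal F).ball 0 := by
  let _ : TopologicalSpace S := moduleTopology F S
  have : IsModuleTopology F S := ⟨rfl⟩
  rcases eq_or_ne x 0 with rfl | hx0
  · simp
  obtain ⟨T, hT⟩ := hx.fg_adjoin_singleton
  have hbox : ∃ C, ∀ y ∈ T, y ∈ box F S C := by
    obtain ⟨C, hC⟩ := exists_subset_box_of_isCompact (F := F) (T.finite_toSet.isCompact)
    exact ⟨C, fun y hy ↦ hC hy⟩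
  obtain ⟨C, hC⟩ := hbox
  obtain ⟨i, hi⟩ := exists_subset_ball_of_isCompact
    ((isCompact_box (F := F) (W := S) C).image (continuous_norm (F := F) (S := S)))
  have hpow (n : ℕ) : i ≤ n * addVal F (Algebra.norm F x) := by
    have h1 : x ^ n ∈ (Algebra.adjoin 𝒪[F] {x}).toSubmodule :=
      pow_mem (Algebra.self_mem_adjoin_singleton _ _) n
    rw [← hT] at h1
    have h2 := hi ⟨_, Submodule.span_le.2 hC h1, rfl⟩
    dsimp only at h2
    rwa [map_pow, SetLike.mem_coe, ZVal.mem_ball_of_ne _ (pow_ne_zero _ (norm_ne_zero hx0)),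
      ZVal.v_pow _ (norm_ne_zero hx0)] at h2
  right
  by_contra! hlt
  have h3 := hpow (i.natAbs + 1)
  rw [fieldVal_v] at hlt
  have h4 : ((i.natAbs + 1 : ℕ) : ℤ) * addVal F (Algebra.norm F x) ≤
      ((i.natAbs + 1 : ℕ) : ℤ) * (-1) := mul_le_mul_of_nonneg_left (by lia) (by lia)
  lia

/-- This is the source of the ultrametric inequality: `1 + x` lies in the finitely generated ring
`𝒪[F][x]`, so integrality passes to it. -/
lemma norm_one_add_mem {x : S} (hx : Algebra.norm F x ∈ (fieldVal F).ball 0) :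
    Algebra.norm F (1 + x) ∈ (fieldVal F).ball 0 :=
  norm_mem_of_isIntegral (IsIntegral.of_mem_of_fg (Algebra.adjoin 𝒪[F] {x})
    (isIntegral_of_norm_mem hx).fg_adjoin_singleton _
    (add_mem (one_mem _) (Algebra.self_mem_adjoin_singleton _ _)))

lemma addVal_norm_mul {x y : S} (hx : x ≠ 0) (hy : y ≠ 0) :
    addVal F (Algebra.norm F (x * y)) =
      addVal F (Algebra.norm F x) + addVal F (Algebra.norm F y) := by
  rw [map_mul]
  exact (fieldVal F).v_mul _ _ (norm_ne_zero hx) (norm_ne_zero hy)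

lemma addVal_norm_inv {x : S} (hx : x ≠ 0) :
    addVal F (Algebra.norm F x⁻¹) = -addVal F (Algebra.norm F x) := by
  have := addVal_norm_mul (F := F) hx (inv_ne_zero hx)
  rw [mul_inv_cancel₀ hx, map_one, addVal_one] at this
  lia

lemma addVal_norm_le_add {x y : S} (hx : x ≠ 0) (hy : y ≠ 0) (h : x + y ≠ 0)
    (hxy : addVal F (Algebra.norm F x) ≤ addVal F (Algebra.norm F y)) :
    addVal F (Algebra.norm F x) ≤ addVal F (Algebra.norm F (x + y)) := by
  have h1 : x + y = x * (1 + x⁻¹ * y) := by rw [mul_add, mul_one, mul_inv_cancel_left₀ hx]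
  have h2 : 1 + x⁻¹ * y ≠ 0 := fun h0 ↦ h (by rw [h1, h0, mul_zero])
  rw [h1, addVal_norm_mul hx h2]
  have h3 : Algebra.norm F (1 + x⁻¹ * y) ∈ (fieldVal F).ball 0 := norm_one_add_mem <| by
    right
    rw [fieldVal_v, addVal_norm_mul (inv_ne_zero hx) hy, addVal_norm_inv hx]
    lia
  rw [ZVal.mem_ball_of_ne _ (norm_ne_zero h2), fieldVal_v] at h3
  lia

variable (F S) in
/-- The group of the valuations of norms. -/
def normValues : AddSubgroup ℤ where
  carrier := {n | ∃ x : S, x ≠ 0 ∧ addVal F (Algebra.norm F x) = n}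
  zero_mem' := ⟨1, one_ne_zero, by rw [map_one, addVal_one]⟩
  add_mem' := by
    rintro _ _ ⟨x, hx, rfl⟩ ⟨y, hy, rfl⟩
    exact ⟨x * y, mul_ne_zero hx hy, addVal_norm_mul hx hy⟩
  neg_mem' := by
    rintro _ ⟨x, hx, rfl⟩
    exact ⟨x⁻¹, inv_ne_zero hx, addVal_norm_inv hx⟩

variable (F S) in
/-- The residue degree, as the positive generator of the group of valuations of norms. -/
lemma exists_normValues_generator : ∃ g : ℤ, 0 < g ∧ ∀ n, n ∈ normValues F S ↔ g ∣ n := by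
  obtain ⟨a, ha⟩ := Int.subgroup_cyclic (normValues F S)
  have hmem (n : ℤ) : n ∈ normValues F S ↔ a ∣ n := by
    rw [ha, ← AddSubgroup.zmultiples_eq_closure, Int.mem_zmultiples_iff]
  refine ⟨|a|, abs_pos.2 ?_, fun n ↦ by rw [hmem, abs_dvd]⟩
  -- The generator cannot vanish, as the norm of a uniformizer of `F` is its power with exponent the
  -- dimension.
  rintro rfl
  obtain ⟨ϖ, hϖ, h1⟩ := (fieldVal F).surj
  have h2 : addVal F (Algebra.norm F (algebraMap F S ϖ)) ∈ normValues F S :=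
    ⟨_, by simpa using hϖ, rfl⟩
  rw [hmem, zero_dvd_iff, Algebra.norm_algebraMap, ← fieldVal_v, ZVal.v_pow _ hϖ, h1] at h2
  have : 0 < Module.finrank F S := Module.finrank_pos
  lia

end DivisionValuation

/-! ### The residue ring and powers by its cardinality -/

namespace ZVal

variable {K : Type*} [DivisionRing K] (w : ZVal K)

/-- The valuation ring. -/
def integerRing : Subring K where
  carrier := w.ball 0
  zero_mem' := zero_mem _
  one_mem' := w.one_mem_ball
  add_mem' := add_mem
  neg_mem' := neg_mem
  mul_mem' hx hy := by simpa using w.mul_mem_ball hx hy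

lemma mem_integerRing {x : K} : x ∈ w.integerRing ↔ x ∈ w.ball 0 := Iff.rfl

/-- The maximal ideal of the valuation ring. -/
def residueIdeal : Ideal w.integerRing where
  carrier := {x | (x : K) ∈ w.ball 1}
  zero_mem' := (w.ball 1).zero_mem
  add_mem' := (w.ball 1).add_mem
  smul_mem' a x hx := by
    have := w.mul_mem_ball (w.mem_integerRing.1 a.2) hx
    rwa [zero_add] at this

lemma mem_residueIdeal {x : w.integerRing} : x ∈ w.residueIdeal ↔ (x : K) ∈ w.ball 1 := Iff.rfl

instance : w.residueIdeal.IsTwoSided where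
  mul_mem_of_left {a} b ha := by
    have := w.mul_mem_ball (w.mem_residueIdeal.1 ha) (w.mem_integerRing.1 b.2)
    rwa [add_zero] at this

/-- The residue division ring. -/
abbrev Residue : Type _ := w.integerRing ⧸ w.residueIdeal

/-- The residue map. -/
def residue : w.integerRing →+* w.Residue := Ideal.Quotient.mk _

lemma residue_surjective : Function.Surjective w.residue := Ideal.Quotient.mk_surjective

lemma residue_eq_zero {x : w.integerRing} : w.residue x = 0 ↔ (x : K) ∈ w.ball 1 :=
  Ideal.Quotient.eq_zero_iff_mem

lemma residue_eq {x y : w.integerRing} : w.residue x = w.residue y ↔ (x - y : K) ∈ w.ball 1 := by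
  rw [← sub_eq_zero, ← map_sub, residue_eq_zero]
  rfl

lemma one_notMem_ball_one : (1 : K) ∉ w.ball 1 := by
  rw [w.mem_ball_of_ne one_ne_zero, w.v_one]
  lia

instance : Nontrivial w.Residue := by
  refine ⟨0, 1, fun h ↦ w.one_notMem_ball_one ?_⟩
  rw [← map_one w.residue, eq_comm, residue_eq_zero] at h
  exact h

instance : NoZeroDivisors w.Residue where
  eq_zero_or_eq_zero_of_mul_eq_zero {a b} h := by
    obtain ⟨x, rfl⟩ := w.residue_surjective a
    obtain ⟨y, rfl⟩ := w.residue_surjective b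
    rw [← map_mul, residue_eq_zero] at h
    rw [residue_eq_zero, residue_eq_zero]
    rcases eq_or_ne (x : K) 0 with hx | hx
    · exact Or.inl (hx ▸ zero_mem _)
    rcases eq_or_ne (y : K) 0 with hy | hy
    · exact Or.inr (hy ▸ zero_mem _)
    have hx' := w.mem_integerRing.1 x.2
    have hy' := w.mem_integerRing.1 y.2
    rw [Subring.coe_mul, w.mem_ball_of_ne (mul_ne_zero hx hy), w.v_mul _ _ hx hy] at h
    rw [w.mem_ball_of_ne hx] at hx' ⊢
    rw [w.mem_ball_of_ne hy] at hy' ⊢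
    lia

instance : IsDomain w.Residue := NoZeroDivisors.to_isDomain _

/-- A finite residue ring is a field. -/
@[reducible]
def residueField [Finite w.Residue] : Field w.Residue := (Finite.isDomain_to_isField _).toField

lemma residue_pow_card [Finite w.Residue] (a : w.Residue) : a ^ Nat.card w.Residue = a := by
  let _ := w.residueField
  have := Fintype.ofFinite w.Residue
  rw [Nat.card_eq_fintype_card]
  exact FiniteField.pow_card a

lemma natCard_residue_eq_zero [Finite w.Residue] : (Nat.card w.Residue : w.Residue) = 0 := by
  let _ := w.residueField
  have := Fintype.ofFinite w.Residue
  rw [Nat.card_eq_fintype_card]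
  exact FiniteField.cast_card_eq_zero _

lemma natCard_mem_ball [Finite w.Residue] : (Nat.card w.Residue : K) ∈ w.ball 1 := by
  have := w.natCard_residue_eq_zero
  rw [← map_natCast w.residue, residue_eq_zero] at this
  simpa using this

lemma pow_card_sub_self_mem [Finite w.Residue] {x : K} (hx : x ∈ w.ball 0) :
    x ^ Nat.card w.Residue - x ∈ w.ball 1 := by
  have := w.residue_pow_card (w.residue ⟨x, hx⟩)
  rw [← map_pow, residue_eq] at this
  exact this

/-- The difference of powers is `x - y` times a geometric sum with `Q` terms, where `Q` is the
cardinality of the residue ring. All terms have the same residue, so the sum is divisible by a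
uniformizer because `Q` vanishes in the residue ring. -/
lemma pow_card_sub_pow_card_mem [Finite w.Residue] {x y : K} (hx : x ∈ w.ball 0)
    (hy : y ∈ w.ball 0) (hc : Commute x y) {m : ℤ} (hm : 1 ≤ m) (h : x - y ∈ w.ball m) :
    x ^ Nat.card w.Residue - y ^ Nat.card w.Residue ∈ w.ball (m + 1) := by
  rw [← hc.mul_geom_sum₂]
  refine w.mul_mem_ball h ?_
  have hxy : w.residue ⟨x, hx⟩ = w.residue ⟨y, hy⟩ := w.residue_eq.2 (w.ball_anti hm h)
  have h1 : w.residue (∑ i ∈ Finset.range (Nat.card w.Residue), (⟨x, hx⟩ : w.integerRing) ^ i *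
      ⟨y, hy⟩ ^ (Nat.card w.Residue - 1 - i)) = 0 := by
    simp only [map_sum, map_mul, map_pow, hxy, ← pow_add]
    rw [Finset.sum_congr rfl (g := fun _ ↦ w.residue ⟨y, hy⟩ ^ (Nat.card w.Residue - 1))]
    · simp [natCard_residue_eq_zero]
    · intro i hi
      rw [Finset.mem_range] at hi
      congr 1
      lia
  rw [residue_eq_zero] at h1
  simpa using h1

lemma pow_pow_card_sub_mem [Finite w.Residue] {x : K} (hx : x ∈ w.ball 0) (n : ℕ) :
    x ^ Nat.card w.Residue ^ (n + 1) - x ^ Nat.card w.Residue ^ n ∈ w.ball (n + 1) := by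
  induction n with
  | zero => simpa using w.pow_card_sub_self_mem hx
  | succ n ih =>
    have := w.pow_card_sub_pow_card_mem (w.pow_mem_ball hx _) (w.pow_mem_ball hx _)
      (Commute.pow_pow_self x _ _) (by lia) ih
    rwa [← pow_mul, ← pow_mul, ← pow_succ, ← pow_succ] at this

lemma pow_pow_card_sub_self_mem [Finite w.Residue] {x : K} (hx : x ∈ w.ball 0) (n : ℕ) :
    x ^ Nat.card w.Residue ^ n - x ∈ w.ball 1 := by
  induction n with
  | zero => simp
  | succ n ih =>
    have := add_mem (w.ball_anti (by lia) (w.pow_pow_card_sub_mem hx n)) ih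
    rwa [sub_add_sub_cancel] at this

lemma eq_zero_of_forall_mem {x : K} (h : ∀ n : ℕ, x ∈ w.ball n) : x = 0 := by
  by_contra hx
  have := (w.mem_ball_of_ne hx).1 (h ((w.v x).toNat + 1))
  lia

end ZVal

/-! ### The normalized valuation of a division algebra and Teichmüller lifts -/

section DivisionValuation

variable {F : Type*} [Field F] [ValuativeRel F] [TopologicalSpace F] [IsNonarchimedeanLocalField F]
  {S : Type*} [DivisionRing S] [Algebra F S] [Module.Finite F S]

variable (F S) in
/-- The generator of the group of valuations of norms. -/
def normGen : ℤ := (exists_normValues_generator F S).choose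

lemma normGen_pos : 0 < normGen F S := (exists_normValues_generator F S).choose_spec.1

lemma mem_normValues {n : ℤ} : n ∈ normValues F S ↔ normGen F S ∣ n :=
  (exists_normValues_generator F S).choose_spec.2 n

lemma normGen_mul_div {x : S} (hx : x ≠ 0) :
    normGen F S * (addVal F (Algebra.norm F x) / normGen F S) = addVal F (Algebra.norm F x) :=
  Int.mul_ediv_cancel' (mem_normValues.1 ⟨x, hx, rfl⟩)

variable (F S) in
/-- The normalized valuation of a division algebra over a local field. -/
def divVal : ZVal S where
  v x := addVal F (Algebra.norm F x) / normGen F S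
  v_mul x y hx hy := by
    refine mul_left_cancel₀ (normGen_pos (F := F) (S := S)).ne' ?_
    rw [mul_add, normGen_mul_div hx, normGen_mul_div hy, normGen_mul_div (mul_ne_zero hx hy),
      addVal_norm_mul hx hy]
  v_add x y hx hy h := by
    rw [min_le_iff]
    rcases le_total (addVal F (Algebra.norm F x)) (addVal F (Algebra.norm F y)) with hxy | hxy
    · exact Or.inl (Int.ediv_le_ediv normGen_pos (addVal_norm_le_add hx hy h hxy))
    · right
      rw [add_comm] at h ⊢
      exact Int.ediv_le_ediv normGen_pos (addVal_norm_le_add hy hx h hxy)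
  surj := by
    obtain ⟨x, hx, h⟩ := mem_normValues.2 (dvd_refl (normGen F S))
    exact ⟨x, hx, by rw [h, Int.ediv_self normGen_pos.ne']⟩

lemma normGen_mul_divVal {x : S} (hx : x ≠ 0) :
    normGen F S * (divVal F S).v x = addVal F (Algebra.norm F x) := normGen_mul_div hx

lemma mem_divVal_ball_iff {i : ℤ} {x : S} :
    x ∈ (divVal F S).ball i ↔ Algebra.norm F x ∈ (fieldVal F).ball (normGen F S * i) := by
  rcases eq_or_ne x 0 with rfl | hx
  · simp
  · rw [ZVal.mem_ball_of_ne _ hx, ZVal.mem_ball_of_ne _ (norm_ne_zero hx), fieldVal_v,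
      ← normGen_mul_divVal hx, mul_le_mul_iff_right₀ normGen_pos]

lemma mem_divVal_ball_zero {x : S} : x ∈ (divVal F S).ball 0 ↔ IsIntegral 𝒪[F] x := by
  rw [mem_divVal_ball_iff, mul_zero]
  exact ⟨isIntegral_of_norm_mem, norm_mem_of_isIntegral⟩

variable (F S) in
lemma exists_divVal_algebraMap :
    ∃ e : ℕ, 0 < e ∧ ∀ t : F, t ≠ 0 → (divVal F S).v (algebraMap F S t) = e * addVal F t := by
  have hd : 0 < Module.finrank F S := Module.finrank_pos
  have key (t : F) (ht : t ≠ 0) : normGen F S * (divVal F S).v (algebraMap F S t) =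
      Module.finrank F S * addVal F t := by
    rw [normGen_mul_divVal (by simpa using ht), Algebra.norm_algebraMap]
    exact (fieldVal F).v_pow ht _
  obtain ⟨ϖ, hϖ, h1⟩ := (fieldVal F).surj
  have h2 := key ϖ hϖ
  rw [← fieldVal_v, h1, mul_one] at h2
  have hg := normGen_pos (F := F) (S := S)
  have h3 : 0 < (divVal F S).v (algebraMap F S ϖ) := by
    by_contra! h
    have := mul_nonpos_of_nonneg_of_nonpos hg.le h
    lia
  refine ⟨((divVal F S).v (algebraMap F S ϖ)).toNat, by lia, fun t ht ↦ ?_⟩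
  refine mul_left_cancel₀ hg.ne' ?_
  rw [key t ht, ← h2, Int.toNat_of_nonneg h3.le, mul_assoc]

variable (F S) in
/-- The ramification index of a division algebra over a local field. -/
def divRam : ℕ := (exists_divVal_algebraMap F S).choose

lemma divRam_pos : 0 < divRam F S := (exists_divVal_algebraMap F S).choose_spec.1

lemma divVal_algebraMap {t : F} (ht : t ≠ 0) :
    (divVal F S).v (algebraMap F S t) = divRam F S * addVal F t :=
  (exists_divVal_algebraMap F S).choose_spec.2 t ht

variable (F S) in
lemma exists_divVal_ball_subset_box :
    ∃ C, ∀ k : ℤ, ∀ x ∈ (divVal F S).ball (divRam F S * k), x ∈ box F S (k + C) := by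
  obtain ⟨C, hC⟩ := exists_box_of_norm_mem F S
  refine ⟨C, fun k x hx ↦ ?_⟩
  obtain ⟨t, ht, htk⟩ := (fieldVal F).exists_eq (-k)
  rw [fieldVal_v] at htk
  have ht' : algebraMap F S t ≠ 0 := by simpa using ht
  rw [← smul_mem_box ht, htk, neg_add_cancel_left]
  apply hC
  have := ((divVal F S).mul_mem_ball_iff (i := divRam F S * k) ht').2 hx
  rw [divVal_algebraMap ht, htk, show (divRam F S : ℤ) * -k + divRam F S * k = 0 by ring,
    mem_divVal_ball_iff, mul_zero, ← Algebra.smul_def] at this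
  exact this

/-- Subspaces are closed: a functional that vanishes on `T` but not at `x` is bounded on boxes, so
it separates `x` from `T` by a fixed amount. -/
lemma exists_forall_sub_notMem_box {W : Type*} [AddCommGroup W] [Module F W] [Module.Finite F W]
    {T : Submodule F W} {x : W} (hx : x ∉ T) : ∃ B, ∀ y ∈ T, x - y ∉ box F W B := by
  obtain ⟨f, hf, hT⟩ := T.exists_le_ker_of_notMem hx
  let _ : TopologicalSpace W := moduleTopology F W
  have : IsModuleTopology F W := ⟨rfl⟩
  obtain ⟨i, hi⟩ := exists_subset_ball_of_isCompact ((isCompact_box (F := F) (W := W) 0).image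
    (IsModuleTopology.continuous_of_linearMap (R := F) f))
  refine ⟨addVal F (f x) - i + 1, fun y hy hb ↦ ?_⟩
  obtain ⟨t, ht, hta⟩ := (fieldVal F).exists_eq (-(addVal F (f x) - i + 1))
  rw [fieldVal_v] at hta
  rw [← smul_mem_box ht, hta, neg_add_cancel] at hb
  have h1 := hi ⟨_, hb, rfl⟩
  rw [map_smul, map_sub, LinearMap.mem_ker.1 (hT hy), sub_zero, smul_eq_mul, SetLike.mem_coe,
    ZVal.mem_ball_of_ne _ (mul_ne_zero ht hf), ZVal.v_mul _ _ _ ht hf, fieldVal_v, fieldVal_v,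
    hta] at h1
  lia

/-- A dense subspace of a finite-dimensional division algebra is everything. -/
lemma eq_top_of_dense {T : Submodule F S}
    (h : ∀ x : S, ∀ n : ℕ, ∃ y ∈ T, x - y ∈ (divVal F S).ball n) : T = ⊤ := by
  by_contra hT
  obtain ⟨x, hx⟩ : ∃ x, x ∉ T := by
    by_contra! hh
    exact hT (Submodule.eq_top_iff'.2 hh)
  obtain ⟨B, hB⟩ := exists_forall_sub_notMem_box hx
  obtain ⟨C, hC⟩ := exists_divVal_ball_subset_box F S
  obtain ⟨y, hy, hxy⟩ := h x (divRam F S * (B - C).toNat)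
  refine hB y hy (box_anti ?_ (hC (B - C).toNat _ (by simpa using hxy)))
  lia

section Topology

variable [TopologicalSpace S] [IsModuleTopology F S]

lemma isOpen_divVal_ball (i : ℤ) : IsOpen ((divVal F S).ball i : Set S) := by
  have : ((divVal F S).ball i : Set S) =
      (fun x ↦ Algebra.norm F x) ⁻¹' (fieldVal F).ball (normGen F S * i) := by
    ext x
    exact mem_divVal_ball_iff
  rw [this]
  exact (isOpen_fieldVal_ball _).preimage continuous_norm

lemma isClosed_divVal_ball (i : ℤ) : IsClosed ((divVal F S).ball i : Set S) := by
  have := IsModuleTopology.isTopologicalRing F S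
  exact ((divVal F S).ball i).isClosed_of_isOpen (isOpen_divVal_ball i)

lemma isCompact_divVal_ball_zero : IsCompact ((divVal F S).ball 0 : Set S) := by
  obtain ⟨C, hC⟩ := exists_divVal_ball_subset_box F S
  exact (isCompact_box (F := F) (0 + C)).of_isClosed_subset (isClosed_divVal_ball 0)
    fun x hx ↦ hC 0 x (by simpa using hx)

end Topology

instance finite_residue : Finite (divVal F S).Residue := by
  let _ : TopologicalSpace S := moduleTopology F S
  have : IsModuleTopology F S := ⟨rfl⟩
  have := IsModuleTopology.isTopologicalRing F S
  have : CompactSpace (divVal F S).integerRing :=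
    isCompact_iff_compactSpace.1 isCompact_divVal_ball_zero
  exact AddSubgroup.quotient_finite_of_isOpen (divVal F S).residueIdeal.toAddSubgroup
    ((isOpen_divVal_ball 1).preimage continuous_subtype_val)

/-- Teichmüller representatives. -/
lemma exists_pow_card_eq_self {x : S} (hx : x ∈ (divVal F S).ball 0) :
    ∃ y, y ^ Nat.card (divVal F S).Residue = y ∧ y - x ∈ (divVal F S).ball 1 := by
  let _ : TopologicalSpace S := moduleTopology F S
  have : IsModuleTopology F S := ⟨rfl⟩
  have := IsModuleTopology.isTopologicalRing F S
  set w := divVal F S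
  set Q := Nat.card w.Residue
  -- The limit of `x ^ Q ^ n` is found by compactness: the sets `C n` are nested, closed and contain
  -- `x ^ Q ^ n`, and a common point is fixed by the `Q`-th power.
  let C (n : ℕ) : Set S := {y | y ∈ w.ball 0 ∧ y - x ∈ w.ball 1 ∧ y ^ Q - y ∈ w.ball n}
  have hclosed (n : ℕ) : IsClosed (C n) :=
    (isClosed_divVal_ball 0).inter (((isClosed_divVal_ball 1).preimage (by fun_prop)).inter
      ((isClosed_divVal_ball n).preimage (f := fun y : S ↦ y ^ Q - y) (by fun_prop)))
  obtain ⟨y, hy⟩ := IsCompact.nonempty_iInter_of_sequence_nonempty_isCompact_isClosed C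
    (fun n y hy ↦ ⟨hy.1, hy.2.1, w.ball_anti (by lia) hy.2.2⟩)
    (fun n ↦ ⟨x ^ Q ^ n, w.pow_mem_ball hx _, w.pow_pow_card_sub_self_mem hx n, by
      rw [← pow_mul, ← pow_succ]
      exact w.ball_anti (by lia) (w.pow_pow_card_sub_mem hx n)⟩)
    (isCompact_divVal_ball_zero.of_isClosed_subset (hclosed 0) fun y hy ↦ hy.1) hclosed
  rw [Set.mem_iInter] at hy
  exact ⟨y, sub_eq_zero.1 (w.eq_zero_of_forall_mem fun n ↦ (hy n).2.2), (hy 0).2.1⟩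

end DivisionValuation

/-! ### A root of unity and a uniformizer that normalizes it -/

section CyclicStructure

variable (F : Type*) [Field F] [ValuativeRel F] [TopologicalSpace F] [IsNonarchimedeanLocalField F]
  (S : Type*) [DivisionRing S] [Algebra F S] [Module.Finite F S]

/-- A root of unity generating the residue field, and a uniformizer that normalizes it. -/
structure CyclicData where
  /-- The order of the root of unity. -/
  M : ℕ
  /-- The root of unity. -/
  ζ : S
  /-- The uniformizer. -/
  P : S
  /-- Conjugation by the uniformizer raises the root of unity to this power. -/
  s : ℕ
  M_pos : 0 < M
  natCast_M : (M : S) ∉ (divVal F S).ball 1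
  zeta_pow : ζ ^ M = 1
  zeta_sep : ∀ l, 0 < l → l < M → ζ ^ l - 1 ∉ (divVal F S).ball 1
  digit : ∀ x ∈ (divVal F S).ball 0, x ∉ (divVal F S).ball 1 →
    ∃ a : ℕ, x - ζ ^ a ∈ (divVal F S).ball 1
  P_ne : P ≠ 0
  v_P : (divVal F S).v P = 1
  P_mul_zeta : P * ζ = ζ ^ s * P

/-- The residue ring is a finite field, so its unit group is cyclic; `ζ` is the Teichmüller lift of
a generator and `M = Q - 1`, which is congruent to `-1` and hence a unit. -/
lemma exists_rootOfUnity : ∃ (M : ℕ) (ζ : S), 0 < M ∧ (M : S) ∉ (divVal F S).ball 1 ∧ ζ ^ M = 1 ∧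
    (∀ l, 0 < l → l < M → ζ ^ l - 1 ∉ (divVal F S).ball 1) ∧
    ∀ x ∈ (divVal F S).ball 0, x ∉ (divVal F S).ball 1 →
      ∃ a : ℕ, x - ζ ^ a ∈ (divVal F S).ball 1 := by
  set w := divVal F S
  let _ := w.residueField
  have := Fintype.ofFinite w.Residue
  obtain ⟨u, hu⟩ := IsCyclic.exists_generator (α := w.Residueˣ)
  obtain ⟨⟨x, hx⟩, hxu⟩ := w.residue_surjective (u : w.Residue)
  obtain ⟨ζ, hζ, hζx⟩ := exists_pow_card_eq_self hx
  have hζ0 : ζ ∈ w.ball 0 := by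
    have := add_mem (w.ball_anti (by lia) hζx) hx
    rwa [sub_add_cancel] at this
  have hζu : w.residue ⟨ζ, hζ0⟩ = u := by
    rw [← hxu, w.residue_eq]
    exact hζx
  have hζne : ζ ≠ 0 := by
    rintro rfl
    refine u.ne_zero ?_
    rw [← hζu, w.residue_eq_zero]
    exact zero_mem _
  have hQ : 1 < Nat.card w.Residue := Finite.one_lt_card
  have hord : orderOf u = Nat.card w.Residue - 1 := by
    rw [orderOf_eq_card_of_forall_mem_zpowers hu, Nat.card_units]
  have hpow (l : ℕ) : w.residue (⟨ζ, hζ0⟩ ^ l) = ((u ^ l : w.Residueˣ) : w.Residue) := by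
    rw [map_pow, hζu, Units.val_pow_eq_pow_val]
  refine ⟨Nat.card w.Residue - 1, ζ, by lia, ?_, ?_, ?_, ?_⟩
  · intro h
    have h1 := sub_mem w.natCard_mem_ball h
    rw [Nat.cast_sub hQ.le, sub_sub_cancel, Nat.cast_one] at h1
    exact w.one_notMem_ball_one h1
  · refine mul_left_cancel₀ hζne ?_
    rw [← pow_succ', Nat.sub_add_cancel hQ.le, mul_one]
    exact hζ
  · intro l hl hlM h
    have h1 : w.residue (⟨ζ, hζ0⟩ ^ l) = w.residue 1 := by
      rw [w.residue_eq]
      simpa using h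
    rw [hpow, map_one, Units.val_eq_one] at h1
    have := orderOf_le_of_pow_eq_one hl h1
    lia
  · intro y hy hy1
    have hne : w.residue ⟨y, hy⟩ ≠ 0 := fun h ↦ hy1 (w.residue_eq_zero.1 h)
    obtain ⟨a, ha⟩ := (mem_powers_iff_mem_zpowers (x := u)).2 (hu (Units.mk0 _ hne))
    refine ⟨a, ?_⟩
    have h1 : w.residue ⟨y, hy⟩ = w.residue (⟨ζ, hζ0⟩ ^ a) := by
      rw [hpow]
      exact (congrArg Units.val ha).symm
    rw [w.residue_eq] at h1
    simpa using h1

variable {F S}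

/-- The projection of `x` to the eigenspace `{y | y * ζ = ζ ^ (j + 1) * y}`. -/
def eigenProj (M : ℕ) (ζ : S) (j : ℕ) : S →+ S where
  toFun x := (M : S)⁻¹ * ∑ l ∈ Finset.range M, ζ⁻¹ ^ ((j + 1) * l) * x * ζ ^ l
  map_zero' := by simp
  map_add' x y := by simp [mul_add, add_mul, Finset.sum_add_distrib]

lemma eigenProj_apply (M : ℕ) (ζ : S) (j : ℕ) (x : S) : eigenProj M ζ j x =
    (M : S)⁻¹ * ∑ l ∈ Finset.range M, ζ⁻¹ ^ ((j + 1) * l) * x * ζ ^ l := rfl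

/-- Multiplication by `ζ` shifts the summation index by one, and the end terms agree because `ζ ^ M
= 1`. -/
lemma eigenProj_mul_zeta {M : ℕ} {ζ : S} (hM : 0 < M) (hζ : ζ ^ M = 1) (j : ℕ) (x : S) :
    eigenProj M ζ j x * ζ = ζ ^ (j + 1) * eigenProj M ζ j x := by
  have hζ0 : ζ ≠ 0 := by
    rintro rfl
    simp [hM.ne'] at hζ
  have h1 : (∑ l ∈ Finset.range M, ζ⁻¹ ^ ((j + 1) * l) * x * ζ ^ l) * ζ = ζ ^ (j + 1) *
      ∑ l ∈ Finset.range M, ζ⁻¹ ^ ((j + 1) * (l + 1)) * x * ζ ^ (l + 1) := by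
    rw [Finset.sum_mul, Finset.mul_sum]
    refine Finset.sum_congr rfl fun l _ ↦ ?_
    have h : ζ⁻¹ ^ ((j + 1) * l) = ζ ^ (j + 1) * ζ⁻¹ ^ ((j + 1) * (l + 1)) := by
      rw [mul_add (j + 1) l 1, mul_one, add_comm _ (j + 1), pow_add ζ⁻¹ (j + 1), inv_pow ζ (j + 1),
        mul_inv_cancel_left₀ (pow_ne_zero _ hζ0)]
    rw [h, pow_succ ζ l]
    simp only [mul_assoc]
  have h2 := Finset.sum_range_succ (fun l ↦ ζ⁻¹ ^ ((j + 1) * l) * x * ζ ^ l) M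
  rw [Finset.sum_range_succ'] at h2
  have h3 : ζ⁻¹ ^ ((j + 1) * M) = 1 := by rw [mul_comm, pow_mul, inv_pow, hζ, inv_one, one_pow]
  rw [h3, hζ, mul_zero, pow_zero, pow_zero, add_left_inj] at h2
  rw [eigenProj_apply, mul_assoc, h1, h2, ← mul_assoc, ← mul_assoc]
  congr 1
  exact ((Nat.cast_commute M _).inv_left₀).eq

/-- After exchanging the sums, the term `l = 0` gives `x` and each other one contains a vanishing
geometric sum of `ζ⁻¹ ^ l`. -/
lemma sum_eigenProj {M : ℕ} {ζ : S} (hM : (M : S) ≠ 0) (hζ : ζ ^ M = 1)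
    (hne : ∀ l, 0 < l → l < M → ζ ^ l ≠ 1) (x : S) :
    ∑ j ∈ Finset.range M, eigenProj M ζ j x = x := by
  have hM0 : 0 < M := Nat.pos_of_ne_zero fun h ↦ hM (by simp [h])
  simp_rw [eigenProj_apply]
  rw [← Finset.mul_sum, Finset.sum_comm, Finset.sum_eq_single_of_mem 0 (by simpa)]
  · simp [hM]
  · intro l hl hl0
    rw [Finset.mem_range] at hl
    have h1 := mul_geom_sum (ζ⁻¹ ^ l) M
    rw [← pow_mul, mul_comm l M, pow_mul, inv_pow ζ M, hζ, inv_one, one_pow, sub_self,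
      mul_eq_zero, sub_eq_zero] at h1
    replace h1 := h1.resolve_left fun h ↦ hne l (by lia) hl (by
      rwa [inv_pow, inv_eq_one] at h)
    simp_rw [add_mul, one_mul, pow_add, mul_comm _ l, pow_mul]
    simp_rw [← Finset.sum_mul]
    rw [h1, zero_mul, zero_mul, zero_mul]

variable (F S) in
lemma exists_cyclicData : Nonempty (CyclicData F S) := by
  obtain ⟨M, ζ, hM, hM1, hζ, hsep, hdig⟩ := exists_rootOfUnity F S
  set w := divVal F S
  have hζ0 : ζ ≠ 0 := by
    rintro rfl
    simp [hM.ne'] at hζ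
  have hMne : (M : S) ≠ 0 := fun h ↦ hM1 (h ▸ zero_mem _)
  obtain ⟨x, hx, hx1⟩ := w.surj
  have hsum := sum_eigenProj hMne hζ
    (fun l h h' h1 ↦ hsep l h h' (by rw [h1, sub_self]; exact zero_mem _)) x
  -- The eigencomponents of the uniformizer `x` all lie in `ball 1` and add up to `x`, so one of
  -- them has valuation exactly `1`. It is the required uniformizer, with `s = j + 1`.
  obtain ⟨j, -, hj⟩ : ∃ j ∈ Finset.range M, eigenProj M ζ j x ∉ w.ball 2 := by
    by_contra! h
    have := sum_mem h
    rw [hsum, w.mem_ball_of_ne hx] at this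
    lia
  have hv : w.v ζ = 0 := by
    have := w.v_pow hζ0 M
    rw [hζ, w.v_one, eq_comm, mul_eq_zero] at this
    exact this.resolve_left (by lia)
  have hζm (k : ℕ) : ζ ^ k ∈ w.ball 0 := Or.inr (by rw [w.v_pow hζ0, hv, mul_zero])
  have hζm' (k : ℕ) : ζ⁻¹ ^ k ∈ w.ball 0 :=
    Or.inr (by rw [w.v_pow (inv_ne_zero hζ0), w.v_inv hζ0, hv, neg_zero, mul_zero])
  have hMi : (M : S)⁻¹ ∈ w.ball 0 := by
    rw [w.mem_ball_of_ne hMne] at hM1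
    right
    rw [w.v_inv hMne]
    lia
  have hj1 : eigenProj M ζ j x ∈ w.ball 1 := by
    rw [eigenProj_apply, ← zero_add (1 : ℤ)]
    refine w.mul_mem_ball hMi (sum_mem fun l _ ↦ ?_)
    have := w.mul_mem_ball (w.mul_mem_ball (hζm' ((j + 1) * l)) (Or.inr hx1.ge)) (hζm l)
    rwa [zero_add, add_zero] at this
  have hne : eigenProj M ζ j x ≠ 0 := fun h ↦ hj (h ▸ zero_mem _)
  rw [w.mem_ball_of_ne hne] at hj hj1
  exact ⟨⟨M, ζ, eigenProj M ζ j x, j + 1, hM, hM1, hζ, hsep, hdig, hne, by lia,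
    eigenProj_mul_zeta hM hζ j x⟩⟩

end CyclicStructure

/-! ### Conjugation by the uniformizer and elements of trace one -/

namespace CyclicData

variable {F : Type*} [Field F] [ValuativeRel F] [TopologicalSpace F] [IsNonarchimedeanLocalField F]
  {S : Type*} [DivisionRing S] [Algebra F S] [Module.Finite F S] (d : CyclicData F S)

lemma zeta_ne : d.ζ ≠ 0 := fun h ↦ by
  have := d.zeta_pow
  rw [h, zero_pow d.M_pos.ne'] at this
  exact zero_ne_one this

lemma M_ne : (d.M : S) ≠ 0 := fun h ↦ d.natCast_M (h ▸ zero_mem _)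

lemma v_zeta : (divVal F S).v d.ζ = 0 := by
  have := (divVal F S).v_pow d.zeta_ne d.M
  rw [d.zeta_pow, (divVal F S).v_one, eq_comm, mul_eq_zero] at this
  exact this.resolve_left (by have := d.M_pos; lia)

lemma zeta_pow_mem (k : ℕ) : d.ζ ^ k ∈ (divVal F S).ball 0 :=
  Or.inr (by rw [(divVal F S).v_pow d.zeta_ne, v_zeta, mul_zero])

lemma inv_zeta_pow_mem (k : ℕ) : d.ζ⁻¹ ^ k ∈ (divVal F S).ball 0 :=
  Or.inr (by rw [(divVal F S).v_pow (inv_ne_zero d.zeta_ne), (divVal F S).v_inv d.zeta_ne, v_zeta,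
    neg_zero, mul_zero])

lemma inv_M_mem : (d.M : S)⁻¹ ∈ (divVal F S).ball 0 := by
  have h := d.natCast_M
  rw [ZVal.mem_ball_of_ne _ d.M_ne] at h
  right
  rw [ZVal.v_inv _ d.M_ne]
  lia

lemma orderOf_zeta : orderOf d.ζ = d.M := by
  refine le_antisymm (orderOf_le_of_pow_eq_one d.M_pos d.zeta_pow) ?_
  by_contra! h
  refine d.zeta_sep _ (orderOf_pos_iff.2 (isOfFinOrder_iff_pow_eq_one.2
    ⟨d.M, d.M_pos, d.zeta_pow⟩)) h ?_
  rw [pow_orderOf_eq_one, sub_self]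
  exact zero_mem _

lemma pow_P_mul_pow_zeta (i a : ℕ) : d.P ^ i * d.ζ ^ a = d.ζ ^ (d.s ^ i * a) * d.P ^ i := by
  have h1 (a : ℕ) : d.P * d.ζ ^ a = d.ζ ^ (d.s * a) * d.P := by
    induction a with
    | zero => simp
    | succ a ih =>
      rw [pow_succ, ← mul_assoc, ih, mul_assoc, d.P_mul_zeta, ← mul_assoc, ← pow_add, mul_add,
        mul_one]
  induction i generalizing a with
  | zero => simp
  | succ i ih => rw [pow_succ, mul_assoc, h1, ← mul_assoc, ih, mul_assoc, ← mul_assoc (d.s ^ i),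
      ← pow_succ]

/-- By pigeonhole, two powers of `s` agree modulo `M`; cancelling the smaller power of `P` leaves a
power that commutes with `ζ`. -/
lemma exists_commute_pow_P : ∃ n, 0 < n ∧ Commute (d.P ^ n) d.ζ := by
  obtain ⟨i, j, hij, h⟩ := Finite.exists_ne_map_eq_of_infinite
    (fun i ↦ (⟨d.s ^ i % d.M, Nat.mod_lt _ d.M_pos⟩ : Fin d.M))
  wlog hlt : i < j generalizing i j
  · exact this j i hij.symm h.symm (by lia)
  have h1 : d.ζ ^ d.s ^ i = d.ζ ^ d.s ^ j := by
    rw [← pow_mod_orderOf d.ζ (d.s ^ i), ← pow_mod_orderOf d.ζ (d.s ^ j), orderOf_zeta]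
    exact congrArg (fun k : Fin d.M ↦ d.ζ ^ (k : ℕ)) h
  refine ⟨j - i, by lia, mul_left_cancel₀ (pow_ne_zero i d.P_ne) ?_⟩
  have h2 := d.pow_P_mul_pow_zeta i 1
  have h3 := d.pow_P_mul_pow_zeta j 1
  rw [pow_one, mul_one] at h2 h3
  rw [← mul_assoc, ← pow_add, Nat.add_sub_cancel' hlt.le, h3, ← mul_assoc, h2, mul_assoc,
    ← pow_add, Nat.add_sub_cancel' hlt.le, h1]

open Classical in
/-- The order of the conjugation by the uniformizer on the root of unity. -/
def f : ℕ := Nat.find d.exists_commute_pow_P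

open Classical in
lemma f_pos : 0 < d.f := (Nat.find_spec d.exists_commute_pow_P).1

open Classical in
lemma commute_pow_f : Commute (d.P ^ d.f) d.ζ := (Nat.find_spec d.exists_commute_pow_P).2

open Classical in
lemma not_commute {i : ℕ} (hi : 0 < i) (hf : i < d.f) : ¬ Commute (d.P ^ i) d.ζ := fun h ↦
  Nat.find_min d.exists_commute_pow_P hf ⟨hi, h⟩

lemma zeta_pow_s_injective {i j : ℕ} (hi : i < d.f) (hj : j < d.f)
    (h : d.ζ ^ d.s ^ i = d.ζ ^ d.s ^ j) : i = j := by
  by_contra hij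
  wlog hlt : i < j generalizing i j
  · exact this hj hi h.symm (Ne.symm hij) (by lia)
  refine d.not_commute (i := j - i) (by lia) (by lia)
    (mul_left_cancel₀ (pow_ne_zero i d.P_ne) ?_)
  have h2 := d.pow_P_mul_pow_zeta i 1
  have h3 := d.pow_P_mul_pow_zeta j 1
  rw [pow_one, mul_one] at h2 h3
  rw [← mul_assoc, ← pow_add, Nat.add_sub_cancel' hlt.le, h3, ← mul_assoc, h2, mul_assoc,
    ← pow_add, Nat.add_sub_cancel' hlt.le, h]

/-- The series expansion in the uniformizer. -/
lemma exists_sub_mem (T : AddSubgroup S) (hT : ∀ (a : ℕ) (n : ℤ), d.ζ ^ a * d.P ^ n ∈ T) (x : S)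
    (n : ℕ) : ∃ y ∈ T, x - y ∈ (divVal F S).ball ((divVal F S).v x + n) := by
  set w := divVal F S
  induction n with
  | zero => exact ⟨0, zero_mem _, Or.inr (by simp)⟩
  | succ n ih =>
    obtain ⟨y, hy, hxy⟩ := ih
    set m := w.v x + n
    have hPv : w.v (d.P ^ m) = m := by rw [w.v_zpow d.P_ne, d.v_P, mul_one]
    have hP0 : d.P ^ m ≠ 0 := zpow_ne_zero _ d.P_ne
    have hmem {z : S} {i : ℤ} : z * d.P ^ m ∈ w.ball (m + i) ↔ z ∈ w.ball i := by
      conv_lhs => rw [← hPv]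
      rw [hPv]
      have := w.mul_mem_ball_iff' (i := i) (y := z) hP0
      rwa [hPv] at this
    have hz : (x - y) * d.P ^ (-m) * d.P ^ m = x - y := by
      rw [zpow_neg, inv_mul_cancel_right₀ hP0]
    have hz0 : (x - y) * d.P ^ (-m) ∈ w.ball 0 := by
      rw [← hmem, hz, add_zero]
      exact hxy
    by_cases hz1 : (x - y) * d.P ^ (-m) ∈ w.ball 1
    · refine ⟨y, hy, ?_⟩
      rw [← hmem, hz] at hz1
      exact w.ball_anti (by push_cast; lia) hz1
    · obtain ⟨a, ha⟩ := d.digit _ hz0 hz1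
      refine ⟨y + d.ζ ^ a * d.P ^ m, add_mem hy (hT _ _), ?_⟩
      rw [← hmem, sub_mul, hz] at ha
      rw [← sub_sub]
      exact w.ball_anti (by push_cast; lia) ha

lemma eq_top_of_forall_mem (T : Submodule F S)
    (hT : ∀ (a : ℕ) (n : ℤ), d.ζ ^ a * d.P ^ n ∈ T) : T = ⊤ := by
  refine eq_top_of_dense fun x n ↦ ?_
  obtain ⟨y, hy, h⟩ := d.exists_sub_mem T.toAddSubgroup hT x (n - (divVal F S).v x).toNat
  exact ⟨y, hy, (divVal F S).ball_anti (by lia) h⟩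

/-- The centralizer of `x` is a subspace that contains all `ζ ^ a * P ^ n`, hence is everything by
series expansion; so `x` is central and lies in `F`. -/
lemma mem_range_of_commute [Algebra.IsCentral F S] {x : S} (hζ : Commute x d.ζ)
    (hP : Commute x d.P) : ∃ t : F, algebraMap F S t = x := by
  have h := d.eq_top_of_forall_mem (Subalgebra.centralizer F {x}).toSubmodule fun a n ↦ by
    rw [Subalgebra.mem_toSubmodule, Subalgebra.mem_centralizer_iff]
    rintro _ rfl
    exact (hζ.pow_right a).mul_right (hP.zpow_right₀ n)
  have hc : x ∈ Subalgebra.center F S := by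
    rw [Subalgebra.mem_center_iff]
    intro y
    have : y ∈ (Subalgebra.centralizer F {x}).toSubmodule := h ▸ Submodule.mem_top
    rw [Subalgebra.mem_toSubmodule, Subalgebra.mem_centralizer_iff] at this
    exact (this x rfl).symm
  exact Algebra.mem_bot.1 (Algebra.IsCentral.out hc)

lemma pow_f_mem_range [Algebra.IsCentral F S] : ∃ t : F, algebraMap F S t = d.P ^ d.f :=
  d.mem_range_of_commute d.commute_pow_f ((Commute.refl d.P).pow_left _)

lemma commute_pow_f' [Algebra.IsCentral F S] (x : S) : Commute (d.P ^ d.f) x := by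
  obtain ⟨t, ht⟩ := d.pow_f_mem_range
  rw [← ht]
  exact Algebra.commutes t x

/-! ### Averaging over the conjugates -/

/-- The sum of the conjugates of `x` by the powers of the inverse of the uniformizer. -/
def conjSum : S →+ S where
  toFun x := ∑ i ∈ Finset.range d.f, d.P⁻¹ ^ i * x * d.P ^ i
  map_zero' := by simp
  map_add' x y := by simp [mul_add, add_mul, Finset.sum_add_distrib]

lemma conjSum_apply (x : S) :
    d.conjSum x = ∑ i ∈ Finset.range d.f, d.P⁻¹ ^ i * x * d.P ^ i := rfl

lemma commute_P_of_periodic {h : ℕ → S} {n : ℕ} (hs : ∀ i, h i * d.P = d.P * h (i + 1))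
    (hn : h n = h 0) : Commute (∑ i ∈ Finset.range n, h i) d.P := by
  show _ * _ = _ * _
  rw [Finset.sum_mul, Finset.mul_sum, Finset.sum_congr rfl fun i _ ↦ hs i, ← Finset.mul_sum,
    ← Finset.mul_sum]
  congr 1
  have h1 := Finset.sum_range_succ h n
  rw [Finset.sum_range_succ', hn, add_left_inj] at h1
  exact h1

/-- Each conjugate commutes with `ζ` because `P` normalizes the powers of `ζ`. Conjugation by `P`
permutes the summands cyclically because `P ^ f` is central. -/
lemma conjSum_mem_range [Algebra.IsCentral F S] {x : S} (hx : Commute x d.ζ) :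
    ∃ t : F, algebraMap F S t = d.conjSum x := by
  rw [conjSum_apply]
  refine d.mem_range_of_commute ?_ (d.commute_P_of_periodic
    (h := fun i ↦ d.P⁻¹ ^ i * x * d.P ^ i) (fun i ↦ ?_) ?_)
  · refine Commute.sum_left _ _ _ fun i _ ↦ ?_
    have h1 := d.pow_P_mul_pow_zeta i 1
    rw [pow_one, mul_one] at h1
    have h2 : d.P⁻¹ ^ i * d.ζ ^ d.s ^ i = d.ζ * d.P⁻¹ ^ i := by
      rw [inv_pow, inv_mul_eq_iff_eq_mul₀ (pow_ne_zero _ d.P_ne), ← mul_assoc, h1,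
        mul_inv_cancel_right₀ (pow_ne_zero _ d.P_ne)]
    show d.P⁻¹ ^ i * x * d.P ^ i * d.ζ = d.ζ * (d.P⁻¹ ^ i * x * d.P ^ i)
    rw [mul_assoc, h1, mul_assoc, ← mul_assoc x, (hx.pow_right _).eq, ← mul_assoc, ← mul_assoc, h2,
      ← mul_assoc, ← mul_assoc]
  · rw [pow_succ' d.P⁻¹, ← mul_assoc, ← mul_assoc, mul_inv_cancel_left₀ d.P_ne, pow_succ]
    simp only [mul_assoc]
  · rw [pow_zero, one_mul, pow_zero, mul_one, mul_assoc, inv_pow,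
      inv_mul_eq_iff_eq_mul₀ (pow_ne_zero _ d.P_ne)]
    exact (d.commute_pow_f' x).symm

/-- An integral element of the unramified subfield of trace one. -/
lemma exists_trace_eq_one [Algebra.IsCentral F S] : ∃ z : S, z ∈ Algebra.adjoin F {d.ζ} ∧
    z ∈ (divVal F S).ball 0 ∧ ∑ i ∈ Finset.range d.f, d.P ^ i * z * d.P⁻¹ ^ i = 1 := by
  set w := divVal F S
  have hconj (i a : ℕ) : d.P ^ i * d.ζ ^ a * d.P⁻¹ ^ i = d.ζ ^ (d.s ^ i * a) := by
    rw [pow_P_mul_pow_zeta, inv_pow, mul_inv_cancel_right₀ (pow_ne_zero _ d.P_ne)]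
  let t (a : ℕ) : S := ∑ i ∈ Finset.range d.f, d.ζ ^ (d.s ^ i * a)
  -- Here `t a` is the trace of `ζ ^ a`. By orthogonality, the sum of `ζ⁻¹ ^ a * t a` is the unit
  -- `M`, as only the identity conjugate survives; so some `t a` is a unit, and `ζ ^ a` divided by
  -- it has trace one.
  obtain ⟨a, ha⟩ : ∃ a, t a ∉ w.ball 1 := by
    by_contra! h
    have h1 : ∑ a ∈ Finset.range d.M, d.ζ⁻¹ ^ a * t a ∈ w.ball 1 := sum_mem fun a _ ↦ by
      have := w.mul_mem_ball (d.inv_zeta_pow_mem a) (h a)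
      rwa [zero_add] at this
    simp_rw [t, Finset.mul_sum] at h1
    rw [Finset.sum_comm, Finset.sum_eq_single_of_mem 0 (by simpa using d.f_pos)] at h1
    · refine d.natCast_M ?_
      simpa [inv_mul_cancel₀ (pow_ne_zero _ d.zeta_ne)] using h1
    · intro i hi hi0
      rw [Finset.mem_range] at hi
      have hcomm : Commute d.ζ⁻¹ (d.ζ ^ d.s ^ i) :=
        ((Commute.refl d.ζ).inv_left₀).pow_right _
      have h2 := mul_geom_sum (d.ζ⁻¹ * d.ζ ^ d.s ^ i) d.M
      rw [hcomm.mul_pow, inv_pow, ← pow_mul, mul_comm _ d.M, pow_mul, d.zeta_pow, one_pow, inv_one,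
        one_mul, sub_self, mul_eq_zero, sub_eq_zero] at h2
      replace h2 := h2.resolve_left fun h3 ↦ hi0 (d.zeta_pow_s_injective hi d.f_pos (by
        rw [inv_mul_eq_iff_eq_mul₀ d.zeta_ne] at h3
        rw [h3, pow_zero, pow_one, mul_one]))
      rw [← h2]
      refine Finset.sum_congr rfl fun a _ ↦ ?_
      rw [hcomm.mul_pow, pow_mul]
  have hta : t a ≠ 0 := fun h ↦ ha (h ▸ zero_mem _)
  have hcζ : Commute (t a) d.ζ := Commute.sum_left _ _ _ fun i _ ↦ (Commute.refl _).pow_left _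
  have hcP : Commute d.P (t a) := by
    have h1 : d.P * t a * d.P⁻¹ = t a := by
      simp_rw [t, Finset.mul_sum, Finset.sum_mul]
      have h2 (i : ℕ) : d.P * d.ζ ^ (d.s ^ i * a) * d.P⁻¹ = d.ζ ^ (d.s ^ (i + 1) * a) := by
        have := hconj 1 (d.s ^ i * a)
        rwa [pow_one, pow_one, pow_one, ← mul_assoc, ← pow_succ'] at this
      simp_rw [h2]
      have h3 := Finset.sum_range_succ (fun i ↦ d.ζ ^ (d.s ^ i * a)) d.f
      have h4 : d.ζ ^ (d.s ^ d.f * a) = d.ζ ^ (d.s ^ 0 * a) := by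
        rw [← hconj, (d.commute_pow_f' _).eq, inv_pow,
          mul_inv_cancel_right₀ (pow_ne_zero _ d.P_ne), pow_zero, one_mul]
      rw [Finset.sum_range_succ', h4, add_left_inj] at h3
      exact h3
    rw [mul_inv_eq_iff_eq_mul₀ d.P_ne] at h1
    exact h1
  obtain ⟨t', ht'⟩ := d.mem_range_of_commute hcζ hcP.symm
  have ht0 : t' ≠ 0 := by
    rintro rfl
    rw [map_zero] at ht'
    exact hta ht'.symm
  refine ⟨t'⁻¹ • d.ζ ^ a, Subalgebra.smul_mem _
    (pow_mem (Algebra.self_mem_adjoin_singleton F d.ζ) a) _, ?_, ?_⟩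
  · rw [Algebra.smul_def, map_inv₀, ht']
    have h1 : (t a)⁻¹ ∈ w.ball 0 := by
      rw [w.mem_ball_of_ne hta] at ha
      right
      rw [w.v_inv hta]
      lia
    have := w.mul_mem_ball h1 (d.zeta_pow_mem a)
    rwa [zero_add] at this
  · simp_rw [mul_smul_comm, smul_mul_assoc, hconj]
    rw [← Finset.smul_sum, Algebra.smul_def, map_inv₀, ht']
    exact inv_mul_cancel₀ hta

end CyclicData

lemma map_sum_of_add {A H ι : Type*} [AddCommGroup A] [AddCommGroup H] (X : AddSubgroup A)
    {lam : A → H} (hadd : ∀ x ∈ X, ∀ y ∈ X, lam (x + y) = lam x + lam y) (s : Finset ι) (g : ι → A)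
    (hg : ∀ i ∈ s, g i ∈ X) : lam (∑ i ∈ s, g i) = ∑ i ∈ s, lam (g i) := by
  classical
  induction s using Finset.induction_on with
  | empty =>
    have := hadd 0 (zero_mem _) 0 (zero_mem _)
    simpa using this
  | insert i s hi ih =>
    rw [Finset.forall_mem_insert] at hg
    rw [Finset.sum_insert hi, Finset.sum_insert hi, hadd _ hg.1 _ (sum_mem hg.2), ih hg.2]

/-! ### The explicit reduced trace and conjugation invariant functions -/

namespace CyclicData

variable {F : Type*} [Field F] [ValuativeRel F] [TopologicalSpace F] [IsNonarchimedeanLocalField F]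
  {S : Type*} [DivisionRing S] [Algebra F S] [Module.Finite F S] (d : CyclicData F S)

lemma commute_eigenProj_zero (x : S) : Commute (eigenProj d.M d.ζ 0 x) d.ζ := by
  have := eigenProj_mul_zeta d.M_pos d.zeta_pow 0 x
  rwa [zero_add, pow_one] at this

lemma eigenProj_smul (j : ℕ) (t : F) (x : S) :
    eigenProj d.M d.ζ j (t • x) = t • eigenProj d.M d.ζ j x := by
  simp_rw [eigenProj_apply, mul_smul_comm, smul_mul_assoc]
  rw [← Finset.smul_sum, mul_smul_comm]

lemma conjSum_smul (t : F) (x : S) : d.conjSum (t • x) = t • d.conjSum x := by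
  simp_rw [conjSum_apply, mul_smul_comm, smul_mul_assoc]
  rw [← Finset.smul_sum]

section Trace

variable [Algebra.IsCentral F S]

lemma exists_algebraMap_eq_conjSum (x : S) :
    ∃ t : F, algebraMap F S t = d.conjSum (eigenProj d.M d.ζ 0 x) :=
  d.conjSum_mem_range (d.commute_eigenProj_zero x)

/-- The reduced trace of the division algebra. -/
def trd : S →ₗ[F] F where
  toFun x := (d.exists_algebraMap_eq_conjSum x).choose
  map_add' x y := by
    apply (algebraMap F S).injective
    refine (d.exists_algebraMap_eq_conjSum (x + y)).choose_spec.trans ?_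
    rw [(algebraMap F S).map_add, (d.exists_algebraMap_eq_conjSum x).choose_spec,
      (d.exists_algebraMap_eq_conjSum y).choose_spec, map_add, map_add]
  map_smul' t x := by
    apply (algebraMap F S).injective
    refine (d.exists_algebraMap_eq_conjSum (t • x)).choose_spec.trans ?_
    rw [smul_eq_mul, map_mul, (d.exists_algebraMap_eq_conjSum x).choose_spec, eigenProj_smul,
      conjSum_smul, Algebra.smul_def, RingHom.id_apply]

lemma algebraMap_trd (x : S) : algebraMap F S (d.trd x) = d.conjSum (eigenProj d.M d.ζ 0 x) :=
  (d.exists_algebraMap_eq_conjSum x).choose_spec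

lemma inv_pow_P_conj_mem {X : AddSubgroup S} (hXc : ∀ g, g ≠ 0 → ∀ x ∈ X, g * x * g⁻¹ ∈ X) {x : S}
    (hx : x ∈ X) (i : ℕ) : d.P⁻¹ ^ i * x * d.P ^ i ∈ X := by
  have := hXc (d.P⁻¹ ^ i) (pow_ne_zero _ (inv_ne_zero d.P_ne)) x hx
  rwa [inv_pow, inv_inv, ← inv_pow] at this

lemma eigenProj_mem {X : AddSubgroup S} (hX : ∀ u ∈ (divVal F S).ball 0, ∀ x ∈ X, u * x ∈ X)
    (hXc : ∀ g, g ≠ 0 → ∀ x ∈ X, g * x * g⁻¹ ∈ X) {x : S} (hx : x ∈ X) (j : ℕ) :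
    eigenProj d.M d.ζ j x ∈ X := by
  rw [eigenProj_apply]
  refine hX _ d.inv_M_mem _ (sum_mem fun l _ ↦ ?_)
  have h1 : d.ζ⁻¹ ^ ((j + 1) * l) * x * d.ζ ^ l =
      d.ζ⁻¹ ^ (j * l) * (d.ζ⁻¹ ^ l * x * (d.ζ⁻¹ ^ l)⁻¹) := by
    rw [← inv_pow, inv_inv, ← mul_assoc, ← mul_assoc, ← pow_add, add_mul, one_mul]
  rw [h1]
  exact hX _ (d.inv_zeta_pow_mem _) _ (hXc _ (pow_ne_zero _ (inv_ne_zero d.zeta_ne)) _ hx)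

/-- Conjugation and multiplication by integral elements preserve `X`, and `M` is a unit, so no
denominators appear. It bounds the reduced traces of the elements of `𝔓 ^ j`. -/
lemma trd_mem {X : AddSubgroup S} (hX : ∀ u ∈ (divVal F S).ball 0, ∀ x ∈ X, u * x ∈ X)
    (hXc : ∀ g, g ≠ 0 → ∀ x ∈ X, g * x * g⁻¹ ∈ X) {x : S} (hx : x ∈ X) :
    algebraMap F S (d.trd x) ∈ X := by
  rw [algebraMap_trd, conjSum_apply]
  exact sum_mem fun i _ ↦ d.inv_pow_P_conj_mem hXc (d.eigenProj_mem hX hXc hx 0) i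

/-- A conjugation invariant additive function factors through the reduced trace. -/
theorem eq_of_conj_invariant {X : AddSubgroup S}
    (hX : ∀ u ∈ (divVal F S).ball 0, ∀ x ∈ X, u * x ∈ X)
    (hXc : ∀ g, g ≠ 0 → ∀ x ∈ X, g * x * g⁻¹ ∈ X) {H : Type*} [AddCommGroup H] {lam : S → H}
    (hadd : ∀ x ∈ X, ∀ y ∈ X, lam (x + y) = lam x + lam y)
    (hconj : ∀ g, g ≠ 0 → ∀ x ∈ X, lam (g * x * g⁻¹) = lam x) {z : S}
    (hz0 : z ∈ (divVal F S).ball 0)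
    (hz : ∑ i ∈ Finset.range d.f, d.P ^ i * z * d.P⁻¹ ^ i = 1) {x : S} (hx : x ∈ X) :
    lam x = lam (algebraMap F S (d.trd x) * z) := by
  have hproj := d.eigenProj_mem hX hXc hx
  have hζi (a : ℕ) : d.ζ⁻¹ ^ a = (d.ζ ^ a)⁻¹ := inv_pow _ _
  -- On this eigencomponent `y`, conjugation by `ζ` is multiplication by `ζ⁻¹ ^ j`. As `u = ζ⁻¹ ^ j
  -- - 1` is a unit, `y` is the difference of a conjugate of `u⁻¹ * y` and `u⁻¹ * y` itself.
  have hkill (j : ℕ) (hj0 : 0 < j) (hj : j < d.M) : lam (eigenProj d.M d.ζ j x) = 0 := by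
    set y := eigenProj d.M d.ζ j x
    set u := d.ζ⁻¹ ^ j - 1
    have hu : u ∉ (divVal F S).ball 1 := fun h ↦ d.zeta_sep j hj0 hj (by
      have h1 := (divVal F S).mul_mem_ball (d.zeta_pow_mem j) (neg_mem h)
      rwa [neg_sub, mul_sub, mul_one, hζi, mul_inv_cancel₀ (pow_ne_zero _ d.zeta_ne),
        zero_add] at h1)
    have hu0 : u ≠ 0 := fun h ↦ hu (h ▸ zero_mem _)
    have hui : u⁻¹ ∈ (divVal F S).ball 0 := by
      rw [ZVal.mem_ball_of_ne _ hu0] at hu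
      right
      rw [ZVal.v_inv _ hu0]
      lia
    have hcu : Commute u⁻¹ d.ζ := Commute.inv_left₀
      ((((Commute.refl d.ζ).inv_left₀).pow_left j).sub_left (Commute.one_left _))
    have hy' := hX _ hui _ (hproj j)
    have h1 : d.ζ * (u⁻¹ * y) * d.ζ⁻¹ = u⁻¹ * y + y := by
      have h2 : d.ζ * y * d.ζ⁻¹ = d.ζ⁻¹ ^ j * y := by
        rw [mul_inv_eq_iff_eq_mul₀ d.zeta_ne, mul_assoc, eigenProj_mul_zeta d.M_pos d.zeta_pow j x,
          pow_succ, hζi, mul_assoc, inv_mul_cancel_left₀ (pow_ne_zero _ d.zeta_ne)]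
      rw [← mul_assoc, ← hcu.eq, mul_assoc, mul_assoc, ← mul_assoc d.ζ, h2,
        show d.ζ⁻¹ ^ j * y = u * y + y by simp only [u]; rw [sub_mul, one_mul, sub_add_cancel],
        mul_add, inv_mul_cancel_left₀ hu0, add_comm]
    have h2 := hconj _ d.zeta_ne _ hy'
    rw [h1, hadd _ hy' _ (hproj j)] at h2
    exact left_eq_add.1 h2.symm
  have h1 : lam x = lam (eigenProj d.M d.ζ 0 x) := by
    conv_lhs => rw [← sum_eigenProj d.M_ne d.zeta_pow
      (fun l h h' h1 ↦ d.zeta_sep l h h' (by rw [h1, sub_self]; exact zero_mem _)) x]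
    rw [map_sum_of_add X hadd _ _ fun j _ ↦ hproj j]
    refine Finset.sum_eq_single_of_mem 0 (by simpa using d.M_pos) fun j hj hj0 ↦ ?_
    exact hkill j (by lia) (by simpa using hj)
  set y := eigenProj d.M d.ζ 0 x
  have hXi (i : ℕ) : z * (d.P⁻¹ ^ i * y * d.P ^ i) ∈ X :=
    hX _ hz0 _ (d.inv_pow_P_conj_mem hXc (hproj 0) i)
  -- Insert `1` as the sum of the conjugates of `z`; invariance then moves the conjugation from `z`
  -- to `y`, which produces the trace of `y` times `z`.
  have hsum : y = ∑ i ∈ Finset.range d.f,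
      d.P ^ i * (z * (d.P⁻¹ ^ i * y * d.P ^ i)) * (d.P ^ i)⁻¹ := by
    conv_lhs => rw [← one_mul y, ← hz, Finset.sum_mul]
    refine Finset.sum_congr rfl fun i _ ↦ ?_
    rw [eq_mul_inv_iff_mul_eq₀ (pow_ne_zero _ d.P_ne)]
    simp only [mul_assoc]
  rw [h1, algebraMap_trd, conjSum_apply]
  conv_lhs => rw [hsum]
  rw [map_sum_of_add X hadd _ _ fun i _ ↦ hXc _ (pow_ne_zero _ d.P_ne) _ (hXi i),
    Finset.sum_congr rfl fun i _ ↦ hconj _ (pow_ne_zero _ d.P_ne) _ (hXi i),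
    ← map_sum_of_add X hadd _ _ fun i _ ↦ hXi i, ← Finset.mul_sum,
    ← conjSum_apply, ← algebraMap_trd, Algebra.commutes]

end Trace

end CyclicData

/-! ### The unramified maximal subfield and the dimension of the division algebra -/

section AdjoinField

variable {F : Type*} [Field F] {S : Type*} [DivisionRing S] [Algebra F S] [Module.Finite F S]

/-- The field generated by an element of a division algebra. -/
@[reducible]
def adjoinField (z : S) : Field (Algebra.adjoin F {z}) :=
  have := Algebra.isMulCommutative_adjoin F (s := {z}) (by rintro _ rfl _ rfl; rfl)
  letI : CommRing (Algebra.adjoin F {z}) := inferInstance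
  have : IsField (Algebra.adjoin F {z}) :=
    isField_of_isIntegral_of_isField' (R := F) (Field.toIsField F)
  this.toField

end AdjoinField

namespace CyclicData

variable {F : Type*} [Field F] [ValuativeRel F] [TopologicalSpace F] [IsNonarchimedeanLocalField F]
  {S : Type*} [DivisionRing S] [Algebra F S] [Module.Finite F S] (d : CyclicData F S)

/-- The unramified subfield. -/
abbrev E : Subalgebra F S := Algebra.adjoin F {d.ζ}

instance : Field d.E := adjoinField d.ζ

/-- Conjugation by the uniformizer. -/
def conj : S →ₐ[F] S where
  toFun x := d.P * x * d.P⁻¹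
  map_one' := by rw [mul_one, mul_inv_cancel₀ d.P_ne]
  map_mul' x y := by simp only [mul_assoc, inv_mul_cancel_left₀ d.P_ne]
  map_zero' := by simp
  map_add' x y := by rw [mul_add, add_mul]
  commutes' r := by rw [← Algebra.commutes, mul_assoc, mul_inv_cancel₀ d.P_ne, mul_one]

/-- Conjugation by the uniformizer on the unramified subfield. -/
def conjHom : d.E →ₐ[F] d.E :=
  AlgHom.codRestrict (d.conj.comp d.E.val) d.E fun x ↦ by
    show d.P * (x : S) * d.P⁻¹ ∈ d.E
    obtain ⟨x, hx⟩ := x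
    induction hx using Algebra.adjoin_induction with
    | mem y hy =>
      obtain rfl : y = d.ζ := hy
      rw [d.P_mul_zeta, mul_inv_cancel_right₀ d.P_ne]
      exact pow_mem (Algebra.self_mem_adjoin_singleton F d.ζ) _
    | algebraMap r =>
      rw [← Algebra.commutes, mul_assoc, mul_inv_cancel₀ d.P_ne, mul_one]
      exact Subalgebra.algebraMap_mem _ r
    | add a b _ _ ha hb =>
      rw [mul_add, add_mul]
      exact add_mem ha hb
    | mul a b _ _ ha hb =>
      have := mul_mem ha hb
      simpa only [mul_assoc, inv_mul_cancel_left₀ d.P_ne] using this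

/-- Conjugation by the uniformizer as an automorphism of the unramified subfield. -/
def conjEquiv : d.E ≃ₐ[F] d.E :=
  AlgEquiv.ofBijective d.conjHom (Algebra.IsAlgebraic.algHom_bijective d.conjHom)

lemma coe_conjEquiv_pow (i : ℕ) (x : d.E) :
    ((d.conjEquiv ^ i) x : S) = d.P ^ i * x * (d.P ^ i)⁻¹ := by
  induction i generalizing x with
  | zero => simp
  | succ i ih =>
    rw [pow_succ, AlgEquiv.mul_apply, ih]
    show d.P ^ i * (d.P * x * d.P⁻¹) * (d.P ^ i)⁻¹ = _
    rw [pow_succ, mul_inv_rev]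
    simp only [mul_assoc]

lemma orderOf_conjEquiv [Algebra.IsCentral F S] : orderOf d.conjEquiv = d.f := by
  rw [orderOf_eq_iff d.f_pos]
  constructor
  · ext x
    rw [coe_conjEquiv_pow, (d.commute_pow_f' _).eq,
      mul_inv_cancel_right₀ (pow_ne_zero _ d.P_ne)]
    rfl
  · intro i hi hi0 h
    have h1 := d.coe_conjEquiv_pow i ⟨d.ζ, Algebra.self_mem_adjoin_singleton F d.ζ⟩
    rw [h, eq_mul_inv_iff_mul_eq₀ (pow_ne_zero _ d.P_ne)] at h1
    exact d.not_commute hi0 hi h1.symm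

/-- By Artin: an element of `F[ζ]` fixed by conjugation by `P` commutes with `ζ` and `P`, so the
fixed field is `F`, and the degree is the order of the conjugation. -/
lemma finrank_E [Algebra.IsCentral F S] : Module.finrank F d.E = d.f := by
  have h := IntermediateField.finrank_fixedField_eq_card (Subgroup.zpowers d.conjEquiv)
  have hbot : IntermediateField.fixedField (Subgroup.zpowers d.conjEquiv) = ⊥ := by
    refine eq_bot_iff.2 fun x hx ↦ ?_
    rw [IntermediateField.mem_fixedField_iff] at hx
    have h1 := hx _ (Subgroup.mem_zpowers d.conjEquiv)
    have h2 : Commute (x : S) d.P := by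
      have h3 : d.P * (x : S) * d.P⁻¹ = x := congrArg Subtype.val h1
      rw [mul_inv_eq_iff_eq_mul₀ d.P_ne] at h3
      exact h3.symm
    have h3 : Commute (x : S) d.ζ := congrArg Subtype.val
      (mul_comm x ⟨d.ζ, Algebra.self_mem_adjoin_singleton F d.ζ⟩)
    obtain ⟨t, ht⟩ := d.mem_range_of_commute h3 h2
    exact IntermediateField.mem_bot.2 ⟨t, Subtype.ext ht⟩
  rw [hbot, IntermediateField.finrank_bot', Nat.card_zpowers, orderOf_conjEquiv] at h
  exact h

/-- The powers of the uniformizer span the division algebra over the unramified subfield. -/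
lemma span_pow_P [Algebra.IsCentral F S] :
    Submodule.span d.E (Set.range fun i : Fin d.f ↦ d.P ^ (i : ℕ)) = ⊤ := by
  have h := d.eq_top_of_forall_mem ((Submodule.span d.E
    (Set.range fun i : Fin d.f ↦ d.P ^ (i : ℕ))).restrictScalars F) fun a n ↦ by
    obtain ⟨t, ht⟩ := d.pow_f_mem_range
    have hf : (0 : ℤ) < d.f := by exact_mod_cast d.f_pos
    have hr := Int.emod_nonneg n hf.ne'
    have hr' := Int.emod_lt_of_pos n hf
    obtain ⟨i, hi⟩ := Int.eq_ofNat_of_zero_le hr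
    rw [hi] at hr'
    have h1 : d.P ^ n = algebraMap F S (t ^ (n / d.f)) * d.P ^ i := by
      conv_lhs => rw [← Int.mul_ediv_add_emod n d.f, zpow_add₀ d.P_ne, zpow_mul, hi]
      rw [map_zpow₀, ht, zpow_natCast, zpow_natCast]
    have h2 : d.ζ ^ a * d.P ^ n = (t ^ (n / d.f) •
        (⟨d.ζ, Algebra.self_mem_adjoin_singleton F d.ζ⟩ : d.E) ^ a) • d.P ^ i := by
      rw [h1, ← mul_assoc, ← Algebra.commutes, smul_assoc, Algebra.smul_def, mul_assoc]
      rfl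
    rw [h2]
    exact Submodule.smul_mem _ _ (Submodule.subset_span
      (Set.mem_range_self (⟨i, by lia⟩ : Fin d.f)))
  rw [eq_top_iff]
  intro x _
  have : x ∈ (Submodule.span d.E
    (Set.range fun i : Fin d.f ↦ d.P ^ (i : ℕ))).restrictScalars F := h ▸ Submodule.mem_top
  exact this

/-- Right multiplication by the root of unity. -/
def mulZeta : Module.End d.E S where
  toFun x := x * d.ζ
  map_add' x y := add_mul x y d.ζ
  map_smul' a x := smul_mul_assoc a x d.ζ

/-- The powers of `P` are eigenvectors of right multiplication by `ζ`, with the distinct eigenvalues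
`ζ ^ s ^ i`. -/
lemma linearIndependent_pow_P :
    LinearIndependent d.E fun i : Fin d.f ↦ d.P ^ (i : ℕ) := by
  refine Module.End.eigenvectors_linearIndependent' d.mulZeta (fun i : Fin d.f ↦
    (⟨d.ζ, Algebra.self_mem_adjoin_singleton F d.ζ⟩ : d.E) ^ d.s ^ (i : ℕ)) ?_ _ fun i ↦
    Module.End.hasEigenvector_iff.2 ⟨Module.End.mem_eigenspace_iff.2 ?_, pow_ne_zero _ d.P_ne⟩
  · intro i j h
    exact Fin.ext (d.zeta_pow_s_injective i.2 j.2 (congrArg Subtype.val h))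
  · have := d.pow_P_mul_pow_zeta i 1
    rw [pow_one, mul_one] at this
    exact this

lemma finrank_E_left [Algebra.IsCentral F S] : Module.finrank d.E S = d.f := by
  rw [Module.finrank_eq_card_basis (Module.Basis.mk d.linearIndependent_pow_P d.span_pow_P.ge),
    Fintype.card_fin]

lemma finrank_eq_sq [Algebra.IsCentral F S] : Module.finrank F S = d.f * d.f := by
  rw [← Module.finrank_mul_finrank F d.E S, finrank_E, finrank_E_left]

end CyclicData

/-! ### Elementary endomorphisms -/

section Elementary

variable {S V ι : Type*} [DivisionRing S] [AddCommGroup V] [Module S V] [Fintype ι]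
  [DecidableEq ι] (b : Module.Basis ι S V)

/-- The endomorphism that sends `b l` to `x • b k` and kills the other basis vectors. -/
def elem (k l : ι) (x : S) : Module.End S V :=
  (LinearMap.toSpanSingleton S V (x • b k)).comp (b.coord l)

lemma elem_apply (k l : ι) (x : S) (v : V) : elem b k l x v = b.repr v l • x • b k := rfl

lemma elem_add (k l : ι) (x y : S) : elem b k l (x + y) = elem b k l x + elem b k l y := by
  ext v
  simp [elem_apply, add_smul]

/-- `elem` as an additive map. -/
def elemHom (k l : ι) : S →+ Module.End S V := AddMonoidHom.mk' (elem b k l) (elem_add b k l)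

lemma elem_zero (k l : ι) : elem b k l (0 : S) = 0 := (elemHom b k l).map_zero

lemma elem_sub (k l : ι) (x y : S) : elem b k l (x - y) = elem b k l x - elem b k l y :=
  (elemHom b k l).map_sub x y

lemma elem_sum {α : Type*} (k l : ι) (s : Finset α) (g : α → S) :
    elem b k l (∑ i ∈ s, g i) = ∑ i ∈ s, elem b k l (g i) := map_sum (elemHom b k l) g s

/-- The factors appear in the opposite order because scalars act on the left of `V`, on the same
side as the endomorphisms. -/
lemma elem_mul_elem (k l p : ι) (x y : S) :
    elem b k l x * elem b l p y = elem b k p (y * x) := by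
  ext v
  simp [elem_apply, mul_smul]

lemma elem_mul_elem_of_ne (k : ι) {l l' : ι} (p : ι) (x y : S) (h : l ≠ l') :
    elem b k l x * elem b l' p y = 0 := by
  ext v
  simp [elem_apply, h.symm]

/-- The matrix entries of an endomorphism. -/
def entry (a : Module.End S V) (k l : ι) : S := b.repr (a (b l)) k

lemma sum_elem_entry (a : Module.End S V) : ∑ l, ∑ k, elem b k l (entry b a k l) = a := by
  refine b.ext fun p ↦ ?_
  simp_rw [LinearMap.sum_apply, elem_apply]
  rw [Finset.sum_eq_single p]
  · simp [entry, b.sum_repr]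
  · intro l _ hl
    simp [hl.symm]
  · simp

lemma sum_elem_one : ∑ l, elem b l l (1 : S) = 1 := by
  refine b.ext fun p ↦ ?_
  simp_rw [LinearMap.sum_apply, elem_apply]
  rw [Finset.sum_eq_single p]
  · simp
  · intro l _ hl
    simp [hl.symm]
  · simp

lemma entry_smul {F : Type*} [Field F] [Algebra F S] [Module F V] [IsScalarTower F S V] (t : F)
    (a : Module.End S V) (k l : ι) : entry b (t • a) k l = t • entry b a k l := by
  rw [entry, LinearMap.smul_apply, ← algebraMap_smul S t (a (b l)), map_smul, Finsupp.smul_apply,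
    algebraMap_smul]
  rfl

lemma elem_smul {F : Type*} [Field F] [Algebra F S] [Module F V] [IsScalarTower F S V] (t : F)
    (k l : ι) (x : S) : elem b k l (t • x) = t • elem b k l x := by
  ext v
  rw [LinearMap.smul_apply, elem_apply, elem_apply, smul_assoc, smul_comm]

end Elementary

/-! ### Traces in a representation of minimal dimension -/

section Trace

variable {F : Type*} [Field F] [ValuativeRel F] [TopologicalSpace F] [IsNonarchimedeanLocalField F]
  {S : Type*} [DivisionRing S] [Algebra F S] [Module.Finite F S] [Algebra.IsCentral F S]
  (d : CyclicData F S)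
  {V ι : Type*} [AddCommGroup V] [Module S V] [Module F V] [IsScalarTower F S V] [Fintype ι]
  [DecidableEq ι] (b : Module.Basis ι S V)
  {K W : Type*} [Field K] [IsAlgClosed K] [Algebra F K] [AddCommGroup W] [Module K W] [Module F W]
  [IsScalarTower F K W] [Module.Finite K W] (ρ : Module.End S V →ₐ[F] Module.End K W)

/-- An eigenvector of the root of unity. -/
lemma exists_eigenvector (k : ι) (hW : 0 < Module.finrank K W) :
    ∃ (w : W) (μ : K), w ≠ 0 ∧ ρ (elem b k k 1) w = w ∧ ρ (elem b k k d.ζ) w = μ • w := by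
  set g := ρ (elem b k k 1)
  have hgg : g * g = g := by rw [← map_mul, elem_mul_elem, one_mul]
  -- The idempotents `elem b l l 1` all factor through this one and add up to `1`, so it cannot act
  -- as zero on a nonzero space.
  have hne : g ≠ 0 := by
    intro h
    have h1 : (1 : Module.End K W) = 0 := by
      rw [← map_one ρ, ← sum_elem_one b, map_sum]
      refine Finset.sum_eq_zero fun l _ ↦ ?_
      rw [show elem b l l (1 : S) = elem b l k 1 * elem b k k 1 * elem b k l 1 by
        simp [elem_mul_elem], map_mul, map_mul]
      show _ * g * _ = 0
      rw [h, mul_zero, zero_mul]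
    have := Module.finrank_pos_iff.1 hW
    exact one_ne_zero h1
  let U := LinearMap.range g
  have hT : ∀ u ∈ U, ρ (elem b k k d.ζ) u ∈ U := by
    rintro _ ⟨v, rfl⟩
    refine ⟨ρ (elem b k k d.ζ) (g v), ?_⟩
    rw [← Module.End.mul_apply, ← map_mul, elem_mul_elem, mul_one]
  have : Nontrivial U := by
    rw [Submodule.nontrivial_iff_ne_bot]
    exact fun h ↦ hne (LinearMap.range_eq_bot.1 h)
  obtain ⟨μ, hμ⟩ := Module.End.exists_eigenvalue ((ρ (elem b k k d.ζ)).restrict hT)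
  obtain ⟨⟨w, v, rfl⟩, hw⟩ := hμ.exists_hasEigenvector
  refine ⟨g v, μ, fun h ↦ hw.2 (Subtype.ext h), ?_, congrArg Subtype.val hw.apply_eq_smul⟩
  rw [← Module.End.mul_apply, hgg]

variable {d ρ}

lemma elem_apply_pow {k : ι} {w : W} {μ : K} (hw1 : ρ (elem b k k 1) w = w)
    (hμ : ρ (elem b k k d.ζ) w = μ • w) (n : ℕ) : ρ (elem b k k (d.ζ ^ n)) w = μ ^ n • w := by
  induction n with
  | zero => simp [hw1]
  | succ n ih =>
    rw [pow_succ, ← elem_mul_elem b k k k, map_mul, Module.End.mul_apply, ih, map_smul, hμ,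
      smul_smul, pow_succ]

/-- Otherwise `ζ ^ m - ζ ^ n` would be invertible in `S` and yet kill `w`. -/
lemma pow_eq_of_eigenvalue {k : ι} {w : W} {μ : K} (hw : w ≠ 0) (hw1 : ρ (elem b k k 1) w = w)
    (hμ : ρ (elem b k k d.ζ) w = μ • w) {m n : ℕ} (h : μ ^ m = μ ^ n) : d.ζ ^ m = d.ζ ^ n := by
  by_contra hne
  have h1 : ρ (elem b k k (d.ζ ^ m - d.ζ ^ n)) w = 0 := by
    rw [elem_sub, map_sub, LinearMap.sub_apply, elem_apply_pow b hw1 hμ, elem_apply_pow b hw1 hμ, h,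
      sub_self]
  have h2 : ρ (elem b k k (d.ζ ^ m - d.ζ ^ n)⁻¹ * elem b k k (d.ζ ^ m - d.ζ ^ n)) w = 0 := by
    rw [map_mul, Module.End.mul_apply, h1, map_zero]
  rw [elem_mul_elem, mul_inv_cancel₀ (sub_ne_zero.2 hne), hw1] at h2
  exact hw h2

lemma exists_smul_of_mem_adjoin {k : ι} {w : W} {μ : K} (hw1 : ρ (elem b k k 1) w = w)
    (hμ : ρ (elem b k k d.ζ) w = μ • w) {z : S} (hz : z ∈ Algebra.adjoin F {d.ζ}) :
    ∃ c : K, ρ (elem b k k z) w = c • w := by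
  induction hz using Algebra.adjoin_induction with
  | mem y hy =>
    obtain rfl : y = d.ζ := hy
    exact ⟨μ, hμ⟩
  | algebraMap r =>
    refine ⟨algebraMap F K r, ?_⟩
    rw [Algebra.algebraMap_eq_smul_one, elem_smul, map_smul, LinearMap.smul_apply, hw1,
      algebraMap_smul]
  | add x y _ _ hx hy =>
    obtain ⟨c, hc⟩ := hx
    obtain ⟨c', hc'⟩ := hy
    exact ⟨c + c', by rw [elem_add, map_add, LinearMap.add_apply, hc, hc', add_smul]⟩
  | mul x y _ _ hx hy =>
    obtain ⟨c, hc⟩ := hx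
    obtain ⟨c', hc'⟩ := hy
    exact ⟨c * c', by rw [← elem_mul_elem b k k k, map_mul, Module.End.mul_apply, hc, map_smul, hc',
      smul_smul]⟩

/-- For fixed `l` the vectors are eigenvectors of the image of `elem b l l ζ` with distinct
eigenvalues; the idempotents `elem b l l 1` separate different `l`. -/
lemma linearIndependent_translates {k : ι} {w : W} {μ : K} (hw : w ≠ 0)
    (hw1 : ρ (elem b k k 1) w = w) (hμ : ρ (elem b k k d.ζ) w = μ • w) :
    LinearIndependent K fun p : ι × Fin d.f ↦ ρ (elem b p.1 k (d.P ^ (p.2 : ℕ))) w := by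
  have hl (l : ι) : LinearIndependent K fun i : Fin d.f ↦ ρ (elem b l k (d.P ^ (i : ℕ))) w := by
    refine Module.End.eigenvectors_linearIndependent' (ρ (elem b l l d.ζ))
      (fun i : Fin d.f ↦ μ ^ d.s ^ (i : ℕ)) ?_ _ fun i ↦
      Module.End.hasEigenvector_iff.2 ⟨Module.End.mem_eigenspace_iff.2 ?_, fun h0 ↦ hw ?_⟩
    · intro i j h
      exact Fin.ext (d.zeta_pow_s_injective i.2 j.2 (pow_eq_of_eigenvalue b hw hw1 hμ h))
    · have h1 := d.pow_P_mul_pow_zeta i 1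
      rw [pow_one, mul_one] at h1
      rw [← Module.End.mul_apply, ← map_mul, elem_mul_elem, h1, ← elem_mul_elem b l k k, map_mul,
        Module.End.mul_apply, elem_apply_pow b hw1 hμ, map_smul]
    · have h2 : ρ (elem b k l (d.P ^ (i : ℕ))⁻¹ * elem b l k (d.P ^ (i : ℕ))) w = 0 := by
        rw [map_mul, Module.End.mul_apply, h0, map_zero]
      rwa [elem_mul_elem, mul_inv_cancel₀ (pow_ne_zero _ d.P_ne), hw1] at h2
  rw [Fintype.linearIndependent_iff]
  rintro c hc ⟨l, i⟩
  have h1 := congrArg (ρ (elem b l l 1)) hc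
  rw [map_sum, map_zero, Fintype.sum_prod_type, Finset.sum_eq_single l] at h1
  · refine Fintype.linearIndependent_iff.1 (hl l) (fun i ↦ c (l, i)) ?_ i
    rw [← h1]
    refine Finset.sum_congr rfl fun j _ ↦ ?_
    rw [map_smul, ← Module.End.mul_apply, ← map_mul, elem_mul_elem, mul_one]
  · intro l' _ hl'
    refine Finset.sum_eq_zero fun j _ ↦ ?_
    rw [map_smul, ← Module.End.mul_apply, ← map_mul, elem_mul_elem_of_ne b _ _ _ _ hl'.symm,
      map_zero, LinearMap.zero_apply, smul_zero]
  · simp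

variable (d) in
lemma conj_mem_adjoin {z : S} (hz : z ∈ Algebra.adjoin F {d.ζ}) (i : ℕ) :
    d.P ^ i * z * (d.P ^ i)⁻¹ ∈ Algebra.adjoin F {d.ζ} := by
  have := (d.coe_conjEquiv_pow i ⟨z, hz⟩)
  rw [← this]
  exact ((d.conjEquiv ^ i) ⟨z, hz⟩).2

/-- The trace of an element of reduced trace one in a representation. -/
lemma trace_elem_eq_one (hW : Module.finrank K W = Fintype.card ι * d.f) (k : ι) {z : S}
    (hzE : z ∈ Algebra.adjoin F {d.ζ})
    (hz : ∑ i ∈ Finset.range d.f, d.P ^ i * z * d.P⁻¹ ^ i = 1) :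
    LinearMap.trace K W (ρ (elem b k k z)) = 1 := by
  have : Nonempty ι := ⟨k⟩
  obtain ⟨w, μ, hw, hw1, hμ⟩ := exists_eigenvector d b ρ k
    (by rw [hW]; exact Nat.mul_pos Fintype.card_pos d.f_pos)
  have : Nonempty (ι × Fin d.f) := ⟨k, 0, d.f_pos⟩
  let B := basisOfLinearIndependentOfCardEqFinrank (linearIndependent_translates b hw hw1 hμ)
    (by rw [hW, Fintype.card_prod, Fintype.card_fin])
  have hB (p : ι × Fin d.f) : B p = ρ (elem b p.1 k (d.P ^ (p.2 : ℕ))) w := by simp [B]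
  choose c hc using fun i : ℕ ↦ exists_smul_of_mem_adjoin b hw1 hμ (conj_mem_adjoin d hzE i)
  have hsum : ∑ i ∈ Finset.range d.f, c i = 1 := by
    have h1 : ∑ i ∈ Finset.range d.f, ρ (elem b k k (d.P ^ i * z * (d.P ^ i)⁻¹)) w = w := by
      simp_rw [← inv_pow]
      rw [← LinearMap.sum_apply, ← map_sum, ← elem_sum, hz, hw1]
    simp_rw [hc] at h1
    rw [← Finset.sum_smul] at h1
    exact smul_left_injective K hw (by simpa using h1)
  -- In the basis of translates the operator is diagonal: zero off the block `k`, and on it the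
  -- scalars `c i` by which the conjugates of `z` act on `w`. These add up to `1`.
  have hdiag (p : ι × Fin d.f) :
      ρ (elem b k k z) (B p) = (if p.1 = k then c p.2 else 0) • B p := by
    obtain ⟨l, i⟩ := p
    rw [hB, ← Module.End.mul_apply, ← map_mul]
    split_ifs with hl
    · obtain rfl : l = k := hl
      rw [elem_mul_elem, ← inv_mul_cancel_right₀ (pow_ne_zero (i : ℕ) d.P_ne) (d.P ^ (i : ℕ) * z),
        ← elem_mul_elem b l l l, map_mul, Module.End.mul_apply, hc, map_smul]
    · rw [elem_mul_elem_of_ne b _ _ _ _ (Ne.symm hl), map_zero, LinearMap.zero_apply, zero_smul]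
  rw [LinearMap.trace_eq_matrix_trace K B, Matrix.trace]
  simp_rw [Matrix.diag_apply, LinearMap.toMatrix_apply, hdiag, map_smul, Finsupp.smul_apply,
    B.repr_self, Finsupp.single_eq_same, smul_eq_mul, mul_one]
  rw [Fintype.sum_prod_type, Finset.sum_eq_single k]
  · simp only [if_true]
    rw [← hsum, Finset.sum_range]
  · intro l _ hl
    simp [hl]
  · simp

/-- The trace in a representation of minimal dimension is the sum of the reduced traces of the
diagonal entries. -/
theorem trace_eq_sum_trd (hW : Module.finrank K W = Fintype.card ι * d.f) (a : Module.End S V) :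
    LinearMap.trace K W (ρ a) = algebraMap F K (∑ k, d.trd (entry b a k k)) := by
  obtain ⟨z, hzE, hz0, hz⟩ := d.exists_trace_eq_one
  -- Split off `elem b k k 1` on the left and rotate it to the right, where the product vanishes.
  have hoff (k l : ι) (x : S) (h : k ≠ l) : LinearMap.trace K W (ρ (elem b k l x)) = 0 := by
    rw [← mul_one x, ← elem_mul_elem b k k l, map_mul, LinearMap.trace_mul_comm, ← map_mul,
      elem_mul_elem_of_ne b _ _ _ _ h.symm, map_zero, map_zero]
  have hdiag (k : ι) (x : S) :
      LinearMap.trace K W (ρ (elem b k k x)) = algebraMap F K (d.trd x) := by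
    -- The trace on a diagonal block is invariant under conjugation, so by linearity its value at
    -- `z` determines it.
    have h1 := d.eq_of_conj_invariant (X := ⊤)
      (lam := fun x ↦ LinearMap.trace K W (ρ (elem b k k x)))
      (fun _ _ _ _ ↦ trivial) (fun _ _ _ _ ↦ trivial)
      (fun x _ y _ ↦ by rw [elem_add, map_add, map_add])
      (fun g hg x _ ↦ by
        rw [← elem_mul_elem b k k k, map_mul, LinearMap.trace_mul_comm, ← map_mul, elem_mul_elem,
          inv_mul_cancel_left₀ hg]) hz0 hz (x := x) trivial
    rw [h1, ← Algebra.smul_def, elem_smul, map_smul, ← algebraMap_smul K (d.trd x) (ρ _), map_smul,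
      trace_elem_eq_one b hW k hzE hz, smul_eq_mul, mul_one]
  conv_lhs => rw [← sum_elem_entry b a]
  simp_rw [map_sum]
  refine Finset.sum_congr rfl fun l _ ↦ ?_
  rw [Finset.sum_eq_single l (fun k _ hk ↦ hoff k l _ hk) (by simp), hdiag]

end Trace

/-! ### Comparison with the reduced trace defined by matrix embeddings -/

section ReducedTrace

variable {F : Type*} [Field F] [ValuativeRel F] [TopologicalSpace F] [IsNonarchimedeanLocalField F]
  {S : Type*} [DivisionRing S] [Algebra F S] [Module.Finite F S] [Algebra.IsCentral F S]
  (d : CyclicData F S)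
  {V ι : Type*} [AddCommGroup V] [Module S V] [Module F V] [IsScalarTower F S V] [Fintype ι]
  [DecidableEq ι] (b : Module.Basis ι S V)

include b in
lemma finrank_space : Module.finrank F V = Fintype.card ι * (d.f * d.f) := by
  rw [← Module.finrank_mul_finrank F S V, Module.finrank_eq_card_basis b, d.finrank_eq_sq, mul_comm]

include b in
lemma finrank_end : Module.finrank F (Module.End S V) =
    (Fintype.card ι * d.f) * (Fintype.card ι * d.f) := by
  have : Module.Finite S V := Module.Finite.of_basis b
  have : Module.Finite F V := Module.Finite.trans S V
  rw [← (b.constr F (M' := V)).finrank_eq, Module.finrank_pi_fintype, Finset.sum_const,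
    Finset.card_univ, finrank_space d b, smul_eq_mul]
  ring

include b in
lemma finrank_E_space : Module.finrank d.E V = Fintype.card ι * d.f := by
  have : Module.Finite S V := Module.Finite.of_basis b
  have : Module.Finite F V := Module.Finite.trans S V
  have : IsScalarTower F d.E V := ⟨fun t x v ↦ by
    show ((t • x : d.E) : S) • v = t • (x : S) • v
    rw [Subalgebra.coe_smul, smul_assoc]⟩
  have h := Module.finrank_mul_finrank F d.E V
  rw [finrank_space d b, d.finrank_E] at h
  refine Nat.eq_of_mul_eq_mul_left d.f_pos ?_
  rw [h]
  ring

/-- Restriction of scalars to the unramified subfield. -/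
def restrictToE [IsScalarTower F d.E V] : Module.End S V →ₐ[F] Module.End d.E V where
  toFun a := a.restrictScalars d.E
  map_one' := rfl
  map_mul' _ _ := rfl
  map_zero' := rfl
  map_add' _ _ := rfl
  commutes' _ := rfl

include b in
-- Over the maximal subfield `E` the space `V` has dimension `Fintype.card ι * d.f`, and `E` embeds
-- into the algebraic closure. Without an embedding, every `t` would satisfy `IsReducedTrace a t`
-- vacuously.
lemma nonempty_algHom_matrix {n : ℕ} (hn : n = Fintype.card ι * d.f) :
    Nonempty (Module.End S V →ₐ[F] Matrix (Fin n) (Fin n) (AlgebraicClosure F)) := by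
  have : Module.Finite S V := Module.Finite.of_basis b
  have : Module.Finite F V := Module.Finite.trans S V
  have : IsScalarTower F d.E V := ⟨fun t x v ↦ by
    show ((t • x : d.E) : S) • v = t • (x : S) • v
    rw [Subalgebra.coe_smul, smul_assoc]⟩
  have : Module.Finite d.E V := Module.Finite.of_restrictScalars_finite F d.E V
  let B := Module.finBasisOfFinrankEq d.E V ((finrank_E_space d b).trans hn.symm)
  let j : d.E →ₐ[F] AlgebraicClosure F := IsAlgClosed.lift
  exact ⟨j.mapMatrix.comp
    (((LinearMap.toMatrixAlgEquiv B).toAlgHom.restrictScalars F).comp (restrictToE d))⟩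

theorem reducedTrace_eq (a : Module.End S V) :
    reducedTrace F a = ∑ k, d.trd (entry b a k k) := by
  have hn : (Module.finrank F (Module.End S V)).sqrt = Fintype.card ι * d.f := by
    rw [finrank_end d b, Nat.sqrt_eq]
  have hred : IsReducedTrace a (∑ k, d.trd (entry b a k k)) := by
    intro φ
    have h := trace_eq_sum_trd (d := d) b (ρ := ((Matrix.toLinAlgEquiv'
      (R := AlgebraicClosure F)).toAlgHom.restrictScalars F).comp φ)
      (by rw [Module.finrank_fin_fun, hn]) a
    rw [← h]
    exact (Matrix.trace_toLin'_eq (φ a)).symm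
  have hex : ∃ t : F, IsReducedTrace a t := ⟨_, hred⟩
  rw [reducedTrace, dif_pos hex]
  obtain ⟨φ⟩ := nonempty_algHom_matrix (F := F) d b hn
  exact (algebraMap F (AlgebraicClosure F)).injective
    ((hex.choose_spec φ).symm.trans (hred φ))

end ReducedTrace

/-! ### Lattice chains and adapted bases -/

section Chains

variable {F : Type*} [Field F] [ValuativeRel F] [TopologicalSpace F] [IsNonarchimedeanLocalField F]
  {S : Type*} [DivisionRing S] [Algebra F S] [Module.Finite F S]
  {V : Type*} [AddCommGroup V] [Module S V] [Module F V] [IsScalarTower F S V] [Module.Finite F V]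

/-- A basis adapted to a lattice chain. -/
structure IsSplit {ι : Type*} (w : ZVal S) (L : ℤ → AddSubgroup V) (r : ℕ)
    (b : Module.Basis ι S V) (a : ι → ℤ) : Prop where
  r_pos : 0 < r
  mem_iff : ∀ i v, v ∈ L i ↔ ∀ k, b.repr v k = 0 ∨ i ≤ a k + r * w.v (b.repr v k)
  surj : ∀ i, ∃ k x, x ≠ 0 ∧ a k + r * w.v x = i

variable (F) in
/-- A lattice chain in a left vector space over the division algebra `S`. -/
structure IsChain (L : ℤ → AddSubgroup V) (r : ℕ) : Prop where
  r_pos : 0 < r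
  smul_mem : ∀ x ∈ (divVal F S).ball 0, ∀ i, ∀ v ∈ L i, x • v ∈ L i
  isCompact : @IsCompact V (moduleTopology F V) (L 0 : Set V)
  isOpen : @IsOpen V (moduleTopology F V) (L 0 : Set V)
  anti : ∀ i j, i ≤ j → L j ≤ L i
  strict : ∀ i, ∃ v ∈ L i, v ∉ L (i + 1)
  periodic : ∀ i, L (i + r) =
    AddSubgroup.closure {u | ∃ v ∈ L i, ∃ x ∈ (divVal F S).ball 1, u = x • v}

namespace IsChain

variable {L : ℤ → AddSubgroup V} {r : ℕ} (h : IsChain F (S := S) L r)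

include h

lemma zpow_smul_mem {p : S} (hp : p ≠ 0) (hv : (divVal F S).v p = 1) (n : ℤ) (i : ℤ) (v : V)
    (hvi : v ∈ L i) : p ^ n • v ∈ L (i + r * n) := by
  have hpos (i : ℤ) (v : V) (hvi : v ∈ L i) : p • v ∈ L (i + r) := by
    rw [h.periodic]
    exact AddSubgroup.subset_closure ⟨v, hvi, p, Or.inr hv.ge, rfl⟩
  have hneg (i : ℤ) (v : V) (hvi : v ∈ L (i + r)) : p⁻¹ • v ∈ L i := by
    rw [h.periodic] at hvi
    induction hvi using AddSubgroup.closure_induction with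
    | mem u hu =>
      obtain ⟨v, hv', x, hx, rfl⟩ := hu
      rw [smul_smul]
      refine h.smul_mem _ ?_ _ _ hv'
      rw [← ZVal.mul_mem_ball_iff _ hp, hv, mul_inv_cancel_left₀ hp, add_zero]
      exact hx
    | zero => simp
    | add x y _ _ hx hy => rw [smul_add]; exact add_mem hx hy
    | neg x _ hx => rw [smul_neg]; exact neg_mem hx
  induction n generalizing i v with
  | zero => simpa using hvi
  | succ n ih =>
    have := ih _ _ (hpos i v hvi)
    rw [smul_smul] at this
    rw [zpow_add_one₀ hp]
    convert this using 2
    ring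
  | pred n ih =>
    have := ih (i - r) _ (hneg (i - r) v (by rwa [sub_add_cancel]))
    rw [smul_smul] at this
    rw [zpow_sub_one₀ hp]
    convert this using 2
    ring

lemma smul_mem_of_mem {x : S} (hx : x ≠ 0) {i : ℤ} {v : V} (hv : v ∈ L i) :
    x • v ∈ L (i + r * (divVal F S).v x) := by
  obtain ⟨p, hp, hp1⟩ := (divVal F S).surj
  set n := (divVal F S).v x
  have h1 : x * (p ^ n)⁻¹ ∈ (divVal F S).ball 0 := by
    right
    rw [ZVal.v_mul _ _ _ hx (inv_ne_zero (zpow_ne_zero _ hp)),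
      ZVal.v_inv _ (zpow_ne_zero _ hp), ZVal.v_zpow _ hp, hp1]
    simp [n]
  have h2 := h.smul_mem _ h1 _ _ (h.zpow_smul_mem hp hp1 n i v hv)
  rwa [smul_smul, inv_mul_cancel_right₀ (zpow_ne_zero _ hp)] at h2

lemma smul_mem_iff {x : S} (hx : x ≠ 0) {i : ℤ} {v : V} :
    x • v ∈ L (i + r * (divVal F S).v x) ↔ v ∈ L i := by
  refine ⟨fun hv ↦ ?_, h.smul_mem_of_mem hx⟩
  have := h.smul_mem_of_mem (inv_ne_zero hx) hv
  rw [inv_smul_smul₀ hx, ZVal.v_inv _ hx] at this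
  convert this using 2
  ring

lemma smul_field_mem_iff {t : F} (ht : t ≠ 0) {i : ℤ} {v : V} :
    t • v ∈ L (i + r * (divRam F S * addVal F t)) ↔ v ∈ L i := by
  rw [← divVal_algebraMap ht, ← algebraMap_smul S t v]
  exact h.smul_mem_iff (by simpa using ht)

lemma exists_mem (v : V) : ∃ i, v ∈ L i := by
  let _ : TopologicalSpace V := moduleTopology F V
  have : IsModuleTopology F V := ⟨rfl⟩
  obtain ⟨C, hC⟩ := exists_box_subset_of_isOpen (F := F) h.isOpen
  obtain ⟨B, hB⟩ := exists_mem_box (F := F) v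
  obtain ⟨t, ht, htv⟩ := (fieldVal F).exists_eq (C - B)
  rw [fieldVal_v] at htv
  have h1 := (smul_mem_box ht).2 hB
  rw [htv, sub_add_cancel] at h1
  refine ⟨0 - r * (divRam F S * addVal F t), (h.smul_field_mem_iff ht).1 ?_⟩
  rw [sub_add_cancel]
  exact hC h1

/-- The lattices are bounded, so they shrink to zero and cannot approach `x` along the closed
subspace `T`. -/
lemma exists_notMem {T : Submodule F V} {x : V} (hx : x ∉ T) : ∃ B, ∀ y ∈ T, x - y ∉ L B := by
  let _ : TopologicalSpace V := moduleTopology F V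
  have : IsModuleTopology F V := ⟨rfl⟩
  obtain ⟨C, hC⟩ := exists_subset_box_of_isCompact (F := F) h.isCompact
  obtain ⟨B, hB⟩ := exists_forall_sub_notMem_box hx
  obtain ⟨t, ht, htv⟩ := (fieldVal F).exists_eq (C - B)
  rw [fieldVal_v] at htv
  refine ⟨0 - r * (divRam F S * addVal F t), fun y hy hxy ↦ hB y hy ?_⟩
  rw [← h.smul_field_mem_iff ht, sub_add_cancel] at hxy
  have := hC hxy
  rw [SetLike.mem_coe, show C = addVal F t + B by lia] at this
  exact (smul_mem_box ht).1 this

/-- An element of a subspace at maximal distance. -/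
lemma exists_maximal {T : Submodule F V} {x : V} (hx : x ∉ T) :
    ∃ i, ∃ y ∈ T, x - y ∈ L i ∧ ∀ z ∈ T, x - z ∉ L (i + 1) := by
  obtain ⟨B, hB⟩ := h.exists_notMem hx
  obtain ⟨i, hi⟩ := h.exists_mem x
  obtain ⟨j, ⟨y, hy, hyj⟩, hmax⟩ := Int.exists_greatest_of_bdd
    (P := fun j ↦ ∃ y ∈ T, x - y ∈ L j)
    ⟨B, fun j ⟨y, hy, hyj⟩ ↦ by
      by_contra! hlt
      exact hB y hy (h.anti _ _ hlt.le hyj)⟩ ⟨i, 0, zero_mem _, by simpa using hi⟩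
  exact ⟨j, y, hy, hyj, fun z hz hzj ↦ by have := hmax _ ⟨z, hz, hzj⟩; lia⟩

/-- Non-archimedean Gram–Schmidt: a vector outside the span is corrected by an element of the span
so that the difference lies as deep in the chain as possible. -/
lemma exists_orthogonal_family (n : ℕ) (hn : n ≤ Module.finrank S V) :
    ∃ (b : Fin n → V) (a : Fin n → ℤ), (∀ k, b k ∈ L (a k) ∧ b k ∉ L (a k + 1)) ∧
      ∀ (x : Fin n → S) (i : ℤ), ∑ k, x k • b k ∈ L i → ∀ k, x k • b k ∈ L i := by
  induction n with
  | zero => exact ⟨Fin.elim0, Fin.elim0, fun k ↦ k.elim0, fun _ _ _ k ↦ k.elim0⟩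
  | succ n ih =>
    obtain ⟨b, a, hba, horth⟩ := ih (by lia)
    let T := Submodule.span S (Set.range b)
    obtain ⟨v, hv⟩ : ∃ v, v ∉ T := by
      by_contra! hall
      have h1 : T = ⊤ := Submodule.eq_top_iff'.2 hall
      have h2 : Module.finrank S T ≤ Fintype.card (Fin n) := finrank_range_le_card b
      rw [h1, finrank_top, Fintype.card_fin] at h2
      lia
    obtain ⟨j, y, hy, hyj, hmax⟩ := h.exists_maximal (T := T.restrictScalars F) hv
    have hmax' : ∀ z ∈ T, v - y + z ∉ L (j + 1) := fun z hz ↦ by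
      have := hmax (y - z) (sub_mem hy hz)
      rwa [sub_sub_eq_add_sub, add_sub_right_comm] at this
    refine ⟨Fin.cons (v - y) b, Fin.cons j a, ?_, ?_⟩
    · intro k
      refine Fin.cases ?_ (fun k ↦ ?_) k
      · exact ⟨hyj, by simpa using hmax' 0 (zero_mem _)⟩
      · exact hba k
    · intro x i hx
      rw [Fin.sum_univ_succ] at hx
      simp only [Fin.cons_zero, Fin.cons_succ] at hx
      have hz : ∑ k : Fin n, x k.succ • b k ∈ T :=
        sum_mem fun k _ ↦ Submodule.smul_mem _ _ (Submodule.subset_span ⟨k, rfl⟩)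
      have h0 : x 0 • (v - y) ∈ L i := by
        rcases eq_or_ne (x 0) 0 with hx0 | hx0
        · rw [hx0, zero_smul]
          exact zero_mem _
        by_contra hcon
        have h1 := h.smul_mem_of_mem hx0 hyj
        have hlt : j + r * (divVal F S).v (x 0) < i := by
          by_contra! hle
          exact hcon (h.anti _ _ hle h1)
        -- Dividing the sum by `x 0` would give a translate of `v - y` by the span that lies in `L
        -- (j + 1)`, against maximality.
        refine hmax' _ (T.smul_mem (x 0)⁻¹ hz) ?_
        rw [← h.smul_mem_iff hx0, smul_add, smul_inv_smul₀ hx0]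
        exact h.anti _ _ (by lia) hx
      have h2 := horth (fun k ↦ x k.succ) i ((add_mem_cancel_left h0).1 hx)
      intro k
      exact Fin.cases h0 h2 k

/-- Lattice chains have adapted bases. -/
theorem exists_isSplit : ∃ (m : ℕ) (b : Module.Basis (Fin m) S V) (a : Fin m → ℤ),
    IsSplit (divVal F S) L r b a := by
  have : Module.Finite S V := Module.Finite.of_restrictScalars_finite F S V
  obtain ⟨b, a, hba, horth⟩ := h.exists_orthogonal_family _ le_rfl
  have hmem (k) (x : S) (i : ℤ) :
      x • b k ∈ L i ↔ x = 0 ∨ i ≤ a k + r * (divVal F S).v x := by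
    rcases eq_or_ne x 0 with rfl | hx
    · simp
    · simp only [hx, false_or]
      refine ⟨fun hxi ↦ ?_, fun hle ↦ h.anti _ _ hle (h.smul_mem_of_mem hx (hba k).1)⟩
      by_contra! hlt
      refine (hba k).2 ((h.smul_mem_iff hx).1 (h.anti _ _ ?_ hxi))
      lia
  have hli : LinearIndependent S b := by
    rw [Fintype.linearIndependent_iff]
    intro x hx k
    by_contra hk
    have h1 := horth x (a k + r * (divVal F S).v (x k) + 1) (by rw [hx]; exact zero_mem _) k
    rw [hmem] at h1
    have := h1.resolve_left hk
    lia
  -- The zero space carries no strict chain.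
  rcases Nat.eq_zero_or_pos (Module.finrank S V) with h0 | hpos
  · obtain ⟨v, _, hv⟩ := h.strict 0
    have := Module.finrank_zero_iff.1 h0
    exact (hv (Subsingleton.elim 0 v ▸ zero_mem _)).elim
  have : Nonempty (Fin (Module.finrank S V)) := ⟨⟨0, hpos⟩⟩
  let B := basisOfLinearIndependentOfCardEqFinrank hli (by simp)
  have hB (k) : B k = b k := by simp [B]
  have hiff (i : ℤ) (v : V) : v ∈ L i ↔
      ∀ k, B.repr v k = 0 ∨ i ≤ a k + r * (divVal F S).v (B.repr v k) := by
    simp_rw [← hmem]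
    conv_lhs => rw [← B.sum_repr v]
    simp_rw [hB]
    exact ⟨horth _ i, fun hk ↦ sum_mem fun k _ ↦ hk k⟩
  refine ⟨_, B, a, h.r_pos, hiff, fun i ↦ ?_⟩
  obtain ⟨v, hv, hv1⟩ := h.strict i
  rw [hiff] at hv hv1
  push Not at hv1
  obtain ⟨k, hk, hlt⟩ := hv1
  exact ⟨k, _, hk, by have := (hv k).resolve_left hk; lia⟩

end IsChain

end Chains

/-! ### Powers of the radical as endomorphisms that shift the chain -/

section Filtration

variable {S : Type*} [DivisionRing S] {V : Type*} [AddCommGroup V] [Module S V]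

/-- The endomorphisms that shift a sequence of lattices by `j`. -/
def fil (S : Type*) [DivisionRing S] {V : Type*} [AddCommGroup V] [Module S V]
    (L : ℤ → AddSubgroup V) (j : ℤ) : AddSubgroup (Module.End S V) where
  carrier := {f | ∀ i, ∀ v ∈ L i, f v ∈ L (i + j)}
  zero_mem' _ _ _ := zero_mem _
  add_mem' hf hg i v hv := add_mem (hf i v hv) (hg i v hv)
  neg_mem' hf i v hv := neg_mem (hf i v hv)

lemma mem_fil {L : ℤ → AddSubgroup V} {j : ℤ} {f : Module.End S V} :
    f ∈ fil S L j ↔ ∀ i, ∀ v ∈ L i, f v ∈ L (i + j) := Iff.rfl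

lemma mul_mem_fil {L : ℤ → AddSubgroup V} {i j : ℤ} {f g : Module.End S V} (hf : f ∈ fil S L i)
    (hg : g ∈ fil S L j) : f * g ∈ fil S L (i + j) := fun k v hv ↦ by
  have := hf _ _ (hg k v hv)
  rwa [add_assoc, add_comm j i] at this

namespace IsSplit

variable {w : ZVal S} {L : ℤ → AddSubgroup V} {r : ℕ} {ι : Type*} {b : Module.Basis ι S V}
  {a : ι → ℤ} (h : IsSplit w L r b a)

include h

lemma anti {i j : ℤ} (hij : i ≤ j) : L j ≤ L i := by
  intro v hv
  rw [h.mem_iff] at hv ⊢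
  exact fun k ↦ (hv k).imp_right fun hk ↦ hij.trans hk

lemma fil_anti {i j : ℤ} (hij : i ≤ j) : fil S L j ≤ fil S L i := fun _ hf k v hv ↦
  h.anti (by lia) (hf k v hv)

lemma smul_basis_mem {k : ι} {x : S} {i : ℤ} :
    x • b k ∈ L i ↔ x = 0 ∨ i ≤ a k + r * w.v x := by
  classical
  rw [h.mem_iff]
  constructor
  · intro hk
    simpa using hk k
  · intro hx l
    rcases eq_or_ne l k with rfl | hl
    · simpa using hx
    · simp [hl.symm]

lemma basis_mem (k : ι) : b k ∈ L (a k) := by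
  rw [← one_smul S (b k), h.smul_basis_mem, w.v_one]
  simp

lemma smul_mem {x : S} (hx : x ≠ 0) {i : ℤ} {v : V} (hv : v ∈ L i) :
    x • v ∈ L (i + r * w.v x) := by
  rw [h.mem_iff] at hv ⊢
  intro k
  rcases eq_or_ne (b.repr v k) 0 with h0 | h0
  · simp [h0]
  · right
    rw [map_smul, Finsupp.smul_apply, smul_eq_mul, w.v_mul _ _ hx h0]
    have := (hv k).resolve_left h0
    linarith

variable [Fintype ι] [DecidableEq ι]

lemma mem_fil_iff {j : ℤ} {f : Module.End S V} : f ∈ fil S L j ↔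
    ∀ k l, entry b f k l = 0 ∨ a l + j ≤ a k + r * w.v (entry b f k l) := by
  constructor
  · intro hf k l
    exact (h.mem_iff _ _).1 (hf _ _ (h.basis_mem l)) k
  · intro hf i v hv
    rw [← b.sum_repr v, map_sum]
    refine sum_mem fun l _ ↦ ?_
    rw [map_smul]
    have h1 : f (b l) ∈ L (a l + j) := (h.mem_iff _ _).2 fun k ↦ hf k l
    rcases eq_or_ne (b.repr v l) 0 with h0 | h0
    · rw [h0, zero_smul]
      exact zero_mem _
    · have h2 := ((h.mem_iff _ _).1 hv l).resolve_left h0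
      exact h.anti (by lia) (h.smul_mem h0 h1)

lemma elem_mem_fil {j : ℤ} {k l : ι} {x : S} :
    elem b k l x ∈ fil S L j ↔ x = 0 ∨ a l + j ≤ a k + r * w.v x := by
  rw [h.mem_fil_iff]
  constructor
  · intro hf
    simpa [entry, elem_apply] using hf k l
  · intro hx p q
    rcases eq_or_ne q l with rfl | hq
    · rcases eq_or_ne p k with rfl | hp
      · simpa [entry, elem_apply] using hx
      · simp [entry, elem_apply, hp.symm]
    · simp [entry, elem_apply, hq]

lemma elem_entry_mem_fil {j : ℤ} {f : Module.End S V} (hf : f ∈ fil S L j) (k l : ι) :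
    elem b k l (entry b f k l) ∈ fil S L j := h.elem_mem_fil.2 (h.mem_fil_iff.1 hf k l)

lemma exists_order {v : V} (hv : v ≠ 0) : ∃ i, v ∈ L i ∧ v ∉ L (i + 1) := by
  obtain ⟨k, hk⟩ : ∃ k, b.repr v k ≠ 0 := by
    by_contra! h0
    exact hv (b.repr.map_eq_zero_iff.1 (Finsupp.ext h0))
  obtain ⟨B, hB⟩ := (Set.finite_range fun k ↦ a k + r * w.v (b.repr v k)).bddBelow
  obtain ⟨i, hi, hmax⟩ := Int.exists_greatest_of_bdd (P := fun i ↦ v ∈ L i)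
    ⟨_, fun i hi ↦ ((h.mem_iff _ _).1 hi k).resolve_left hk⟩
    ⟨B, (h.mem_iff _ _).2 fun k ↦ Or.inr (hB ⟨k, rfl⟩)⟩
  exact ⟨i, hi, fun hi1 ↦ by have := hmax _ hi1; lia⟩

/-- Elements of `1 + 𝔓` are invertible in the order. -/
lemma exists_inv_one_add {g : Module.End S V} (hg : g ∈ fil S L 1) :
    ∃ z ∈ fil S L 0, z * (1 + g) = 1 ∧ (1 + g) * z = 1 := by
  have : Module.Finite S V := Module.Finite.of_basis b
  have hinj : Function.Injective ⇑(1 + g : Module.End S V) := by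
    rw [← LinearMap.ker_eq_bot, LinearMap.ker_eq_bot']
    intro v hv
    by_contra hv0
    -- A vector in the kernel satisfies `v = -g v`, so it would lie one step deeper than its own
    -- level.
    obtain ⟨i, hi, hi1⟩ := h.exists_order hv0
    rw [LinearMap.add_apply, Module.End.one_apply, add_eq_zero_iff_eq_neg] at hv
    exact hi1 (hv ▸ neg_mem (hg i v hi))
  let e := LinearEquiv.ofBijective (1 + g) ⟨hinj, LinearMap.injective_iff_surjective.1 hinj⟩
  refine ⟨e.symm, fun i v hv ↦ ?_, LinearMap.ext fun v ↦ e.symm_apply_apply v,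
    LinearMap.ext fun v ↦ e.apply_symm_apply v⟩
  rw [add_zero]
  by_contra hu
  have hu0 : e.symm v ≠ 0 := fun h0 ↦ hu (h0 ▸ zero_mem _)
  obtain ⟨m, hm, hm1⟩ := h.exists_order hu0
  have hlt : m < i := by
    by_contra! hle
    exact hu (h.anti hle hm)
  have h1 : e.symm v + g (e.symm v) = v := e.apply_symm_apply v
  refine hm1 ((add_mem_cancel_right (hg m _ hm)).1 ?_)
  rw [h1]
  exact h.anti (by lia) hv

variable {R : Type*} [CommRing R] [Algebra R (Module.End S V)]
  {𝔄 : Subalgebra R (Module.End S V)} (h𝔄 : ∀ f, f ∈ 𝔄 ↔ f ∈ fil S L 0)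

include h𝔄

lemma mem_jacobson_iff (x : 𝔄) : x ∈ Ring.jacobson 𝔄 ↔ (x : Module.End S V) ∈ fil S L 1 := by
  rw [← Ideal.jacobson_bot, Ideal.mem_jacobson_iff]
  simp_rw [Ideal.mem_bot, sub_eq_zero]
  constructor
  · intro hx
    rw [h.mem_fil_iff]
    intro k l
    by_contra! hcon
    set e := entry b (x : Module.End S V) k l
    have h0 := (h.mem_fil_iff.1 ((h𝔄 _).1 x.2) k l).resolve_left hcon.1
    -- An entry `e` that is too shallow has its inverse elementary matrix in the order. With `y`
    -- this matrix, `1 - y * x` kills `b l` and cannot be left invertible.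
    have hy : elem b l k e⁻¹ ∈ 𝔄 := by
      rw [h𝔄, h.elem_mem_fil]
      right
      rw [w.v_inv hcon.1]
      linarith
    obtain ⟨z, hz⟩ := hx (-⟨_, hy⟩)
    have h1 := LinearMap.congr_fun (congrArg Subtype.val hz) (b l)
    have h2 : elem b l k e⁻¹ ((x : Module.End S V) (b l)) = b l := by
      rw [elem_apply]
      exact smul_inv_smul₀ hcon.1 _
    simp only [Subalgebra.coe_add, Subalgebra.coe_mul, Subalgebra.coe_neg, Subalgebra.coe_one,
      LinearMap.add_apply, Module.End.mul_apply, LinearMap.neg_apply, h2, map_neg,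
      neg_add_cancel, Module.End.one_apply] at h1
    exact b.ne_zero l h1.symm
  · intro hx y
    obtain ⟨z, hz, hz1, -⟩ := h.exists_inv_one_add (g := (y : Module.End S V) * x) (by
      have := mul_mem_fil ((h𝔄 _).1 y.2) hx
      rwa [zero_add] at this)
    refine ⟨⟨z, (h𝔄 z).2 hz⟩, Subtype.ext ?_⟩
    simp only [Subalgebra.coe_add, Subalgebra.coe_mul, Subalgebra.coe_one]
    rw [mul_assoc, ← mul_add_one, add_comm, hz1]

lemma mem_jacobson_pow_iff (n : ℕ) (x : 𝔄) :
    x ∈ Ring.jacobson 𝔄 ^ n ↔ (x : Module.End S V) ∈ fil S L n := by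
  induction n generalizing x with
  | zero =>
    rw [Submodule.pow_zero, Ideal.one_eq_top]
    simpa using (h𝔄 _).1 x.2
  | succ n ih =>
    rw [Submodule.pow_succ]
    constructor
    · intro hx
      refine Submodule.smul_induction_on (I := Ring.jacobson 𝔄 ^ n)
        (N := Ring.jacobson 𝔄) (p := fun y ↦ (y : Module.End S V) ∈ fil S L (n + 1 : ℕ)) hx
        (fun y hy z hz ↦ ?_) fun y z hy hz ↦ add_mem hy hz
      push_cast
      exact mul_mem_fil ((ih y).1 hy) ((h.mem_jacobson_iff h𝔄 z).1 hz)
    · intro hx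
      have key (k l : ι) (u : S) (hu : elem b k l u ∈ fil S L (n + 1 : ℕ)) :
          ∃ y : 𝔄, (y : Module.End S V) = elem b k l u ∧
            y ∈ Ring.jacobson 𝔄 ^ n * Ring.jacobson 𝔄 := by
        rcases eq_or_ne u 0 with rfl | hu0
        · exact ⟨0, by simp [elem_zero], zero_mem _⟩
        rw [h.elem_mem_fil] at hu
        replace hu := hu.resolve_left hu0
        push_cast at hu
        -- Every integer occurs as a level, so a factor `elem b p l z` of order exactly `1` can be
        -- split off on the right; the other factor then keeps order at least `n`.
        obtain ⟨p, z, hz, hpz⟩ := h.surj (a l + 1)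
        have h1 : elem b p l z ∈ fil S L 1 := h.elem_mem_fil.2 (Or.inr hpz.ge)
        have h2 : elem b k p (z⁻¹ * u) ∈ fil S L n := by
          refine h.elem_mem_fil.2 (Or.inr ?_)
          rw [w.v_mul _ _ (inv_ne_zero hz) hu0, w.v_inv hz]
          linarith
        have m1 : elem b p l z ∈ 𝔄 := (h𝔄 _).2 (h.fil_anti (by lia) h1)
        have m2 : elem b k p (z⁻¹ * u) ∈ 𝔄 := (h𝔄 _).2 (h.fil_anti (by lia) h2)
        refine ⟨⟨_, m2⟩ * ⟨_, m1⟩, ?_, Ideal.mul_mem_mul ((ih _).2 h2)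
          ((h.mem_jacobson_iff h𝔄 _).2 h1)⟩
        rw [Subalgebra.coe_mul, elem_mul_elem, mul_inv_cancel_left₀ hz]
      choose y hy hy' using fun k l ↦ key k l _ (h.elem_entry_mem_fil hx k l)
      have hxs : x = ∑ l, ∑ k, y k l := by
        apply Subtype.ext
        push_cast
        simp_rw [hy, sum_elem_entry]
      rw [hxs]
      exact sum_mem fun l _ ↦ sum_mem fun k _ ↦ hy' k l

end IsSplit

end Filtration

/-! ### Scalars in the filtration and the ramification index -/

section FieldFiltration

variable {F : Type*} [Field F] [ValuativeRel F] [TopologicalSpace F] [IsNonarchimedeanLocalField F]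
  {S : Type*} [DivisionRing S] [Algebra F S] [Module.Finite F S]
  {V : Type*} [AddCommGroup V] [Module S V] [Module F V] [IsScalarTower F S V]
  {L : ℤ → AddSubgroup V} {r : ℕ} {ι : Type*} [Fintype ι] [DecidableEq ι]
  {b : Module.Basis ι S V} {a : ι → ℤ} (h : IsSplit (divVal F S) L r b a)
  {𝔄 : Subalgebra 𝒪[F] (Module.End S V)} (h𝔄 : ∀ f, f ∈ 𝔄 ↔ f ∈ fil S L 0)

include h

lemma smul_mem_fil {t : F} (ht : t ≠ 0) {j : ℤ} {f : Module.End S V} :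
    t • f ∈ fil S L (j + r * (divRam F S * addVal F t)) ↔ f ∈ fil S L j := by
  rw [h.mem_fil_iff, h.mem_fil_iff]
  refine forall_congr' fun k ↦ forall_congr' fun l ↦ ?_
  rw [entry_smul, smul_eq_zero_iff_right ht]
  refine or_congr_right' fun h0 ↦ ?_
  rw [Algebra.smul_def, ZVal.v_mul _ _ _ (by simpa using ht) h0, divVal_algebraMap ht, mul_add]
  constructor <;> intro _ <;> linarith

include h𝔄

lemma mem_radicalPow {n : ℕ} {f : Module.End S V} : f ∈ radicalPow 𝔄 n ↔ f ∈ fil S L n := by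
  constructor
  · rintro ⟨x, hx, rfl⟩
    exact (h.mem_jacobson_pow_iff h𝔄 n x).1 hx
  · intro hf
    exact ⟨⟨f, (h𝔄 f).2 (h.fil_anti (by lia) hf)⟩, (h.mem_jacobson_pow_iff h𝔄 n _).2 hf, rfl⟩

lemma ramificationIndex_eq : ramificationIndex 𝔄 = r * divRam F S := by
  have hset (ϖ : F) (hϖ : addVal F ϖ = 1) :
      (fun f : Module.End S V ↦ ϖ • f) '' 𝔄 = fil S L (r * divRam F S : ℕ) := by
    have hϖ0 : ϖ ≠ 0 := by
      rintro rfl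
      simp [addVal] at hϖ
    have h1 {j : ℤ} {f : Module.End S V} :
        ϖ • f ∈ fil S L (j + (r * divRam F S : ℕ)) ↔ f ∈ fil S L j := by
      have := smul_mem_fil h hϖ0 (j := j) (f := f)
      rw [hϖ, mul_one] at this
      exact_mod_cast this
    ext f
    constructor
    · rintro ⟨g, hg, rfl⟩
      rw [← zero_add ((r * divRam F S : ℕ) : ℤ)]
      exact h1.2 ((h𝔄 g).1 hg)
    · intro hf
      refine ⟨ϖ⁻¹ • f, (h𝔄 _).2 (h1.1 ?_), smul_inv_smul₀ hϖ0 f⟩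
      rw [smul_inv_smul₀ hϖ0, zero_add]
      exact hf
  have hsets : {e | ∃ ϖ : F, addVal F ϖ = 1 ∧
      radicalPow 𝔄 e = (fun f : Module.End S V ↦ ϖ • f) '' 𝔄} = {r * divRam F S} := by
    ext e
    constructor
    · rintro ⟨ϖ, hϖ, he⟩
      rw [hset ϖ hϖ] at he
      obtain ⟨l, -⟩ := h.surj 0
      -- The filtration is strictly decreasing, so only one exponent `e` is possible and the infimum
      -- is over a singleton.
      have hex (n : ℕ) : ∃ f ∈ fil S L n, f ∉ fil S L (n + 1) := by
        obtain ⟨k, x, hx, hkx⟩ := h.surj (a l + n)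
        refine ⟨elem b k l x, h.elem_mem_fil.2 (Or.inr hkx.ge), fun hf ↦ ?_⟩
        have := (h.elem_mem_fil.1 hf).resolve_left hx
        lia
      have hiff (f : Module.End S V) : f ∈ fil S L e ↔ f ∈ fil S L (r * divRam F S : ℕ) := by
        rw [← mem_radicalPow h h𝔄, he]
        rfl
      refine le_antisymm ?_ ?_
      · by_contra! hlt
        obtain ⟨f, hf, hf1⟩ := hex (r * divRam F S)
        exact hf1 (h.fil_anti (by lia) ((hiff f).2 hf))
      · by_contra! hlt
        obtain ⟨f, hf, hf1⟩ := hex e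
        exact hf1 (h.fil_anti (by lia) ((hiff f).1 hf))
    · rintro rfl
      obtain ⟨ϖ, -, hϖ⟩ := (fieldVal F).surj
      refine ⟨ϖ, hϖ, ?_⟩
      rw [hset ϖ hϖ]
      ext f
      exact mem_radicalPow h h𝔄
  exact (congrArg sInf hsets).trans (csInf_singleton _)

end FieldFiltration

/-! ### The function `y ↦ χ (1 + y)` -/

section OneAdd

variable {A H : Type*} [Ring A] [CommGroup H] (χ : Aˣ →* H)

open Classical in
/-- The function `y ↦ χ (1 + y)`, extended by `1` to the `y` such that `1 + y` is not a unit. -/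
def oneAdd (y : A) : H := if h : IsUnit (1 + y) then χ h.unit else 1

lemma oneAdd_eq {y : A} {u : Aˣ} (hu : (u : A) = 1 + y) : oneAdd χ y = χ u := by
  have h : IsUnit (1 + y) := ⟨u, hu⟩
  rw [oneAdd, dif_pos h]
  congr 1
  exact Units.ext hu.symm

lemma oneAdd_mul {x y z : A} (hx : IsUnit (1 + x)) (hy : IsUnit (1 + y))
    (h : (1 + x) * (1 + y) = 1 + z) : oneAdd χ z = oneAdd χ x * oneAdd χ y := by
  obtain ⟨u, hu⟩ := hx
  obtain ⟨v, hv⟩ := hy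
  rw [oneAdd_eq χ hu, oneAdd_eq χ hv, ← map_mul, oneAdd_eq χ (u := u * v)]
  rw [← h, Units.val_mul, hu, hv]

lemma oneAdd_conj (g : Aˣ) {x y : A} (hx : IsUnit (1 + x)) (h : y * g = g * x) :
    oneAdd χ y = oneAdd χ x := by
  obtain ⟨u, hu⟩ := hx
  rw [oneAdd_eq χ hu, oneAdd_eq χ (u := g * u * g⁻¹), map_mul, map_mul, map_inv,
    mul_inv_cancel_comm]
  rw [Units.val_mul, eq_comm, Units.eq_mul_inv_iff_mul_eq, Units.val_mul, hu, add_mul, mul_add, h,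
    one_mul, mul_one]

end OneAdd

/-! ### Characters on elementary matrices -/

section Elementary

variable {S : Type*} [DivisionRing S] {V : Type*} [AddCommGroup V] [Module S V]
  {ι : Type*} [Fintype ι] [DecidableEq ι] (b : Module.Basis ι S V)

/-- The diagonal unit with entry `g` at `k` and all other diagonal entries equal to `1`. -/
def diagUnit (k : ι) {g : S} (hg : g ≠ 0) : (Module.End S V)ˣ where
  val := 1 + elem b k k (g - 1)
  inv := 1 + elem b k k (g⁻¹ - 1)
  val_inv := by
    rw [mul_add, mul_one, add_mul, one_mul, elem_mul_elem, add_assoc, ← elem_add, ← elem_add,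
      show g - 1 + (g⁻¹ - 1 + (g⁻¹ - 1) * (g - 1)) = 0 by
        rw [sub_mul, mul_sub, inv_mul_cancel₀ hg, mul_one, one_mul]; abel, elem_zero, add_zero]
  inv_val := by
    rw [mul_add, mul_one, add_mul, one_mul, elem_mul_elem, add_assoc, ← elem_add, ← elem_add,
      show g⁻¹ - 1 + (g - 1 + (g - 1) * (g⁻¹ - 1)) = 0 by
        rw [sub_mul, mul_sub, mul_inv_cancel₀ hg, mul_one, one_mul]; abel, elem_zero, add_zero]

lemma diagUnit_mul_elem (k l : ι) {g : S} (hg : g ≠ 0) (x : S) :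
    (diagUnit b k hg : Module.End S V) * elem b k l x = elem b k l (x * g) := by
  change (1 + elem b k k (g - 1)) * _ = _
  rw [add_mul, one_mul, elem_mul_elem, ← elem_add, mul_sub, mul_one, add_sub_cancel]

lemma elem_mul_diagUnit (k l : ι) {g : S} (hg : g ≠ 0) (x : S) :
    elem b l k x * (diagUnit b k hg : Module.End S V) = elem b l k (g * x) := by
  change _ * (1 + elem b k k (g - 1)) = _
  rw [mul_add, mul_one, elem_mul_elem, ← elem_add, sub_mul, one_mul, add_sub_cancel]

lemma elem_mul_diagUnit_of_ne {k l : ι} (p : ι) (hkl : k ≠ l) {g : S} (hg : g ≠ 0) (x : S) :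
    elem b p l x * (diagUnit b k hg : Module.End S V) = elem b p l x := by
  change _ * (1 + elem b k k (g - 1)) = _
  rw [mul_add, mul_one, elem_mul_elem_of_ne b _ _ _ _ hkl.symm, add_zero]

/-- The unit that permutes the basis vectors. -/
def permUnit (σ : Equiv.Perm ι) : (Module.End S V)ˣ :=
  LinearMap.GeneralLinearGroup.ofLinearEquiv (b.equiv b σ)

lemma permUnit_basis (σ : Equiv.Perm ι) (i : ι) :
    (permUnit b σ : Module.End S V) (b i) = b (σ i) := b.equiv_apply i b σ

lemma elem_mul_permUnit (σ : Equiv.Perm ι) (k l : ι) (x : S) :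
    elem b (σ k) (σ l) x * (permUnit b σ : Module.End S V) =
      (permUnit b σ : Module.End S V) * elem b k l x := by
  refine b.ext fun i ↦ ?_
  rw [Module.End.mul_apply, Module.End.mul_apply, permUnit_basis, elem_apply, elem_apply,
    map_smul, map_smul, permUnit_basis, b.repr_self, b.repr_self]
  congr 1
  simp [Finsupp.single_apply]

variable {H : Type*} [CommGroup H] (χ : (Module.End S V)ˣ →* H)

lemma oneAdd_offDiag_mul {k l : ι} (hkl : k ≠ l) (x y : S) :
    IsUnit (1 + elem b k l x) ∧
      oneAdd χ (elem b k l (x + y)) = oneAdd χ (elem b k l x) * oneAdd χ (elem b k l y) := by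
  have h1 (x y : S) : (1 + elem b k l x) * (1 + elem b k l y) = 1 + elem b k l (x + y) := by
    rw [mul_add, mul_one, add_mul, one_mul, elem_mul_elem_of_ne b _ _ _ _ hkl.symm, add_zero,
      elem_add, add_assoc]
  have h2 (x : S) : IsUnit (1 + elem b k l x) := by
    refine ⟨⟨_, 1 + elem b k l (-x), ?_, ?_⟩, rfl⟩ <;> simp [h1, elem_zero]
  exact ⟨h2 x, oneAdd_mul χ (h2 x) (h2 y) (h1 x y)⟩

/-- Characters of `GL_m(S)` are trivial on elementary matrices. -/
lemma oneAdd_offDiag (hS : ∃ g : S, g ≠ 0 ∧ g ≠ 1) {k l : ι} (hkl : k ≠ l) (x : S) :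
    oneAdd χ (elem b k l x) = 1 := by
  obtain ⟨g, hg, hg1⟩ := hS
  -- With this `y`, `y * g = y + x`; since `y * g` and `y` give conjugate matrices, additivity
  -- leaves nothing for `x`.
  set y := x * (g - 1)⁻¹
  have hx : x = y * (g - 1) := (inv_mul_cancel_right₀ (sub_ne_zero.2 hg1) x).symm
  have h1 := oneAdd_conj χ (diagUnit b k hg) (x := elem b k l y) (y := elem b k l (y * g))
    (oneAdd_offDiag_mul b χ hkl y 0).1
    (by rw [diagUnit_mul_elem, elem_mul_diagUnit_of_ne b k hkl])
  have h2 := (oneAdd_offDiag_mul b χ hkl y x).2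
  rwa [hx, ← mul_one_add, add_sub_cancel, h1, left_eq_mul, ← hx] at h2

end Elementary

/-! ### Additivity on congruence subgroups and reduction to one diagonal entry -/

namespace IsSplit

variable {S : Type*} [DivisionRing S] {V : Type*} [AddCommGroup V] [Module S V]
  {w : ZVal S} {L : ℤ → AddSubgroup V} {r : ℕ} {ι : Type*} [Fintype ι] [DecidableEq ι]
  {b : Module.Basis ι S V} {a : ι → ℤ} (h : IsSplit w L r b a)

include h

lemma isUnit_one_add {g : Module.End S V} {j : ℤ} (hj : 1 ≤ j) (hg : g ∈ fil S L j) :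
    IsUnit (1 + g) := by
  obtain ⟨z, -, h1, h2⟩ := h.exists_inv_one_add (h.fil_anti hj hg)
  exact ⟨⟨_, z, h2, h1⟩, rfl⟩

lemma elem_diag_mem_fil {j : ℤ} {k : ι} {x : S} :
    elem b k k x ∈ fil S L j ↔ x = 0 ∨ j ≤ r * w.v x := by
  rw [h.elem_mem_fil, add_le_add_iff_left]

variable {H : Type*} [CommGroup H] (χ : (Module.End S V)ˣ →* H) {n j : ℤ} (hj : 1 ≤ j)

include hj

/-- Conjugation invariance of `χ` on a diagonal block. -/
lemma oneAdd_diag_conj {k : ι} {g : S} (hg : g ≠ 0) {x : S} (hx : elem b k k x ∈ fil S L j) :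
    oneAdd χ (elem b k k (g * x * g⁻¹)) = oneAdd χ (elem b k k x) := by
  -- The inverse of `g` is used because composition reverses products in `S`.
  refine oneAdd_conj χ (diagUnit b k (inv_ne_zero hg)) (h.isUnit_one_add hj hx) ?_
  rw [elem_mul_diagUnit, diagUnit_mul_elem, ← mul_assoc, inv_mul_cancel_left₀ hg]

lemma oneAdd_diag_eq (k l : ι) {x : S} (hx : elem b k k x ∈ fil S L j) :
    oneAdd χ (elem b k k x) = oneAdd χ (elem b l l x) := by
  refine (oneAdd_conj χ (permUnit b (Equiv.swap k l)) (h.isUnit_one_add hj hx) ?_).symm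
  rw [← elem_mul_permUnit, Equiv.swap_apply_left]

variable (hjn : n ≤ 2 * j) (htriv : ∀ y ∈ fil S L n, oneAdd χ y = 1)

include hjn htriv

lemma oneAdd_add {x y : Module.End S V} (hx : x ∈ fil S L j) (hy : y ∈ fil S L j) :
    oneAdd χ (x + y) = oneAdd χ x * oneAdd χ y := by
  obtain ⟨z, hz, hz1, hz2⟩ := h.exists_inv_one_add (h.fil_anti hj (add_mem hx hy))
  have ht : z * (x * y) ∈ fil S L (2 * j) := by
    have := mul_mem_fil hz (mul_mem_fil hx hy)
    rwa [zero_add, ← two_mul] at this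
  -- With `z` the inverse of `1 + x + y`, the quotient of `(1 + x)(1 + y)` by `1 + x + y` is `1 + z
  -- x y`, which lies deep enough for `χ` to be trivial.
  have h2 : (1 + (x + y)) * (1 + z * (x * y)) = 1 + (x + y + x * y) := by
    rw [mul_one_add, ← mul_assoc, hz2, one_mul, add_assoc]
  rw [← oneAdd_mul χ (h.isUnit_one_add hj hx) (h.isUnit_one_add hj hy)
      (z := x + y + x * y) (by noncomm_ring),
    oneAdd_mul χ (h.isUnit_one_add hj (add_mem hx hy)) (h.isUnit_one_add (by lia) ht) h2,
    htriv _ (h.fil_anti hjn ht), mul_one]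

lemma oneAdd_eq_sum_diag (hS : ∃ g : S, g ≠ 0 ∧ g ≠ 1) (k : ι) {y : Module.End S V}
    (hy : y ∈ fil S L j) :
    oneAdd χ y = oneAdd χ (elem b k k (∑ l, entry b y l l)) := by
  have hadd (x : Module.End S V) (hx : x ∈ fil S L j) (y : Module.End S V) (hy : y ∈ fil S L j) :
      Additive.ofMul (oneAdd χ (x + y)) =
        Additive.ofMul (oneAdd χ x) + Additive.ofMul (oneAdd χ y) :=
    congrArg Additive.ofMul (h.oneAdd_add χ hj hjn htriv hx hy)
  have hmem (p q : ι) := h.elem_entry_mem_fil hy p q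
  have hdiag (l : ι) : elem b k k (entry b y l l) ∈ fil S L j :=
    h.elem_diag_mem_fil.2 (h.elem_diag_mem_fil.1 (hmem l l))
  apply Additive.ofMul.injective
  conv_lhs => rw [← sum_elem_entry b y]
  rw [map_sum_of_add (lam := fun f ↦ Additive.ofMul (oneAdd χ f)) _ hadd _ _
      fun q _ ↦ sum_mem fun p _ ↦ hmem p q, elem_sum,
    map_sum_of_add (lam := fun f ↦ Additive.ofMul (oneAdd χ f)) _ hadd _ _ fun q _ ↦ hdiag q]
  refine Finset.sum_congr rfl fun q _ ↦ ?_
  rw [map_sum_of_add (lam := fun f ↦ Additive.ofMul (oneAdd χ f)) _ hadd _ _ fun p _ ↦ hmem p q,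
    Finset.sum_eq_single q (fun p _ hp ↦ by rw [oneAdd_offDiag b χ hS hp]; rfl) (by simp),
    h.oneAdd_diag_eq χ hj q k (hmem q q)]

end IsSplit

/-! ### The parameter of the character -/

section Main

lemma exists_ne_zero_ne_one (F S : Type*) [Field F] [ValuativeRel F] [TopologicalSpace F]
    [IsNonarchimedeanLocalField F] [DivisionRing S] [Algebra F S] [Module.Finite F S] :
    ∃ g : S, g ≠ 0 ∧ g ≠ 1 := by
  obtain ⟨g, hg, hg1⟩ := (divVal F S).exists_eq 1
  refine ⟨g, hg, ?_⟩
  rintro rfl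
  simp [ZVal.v_one] at hg1

variable {F : Type*} [Field F] [ValuativeRel F] [TopologicalSpace F] [IsNonarchimedeanLocalField F]
  {S : Type*} [DivisionRing S] [Algebra F S] [Module.Finite F S]
  {V : Type*} [AddCommGroup V] [Module S V] [Module F V] [IsScalarTower F S V]
  {L : ℤ → AddSubgroup V} {r : ℕ} {ι : Type*} [Fintype ι] [DecidableEq ι]
  {b : Module.Basis ι S V} {a : ι → ℤ} (h : IsSplit (divVal F S) L r b a)

include h

/-- The `x` such that the diagonal matrix with entry `x` lies in the `j`-th filtration step. -/
def diagFil (F : Type*) {S : Type*} [Field F] [ValuativeRel F] [TopologicalSpace F]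
    [IsNonarchimedeanLocalField F] [DivisionRing S] [Algebra F S] [Module.Finite F S]
    {V : Type*} [AddCommGroup V] [Module S V] {ι : Type*} [Fintype ι] [DecidableEq ι]
    (b : Module.Basis ι S V) (L : ℤ → AddSubgroup V) (k : ι) (j : ℤ) : AddSubgroup S :=
  (fil S L j).comap (elemHom b k k)

lemma mem_diagFil {k : ι} {j : ℤ} {x : S} :
    x ∈ diagFil F b L k j ↔ x = 0 ∨ j ≤ r * (divVal F S).v x :=
  AddSubgroup.mem_comap.trans h.elem_diag_mem_fil

lemma mul_mem_diagFil {k : ι} {j : ℤ} : ∀ u ∈ (divVal F S).ball 0, ∀ x ∈ diagFil F b L k j,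
    u * x ∈ diagFil F b L k j := by
  intro u hu x hx
  rw [mem_diagFil h] at hx ⊢
  rcases eq_or_ne u 0 with rfl | hu0
  · simp
  rcases eq_or_ne x 0 with rfl | hx0
  · simp
  right
  rw [ZVal.v_mul _ _ _ hu0 hx0]
  have h1 := hx.resolve_left hx0
  have h2 : 0 ≤ (divVal F S).v u := ((divVal F S).mem_ball_of_ne hu0).1 hu
  nlinarith

lemma conj_mem_diagFil {k : ι} {j : ℤ} : ∀ g, g ≠ 0 → ∀ x ∈ diagFil F b L k j,
    g * x * g⁻¹ ∈ diagFil F b L k j := by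
  intro g hg x hx
  rw [mem_diagFil h] at hx ⊢
  rcases eq_or_ne x 0 with rfl | hx0
  · simp
  right
  rw [ZVal.v_mul _ _ _ (mul_ne_zero hg hx0) (inv_ne_zero hg), ZVal.v_mul _ _ _ hg hx0,
    ZVal.v_inv _ hg, add_neg_cancel_comm]
  exact hx.resolve_left hx0

lemma algebraMap_mem_diagFil {k : ι} {j : ℤ} {t : F} (ht : t ≠ 0) :
    algebraMap F S t ∈ diagFil F b L k j ↔ j ≤ (r * divRam F S : ℕ) * addVal F t := by
  rw [mem_diagFil h, divVal_algebraMap ht, or_iff_right (by simpa using ht)]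
  push_cast
  rw [mul_assoc]

variable [Algebra.IsCentral F S]

omit h in
lemma reducedTrace_smul (d : CyclicData F S) (b : Module.Basis ι S V) (c : F)
    (y : Module.End S V) :
    reducedTrace F (c • y) = c * reducedTrace F y := by
  simp_rw [reducedTrace_eq d b, entry_smul, map_smul, smul_eq_mul, Finset.mul_sum]

lemma algebraMap_reducedTrace_mem (d : CyclicData F S) {j : ℤ} {y : Module.End S V}
    (hy : y ∈ fil S L j) (k : ι) : algebraMap F S (reducedTrace F y) ∈ diagFil F b L k j := by
  rw [reducedTrace_eq d b, map_sum]
  exact sum_mem fun l _ ↦ d.trd_mem (mul_mem_diagFil h) (conj_mem_diagFil h)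
    ((mem_diagFil h).2 (h.elem_diag_mem_fil.1 (h.elem_entry_mem_fil hy l l)))

lemma addChar_reducedTrace_eq_one {ψ : AddChar F ℂ} (hψ : HasConductorMaximalIdeal ψ)
    {y : Module.End S V} (hy : y ∈ fil S L 1) : ψ (reducedTrace F y) = 1 := by
  obtain ⟨d⟩ := exists_cyclicData F S
  obtain ⟨k, -⟩ := h.surj 0
  apply hψ.eq_one
  rcases eq_or_ne (reducedTrace F y) 0 with h0 | h0
  · rw [h0]
    exact zero_mem _
  have h1 := (algebraMap_mem_diagFil h h0).1 (algebraMap_reducedTrace_mem h d hy k)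
  rw [ZVal.mem_ball_of_ne _ h0, fieldVal_v]
  by_contra! hlt
  nlinarith

/-- The restriction of a character to a congruence subgroup factors through the reduced trace. -/
theorem exists_oneAdd_eq_addChar {ψ : AddChar F ℂ} (hψ : HasConductorMaximalIdeal ψ)
    (χ : (Module.End S V)ˣ →* ℂˣ) {n j : ℤ} (hj : 1 ≤ j) (hjn : n + 1 ≤ 2 * j) (hjn' : j ≤ n)
    (htriv : ∀ y ∈ fil S L (n + 1), oneAdd χ y = 1) (hne : ∃ y ∈ fil S L n, oneAdd χ y ≠ 1) :
    ∃ c : F, c ≠ 0 ∧ (r * divRam F S : ℕ) * addVal F c = -n ∧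
      ∀ y ∈ fil S L j, ((oneAdd χ y : ℂˣ) : ℂ) = ψ (reducedTrace F (c • y)) := by
  obtain ⟨d⟩ := exists_cyclicData F S
  obtain ⟨k, -⟩ := h.surj 0
  obtain ⟨z, -, hz0, hz⟩ := d.exists_trace_eq_one
  obtain ⟨q, hqdef⟩ : ∃ q : ℤ, ((r * divRam F S : ℕ) : ℤ) = q := ⟨_, rfl⟩
  have hq : 0 < q := by
    rw [← hqdef]
    exact_mod_cast Nat.mul_pos h.r_pos divRam_pos
  have hmemq {i : ℤ} {t : F} (ht : t ≠ 0) :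
      algebraMap F S t ∈ diagFil F b L k i ↔ i ≤ q * addVal F t := by
    rw [algebraMap_mem_diagFil h ht, hqdef]
  -- Since `z` has reduced trace one, `t * z` is an element of reduced trace `t`; its integrality
  -- keeps the order of `t`.
  let θ (t : F) : ℂˣ := oneAdd χ (elem b k k (algebraMap F S t * z))
  have hmem {i : ℤ} {t : F} (ht : t = 0 ∨ i ≤ q * addVal F t) :
      algebraMap F S t * z ∈ diagFil F b L k i := by
    rw [Algebra.commutes]
    refine mul_mem_diagFil h z hz0 _ ?_
    rcases eq_or_ne t 0 with rfl | h0
    · simp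
    · exact (hmemq h0).2 (ht.resolve_left h0)
  have hθ_one {t : F} (ht : t = 0 ∨ n + 1 ≤ q * addVal F t) : θ t = 1 := htriv _ (hmem ht)
  have hθ_add {s t : F} (hs : s = 0 ∨ j ≤ q * addVal F s) (ht : t = 0 ∨ j ≤ q * addVal F t) :
      θ (s + t) = θ s * θ t := by
    change oneAdd χ _ = _
    rw [map_add, add_mul, elem_add]
    exact h.oneAdd_add χ hj hjn htriv (hmem hs) (hmem ht)
  have hχθ {y : Module.End S V} (hy : y ∈ fil S L j) : oneAdd χ y = θ (reducedTrace F y) := by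
    rw [h.oneAdd_eq_sum_diag χ hj hjn htriv (exists_ne_zero_ne_one F S) k hy]
    have := d.eq_of_conj_invariant (X := diagFil F b L k j) (mul_mem_diagFil h)
      (conj_mem_diagFil h) (lam := fun x ↦ Additive.ofMul (oneAdd χ (elem b k k x)))
      (fun x hx y hy ↦ by
        rw [elem_add]
        exact congrArg Additive.ofMul (h.oneAdd_add χ hj hjn htriv hx hy))
      (fun g hg x hx ↦ congrArg Additive.ofMul (h.oneAdd_diag_conj χ hj hg hx)) hz0 hz
      (x := ∑ l, entry b y l l) (sum_mem fun l _ ↦ (mem_diagFil h).2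
        (h.elem_diag_mem_fil.1 (h.elem_entry_mem_fil hy l l)))
    rw [map_sum, ← reducedTrace_eq d b] at this
    exact Additive.ofMul.injective this
  obtain ⟨y, hy, hy1⟩ := hne
  rw [hχθ (h.fil_anti hjn' hy)] at hy1
  set t := reducedTrace F y
  have ht0 : t ≠ 0 := fun h0 ↦ hy1 (hθ_one (Or.inl h0))
  -- The trace bound gives `n ≤ q * addVal F t`, and `θ t ≠ 1` excludes strict inequality. In
  -- particular `q` divides `n`.
  have htn : q * addVal F t = n := by
    have h1 := (hmemq ht0).1 (algebraMap_reducedTrace_mem h d hy k)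
    by_contra hcon
    exact hy1 (hθ_one (Or.inr (lt_of_le_of_ne h1 (Ne.symm hcon))))
  obtain ⟨m, hm⟩ : ∃ m : ℤ, ∀ v, m ≤ v ↔ j ≤ q * v := by
    -- This is the quotient `j / q` rounded up.
    refine ⟨-(-j / q), fun v ↦ ?_⟩
    rw [neg_le, Int.le_ediv_iff_mul_le hq]
    constructor <;> intro _ <;> linarith
  have hball {i : ℤ} {x : F} : x ∈ (fieldVal F).ball i ↔ x = 0 ∨ i ≤ addVal F x := Iff.rfl
  have hone : ∀ x ∈ (fieldVal F).ball (addVal F t + 1), ((θ x : ℂˣ) : ℂ) = 1 := fun x hx ↦ by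
    rw [hθ_one ((hball.1 hx).imp_right fun h1 ↦ by nlinarith), Units.val_one]
  have hmt : m ≤ addVal F t := (hm _).2 (by lia)
  obtain ⟨c, hc⟩ := exists_eq_addChar_mul hψ (θ := fun t ↦ ((θ t : ℂˣ) : ℂ)) hmt
    (fun x hx y hy ↦ by
      rw [hθ_add ((hball.1 hx).imp_right (hm _).1) ((hball.1 hy).imp_right (hm _).1),
        Units.val_mul]) hone
  obtain ⟨hc0, hcv⟩ := addVal_eq_of_addChar_mul hψ (c := c) (h := addVal F t)
    (fun x hx ↦ by rw [← hc x ((fieldVal F).ball_anti (by lia) hx), hone x hx])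
    ⟨t, hball.2 (Or.inr le_rfl), by
      rw [← hc t (hball.2 (Or.inr hmt))]
      exact fun h1 ↦ hy1 (Units.ext h1)⟩
  refine ⟨c, hc0, by rw [hcv, hqdef]; lia, fun y hy ↦ ?_⟩
  rw [hχθ hy, reducedTrace_smul d b]
  refine hc _ (hball.2 ?_)
  rcases eq_or_ne (reducedTrace F y) 0 with h0 | h0
  · exact Or.inl h0
  · exact Or.inr ((hm _).2
      ((hmemq h0).1 (algebraMap_reducedTrace_mem h d hy k)))

end Main

/-! ### From the order to the filtration, and the case of level zero -/

section Scalar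

variable {F : Type*} [Field F] [ValuativeRel F] [TopologicalSpace F] [IsNonarchimedeanLocalField F]
  {S : Type*} [DivisionRing S] [Algebra F S] [Module.Finite F S] [Algebra.IsCentral F S]
  {V : Type*} [AddCommGroup V] [Module S V] [Module F V] [IsScalarTower F S V]
  {L : ℤ → AddSubgroup V} {r : ℕ} {ι : Type*} [Fintype ι] [DecidableEq ι]
  {b : Module.Basis ι S V} {a : ι → ℤ} (h : IsSplit (divVal F S) L r b a)
  {𝔄 : Subalgebra 𝒪[F] (Module.End S V)} (h𝔄 : ∀ f, f ∈ 𝔄 ↔ f ∈ fil S L 0)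

include h h𝔄

theorem exists_scalar {ψ : AddChar F ℂ} (hψ : HasConductorMaximalIdeal ψ)
    (χ : (Module.End S V)ˣ →* ℂˣ) (n : ℕ) (htriv : ∀ u ∈ unitFiltration 𝔄 (n + 1), χ u = 1)
    (hnontriv : ∃ u ∈ unitFiltration 𝔄 n, χ u ≠ 1) :
    ∃ c : F, c ≠ 0 ∧ (addVal F c : ℚ) = -(n : ℚ) / (ramificationIndex 𝔄 : ℚ) ∧
      ∀ y ∈ radicalPow 𝔄 (n / 2 + 1), ∃ u : (Module.End S V)ˣ, (u : Module.End S V) = 1 + y ∧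
        ((χ u : ℂˣ) : ℂ) = ψ (reducedTrace F (c • y)) := by
  have hunit {m : ℕ} {y : Module.End S V} (hy : y ∈ fil S L (m + 1 : ℕ)) :
      ∃ u : (Module.End S V)ˣ, (u : Module.End S V) = 1 + y ∧ u ∈ unitFiltration 𝔄 (m + 1) := by
    obtain ⟨u, hu⟩ := h.isUnit_one_add (by lia) hy
    exact ⟨u, hu, y, (mem_radicalPow h h𝔄).2 hy, hu⟩
  have htriv' : ∀ y ∈ fil S L (n + 1 : ℕ), oneAdd χ y = 1 := fun y hy ↦ by
    obtain ⟨u, hu, hu'⟩ := hunit hy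
    rw [oneAdd_eq χ hu, htriv u hu']
  rw [ramificationIndex_eq h h𝔄]
  cases n with
  | zero =>
    -- At level zero `χ` is trivial on `1 + 𝔓`, and the reduced trace maps `𝔓` into the kernel of
    -- `ψ`, so any unit of `𝔬_F` would serve.
    refine ⟨1, one_ne_zero, by simp [addVal_one], fun y hy ↦ ?_⟩
    have hy' := (mem_radicalPow h h𝔄).1 hy
    obtain ⟨u, hu, hu'⟩ := hunit hy'
    refine ⟨u, hu, ?_⟩
    rw [htriv u hu', one_smul, addChar_reducedTrace_eq_one h hψ hy', Units.val_one]
  | succ m =>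
    have hne : ∃ y ∈ fil S L (m + 1 : ℕ), oneAdd χ y ≠ 1 := by
      obtain ⟨u, ⟨y, hy, hu⟩, hχ⟩ := hnontriv
      exact ⟨y, (mem_radicalPow h h𝔄).1 hy, by rwa [oneAdd_eq χ hu]⟩
    -- For a level `n = m + 1`, `j = ⌊n / 2⌋ + 1` satisfies `n + 1 ≤ 2 * j`; `j ≤ n` holds because
    -- `n` is positive.
    obtain ⟨c, hc0, hcv, hc⟩ := exists_oneAdd_eq_addChar h hψ χ (n := (m + 1 : ℕ))
      (j := ((m + 1) / 2 + 1 : ℕ)) (by lia) (by lia) (by lia) htriv' hne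
    refine ⟨c, hc0, ?_, fun y hy ↦ ?_⟩
    · have hq : ((r * divRam F S : ℕ) : ℚ) ≠ 0 := by
        exact_mod_cast (Nat.mul_pos h.r_pos divRam_pos).ne'
      rw [eq_div_iff hq, mul_comm]
      exact_mod_cast hcv
    · have hy' := (mem_radicalPow h h𝔄).1 hy
      obtain ⟨u, hu, -⟩ := hunit hy'
      exact ⟨u, hu, by rw [← oneAdd_eq χ hu, hc y hy']⟩

end Scalar

/-! ### Right vector spaces over `D` as left vector spaces over `Dᵐᵒᵖ` -/

section Opposite

variable {F : Type*} [Field F] [ValuativeRel F] [TopologicalSpace F] [IsNonarchimedeanLocalField F]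
  {D : Type*} [DivisionRing D] [Algebra F D] [Module.Finite F D]

lemma isIntegral_op_iff {R A : Type*} [CommRing R] [Ring A] [Algebra R A] {x : A} :
    IsIntegral R (MulOpposite.op x) ↔ IsIntegral R x := by
  refine exists_congr fun p ↦ and_congr_right fun _ ↦ ?_
  rw [← Polynomial.aeval_def, ← Polynomial.aeval_def, Polynomial.aeval_eq_sum_range,
    Polynomial.aeval_eq_sum_range]
  simp_rw [← MulOpposite.op_pow, ← MulOpposite.op_smul, ← Finset.op_sum]
  exact MulOpposite.op_eq_zero_iff _

lemma op_mem_ball_zero {x : D} :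
    MulOpposite.op x ∈ (divVal F Dᵐᵒᵖ).ball 0 ↔ x ∈ integers F D :=
  mem_divVal_ball_zero.trans isIntegral_op_iff

/-- An integral element of valuation zero has an integral inverse, so the non-units are exactly
those of positive valuation. -/
lemma op_mem_ball_one {x : D} :
    MulOpposite.op x ∈ (divVal F Dᵐᵒᵖ).ball 1 ↔ x ∈ maximalIdeal F D := by
  set w := divVal F Dᵐᵒᵖ
  constructor
  · intro hx
    refine ⟨op_mem_ball_zero.1 (w.ball_anti zero_le_one hx), fun y hy hxy ↦ ?_⟩
    have h1 := w.mul_mem_ball (op_mem_ball_zero.2 hy) hx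
    rw [← MulOpposite.op_mul, hxy] at h1
    exact w.one_notMem_ball_one (by simpa using h1)
  · rintro ⟨hx, hxy⟩
    by_contra hcon
    have hx0 : MulOpposite.op x ≠ 0 := by
      rintro h0
      exact hcon (h0 ▸ zero_mem _)
    rw [w.mem_ball_of_ne hx0] at hcon
    refine hxy x⁻¹ (op_mem_ball_zero.1 ?_) (mul_inv_cancel₀ ((MulOpposite.op_ne_zero_iff _).1 hx0))
    rw [MulOpposite.op_inv, w.mem_ball_of_ne (inv_ne_zero hx0), w.v_inv hx0]
    lia

lemma IsUniformChain.exists_isChain {V : Type*} [AddCommGroup V] [Module F V] [Module Dᵐᵒᵖ V]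
    [IsScalarTower F Dᵐᵒᵖ V] {L : ℤ → AddSubgroup V} (hL : IsUniformChain F D L) :
    ∃ r : ℕ, IsChain F (S := Dᵐᵒᵖ) L r := by
  obtain ⟨r, hr, hper⟩ := hL.periodic
  refine ⟨r, hr, fun x hx i v hv ↦ ?_, (hL.isLattice 0).isCompact, (hL.isLattice 0).isOpen,
    fun i j hij ↦ ?_, fun i ↦ SetLike.exists_of_lt (hL.strict i), fun i ↦ ?_⟩
  · exact (hL.isLattice i).smul_mem x.unop (op_mem_ball_zero.1 hx) v hv
  · rcases hij.eq_or_lt with rfl | hlt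
    · exact le_rfl
    · exact hL.antitone i j hlt
  · rw [hper, mulMaximalIdeal]
    congr 1
    ext u
    refine exists_congr fun v ↦ and_congr_right fun _ ↦ ?_
    rw [MulOpposite.op_surjective.exists]
    simp_rw [op_mem_ball_one]

end Opposite

end PrincipalOrderCharacter

end

/-! ### The main theorem -/

theorem mainTheorem8
    {F : Type*} [Field F] [ValuativeRel F] [TopologicalSpace F] [IsNonarchimedeanLocalField F]
    {D : Type*} [DivisionRing D] [Algebra F D] [Algebra.IsCentral F D] [Module.Finite F D]
    {V : Type*} [AddCommGroup V] [Module F V] [Module Dᵐᵒᵖ V] [IsScalarTower F Dᵐᵒᵖ V]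
    [Module.Finite F V]
    (ψ : AddChar F ℂ) (hψ : PrincipalOrderCharacter.HasConductorMaximalIdeal ψ)
    (χ : (Module.End Dᵐᵒᵖ V)ˣ →* ℂˣ) (hχ : PrincipalOrderCharacter.IsSmoothCharacter F χ)
    (𝔄 : Subalgebra 𝒪[F] (Module.End Dᵐᵒᵖ V))
    (h𝔄 : PrincipalOrderCharacter.IsPrincipalOrder F D 𝔄)
    (n : ℕ)
    (htriv : ∀ u ∈ PrincipalOrderCharacter.unitFiltration 𝔄 (n + 1), χ u = 1)
    (hnontriv : ∃ u ∈ PrincipalOrderCharacter.unitFiltration 𝔄 n, χ u ≠ 1) :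
    ∃ c : F, c ≠ 0 ∧
      (PrincipalOrderCharacter.addVal F c : ℚ)
        = -(n : ℚ) / (PrincipalOrderCharacter.ramificationIndex 𝔄 : ℚ) ∧
      ∀ y ∈ PrincipalOrderCharacter.radicalPow 𝔄 (n / 2 + 1),
        ∃ u : (Module.End Dᵐᵒᵖ V)ˣ, (u : Module.End Dᵐᵒᵖ V) = 1 + y ∧
          ((χ u : ℂˣ) : ℂ) = ψ (PrincipalOrderCharacter.reducedTrace F (c • y)) := by
  obtain ⟨L, hL, hA⟩ := h𝔄
  obtain ⟨r, hr⟩ := hL.exists_isChain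
  obtain ⟨m, b, a, h⟩ := hr.exists_isSplit
  exact PrincipalOrderCharacter.exists_scalar h
    (fun f ↦ by simp_rw [hA, PrincipalOrderCharacter.mem_fil, add_zero]) hψ χ n htriv hnontriv
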